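/- Let $d\ge 1$, $\delta>0$, $\alpha\in\mathbb R$ and $1\le p,q<\infty$. Write $\hat f(\xi)=\int_{\mathbb R^d} f(x)e^{-ix\cdot\xi}\,dx$ for the Fourier transform, extended to tempered distributions as usual. Let $\phi_0,\psi$ be Schwartz functions on $\mathbb R^d$ such that $\hat\phi_0$ is supported in $\{|\xi|\le 2\}$, $\hat\psi$ is supported in $\{1/2\le|\xi|\le 2\}$, and $\hat\phi_0(\xi)+\sum_{l\ge 1}\hat\psi(2^{-l}\xi)=1$ for all $\xi\in\mathbb R^d$; put $\psi_l=2^{ld}\psi(2^l\,\cdot)$. The Triebel–Lizorkin space $F^\alpha_{p,q}$ and the Besov space $B^\alpha_{p,q}$ consist of all tempered distributions $f$ on $\mathbb R^d$ with, respectively, $$\|f\|_{F^\alpha_{p,q}}=\|\phi_0*f\|_p+\Big\|\Big(\sum_{l\ge1}2^{l\alpha q}|\psi_l*f|^q\Big)^{1/q}\Big\|_p<\infty,\qquad \|f\|_{B^\alpha_{p,q}}=\|\phi_0*f\|_p+\Big(\sum_{l\ge1}2^{l\alpha q}\|\psi_l*f\|_p^q\Big)^{1/q}<\infty.$$ For a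 Schwartz function $f$, the Bochner–Riesz mean $B_\delta f$ is defined by $\widehat{B_\delta f}(\xi)=(1-|\xi|^2)_+^\delta\,\hat f(\xi)$, where $t_+=\max(t,0)$. Let $X$ be $F^\alpha_{p,q}$ or $B^\alpha_{p,q}$. We say that $B_\delta$ is bounded on $X$ if there is a constant $C$ with $\|B_\delta f\|_X\le C\|f\|_X$ for all Schwartz functions $f$. Theorem. If $B_\delta$ is bounded on $X$, then it extends from the Schwartz functions to a unique bounded linear operator on $X$, and the spectrum of this operator, that is, the set of all $z\in\mathbb C$ for which $zI-B_\delta$ has no bounded inverse on $X$, is the unit interval $[0,1]$. -/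

import Mathlib

open MeasureTheory SchwartzMap Filter Topology
open scoped ENNReal NNReal FourierTransform

namespace BochnerRiesz

noncomputable section

/-- The Euclidean space `ℝᵈ`. -/
abbrev Eucl (d : ℕ) : Type := EuclideanSpace ℝ (Fin d)

/-! ### Fourier transform -/

/-- The Fourier transform `f̂(ξ) = ∫ f(x) e^{-i x·ξ} dx` (no factor `2π` in the phase). -/
def hat {d : ℕ} (f : Eucl d → ℂ) (ξ : Eucl d) : ℂ :=
  ∫ x, Complex.exp (-(Complex.I * (inner ℝ x ξ : ℝ))) * f x

/-- The relation with Mathlib's Fourier transform `∫ f(x) e^{-2π i x·η} dx`. -/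
theorem fourier_eq_hat {d : ℕ} (f : 𝓢(Eucl d, ℂ)) (η : Eucl d) :
    𝓕 f η = hat f ((2 * Real.pi) • η) := by
  rw [SchwartzMap.fourier_coe, Real.fourier_eq']
  unfold hat
  congr 1
  ext x
  rw [smul_eq_mul, inner_smul_right]
  congr 2
  push_cast
  ring

/-! ### Bochner-Riesz means on Schwartz functions -/

/-- The symbol `(1 - |ξ|²)₊^δ`. -/
def symbol (d : ℕ) (δ : ℝ) (ξ : Eucl d) : ℝ := (max (1 - ‖ξ‖ ^ 2) 0) ^ δ

theorem measurable_symbol (d : ℕ) (δ : ℝ) : Measurable (symbol d δ) := by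
  unfold symbol
  fun_prop

theorem norm_symbol_le {d : ℕ} {δ : ℝ} (hδ : 0 ≤ δ) (ξ : Eucl d) : ‖symbol d δ ξ‖ ≤ 1 := by
  unfold symbol
  have h0 : 0 ≤ max (1 - ‖ξ‖ ^ 2) 0 := le_max_right _ _
  rw [Real.norm_of_nonneg (Real.rpow_nonneg h0 _)]
  refine Real.rpow_le_one h0 (max_le ?_ zero_le_one) hδ
  nlinarith [sq_nonneg ‖ξ‖]

theorem memLp_symbol_mul_fourier {d : ℕ} {δ : ℝ} (hδ : 0 ≤ δ) (f : 𝓢(Eucl d, ℂ)) :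
    MemLp (fun η => (symbol d δ ((2 * Real.pi) • η) : ℂ) * 𝓕 f η) 1 volume := by
  refine MemLp.of_le ((𝓕 f).memLp 1 volume) ?_ (Eventually.of_forall fun η => ?_)
  · refine AEStronglyMeasurable.mul ?_ (𝓕 f).continuous.aestronglyMeasurable
    have := measurable_symbol d δ
    exact (by fun_prop : Measurable
      (fun η : Eucl d => (symbol d δ ((2 * Real.pi) • η) : ℂ))).aestronglyMeasurable
  · rw [norm_mul, Complex.norm_real]
    exact mul_le_of_le_one_left (norm_nonneg _) (norm_symbol_le hδ _)

/-- The Bochner-Riesz mean `B_δ f` of a Schwartz function `f`, as a tempered distribution: the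
inverse Fourier transform of the integrable function `(1 - |ξ|²)₊^δ f̂(ξ)`. In terms of Mathlib's
Fourier transform, in which the frequency variable is `η = ξ / (2π)`, this reads
`𝓕 (B_δ f) (η) = (1 - |2πη|²)₊^δ 𝓕 f (η)`. -/
def mean {d : ℕ} (δ : ℝ) (hδ : 0 < δ) (f : 𝓢(Eucl d, ℂ)) : 𝓢'(Eucl d, ℂ) :=
  𝓕⁻ (Lp.toTemperedDistribution ((memLp_symbol_mul_fourier hδ.le f).toLp _))

/-- The defining property of `B_δ f`, tested against Schwartz functions. -/
theorem fourier_mean_apply {d : ℕ} (δ : ℝ) (hδ : 0 < δ) (f g : 𝓢(Eucl d, ℂ)) :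
    𝓕 (mean δ hδ f) g =
      ∫ η, g η * ((symbol d δ ((2 * Real.pi) • η) : ℂ) * hat f ((2 * Real.pi) • η)) := by
  rw [mean, FourierTransform.fourier_fourierInv_eq, Lp.toTemperedDistribution_apply]
  refine integral_congr_ae ?_
  filter_upwards [(memLp_symbol_mul_fourier hδ.le f).coeFn_toLp] with η hη
  rw [hη, fourier_eq_hat, smul_eq_mul]

/-! ### Convolution of a Schwartz function with a tempered distribution -/

/-- The Schwartz function `y ↦ K (x - y)`. -/
def reflectTranslate {d : ℕ} (K : 𝓢(Eucl d, ℂ)) (x : Eucl d) : 𝓢(Eucl d, ℂ) :=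
  compSubConstCLM ℂ x (compCLMOfContinuousLinearEquiv ℂ (ContinuousLinearEquiv.neg ℝ) K)

theorem reflectTranslate_apply {d : ℕ} (K : 𝓢(Eucl d, ℂ)) (x y : Eucl d) :
    reflectTranslate K x y = K (x - y) := by
  simp [reflectTranslate]

/-- The convolution `K * f`, the function `x ↦ ⟨f, K (x - ·)⟩`. -/
def conv {d : ℕ} (K : 𝓢(Eucl d, ℂ)) (f : 𝓢'(Eucl d, ℂ)) (x : Eucl d) : ℂ :=
  f (reflectTranslate K x)

theorem continuous_translate {d : ℕ} (K : 𝓢(Eucl d, ℂ)) :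
    Continuous (fun x : Eucl d => compSubConstCLM ℂ x K) := by
  rw [continuous_iff_continuousAt]
  intro x₀
  rw [ContinuousAt, (schwartz_withSeminorms ℂ (Eucl d) ℂ).tendsto_nhds]
  rintro ⟨k, n⟩ ε hε
  set C : ℝ := 2 ^ k * (Finset.Iic ((k, n + 1) : ℕ × ℕ)).sup
    (fun m => SchwartzMap.seminorm ℂ m.1 m.2) K with hC
  have hC0 : 0 ≤ C := by positivity
  set M : ℝ := (1 + ‖x₀‖) ^ k * C with hM
  have hM0 : 0 ≤ M := by positivity
  have hball : Metric.ball x₀ (min 1 (ε / (M + 1))) ∈ 𝓝 x₀ :=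
    Metric.ball_mem_nhds _ (lt_min one_pos (by positivity))
  filter_upwards [hball] with x hx
  rw [Metric.mem_ball, dist_eq_norm, lt_min_iff] at hx
  have key : SchwartzMap.seminorm ℂ k n (compSubConstCLM ℂ x K - compSubConstCLM ℂ x₀ K)
      ≤ M * ‖x - x₀‖ := by
    refine SchwartzMap.seminorm_le_bound ℂ k n _ (by positivity) fun y => ?_
    have hder : iteratedFDeriv ℝ n (⇑(compSubConstCLM ℂ x K - compSubConstCLM ℂ x₀ K)) y =
        iteratedFDeriv ℝ n K (y - x) - iteratedFDeriv ℝ n K (y - x₀) := by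
      have h1 : (⇑(compSubConstCLM ℂ x K - compSubConstCLM ℂ x₀ K)) =
          (fun z => K (z - x)) - (fun z => K (z - x₀)) := by
        ext z; simp
      have hs (a : Eucl d) : ContDiff ℝ n (fun z => K (z - a)) :=
        (K.smooth n).comp (contDiff_id.sub contDiff_const)
      rw [h1, iteratedFDeriv_sub (hs x) (hs x₀), Pi.sub_apply,
        iteratedFDeriv_comp_sub, iteratedFDeriv_comp_sub]
    rw [hder]
    have hdiff : Differentiable ℝ (iteratedFDeriv ℝ n K) :=
      (K.smooth ⊤).differentiable_iteratedFDeriv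
        (by exact_mod_cast (WithTop.coe_lt_top n))
    have hmv := (convex_ball (y - x₀) 1).norm_image_sub_le_of_norm_fderiv_le
      (f := fun w => ‖y‖ ^ k • iteratedFDeriv ℝ n K w) (C := M) (𝕜 := ℝ)
      (x := y - x₀) (y := y - x)
      (fun w _ => (hdiff w).fun_const_smul _) (fun w hw => ?_)
      (Metric.mem_ball_self one_pos)
      (by
        rw [Metric.mem_ball, dist_eq_norm]
        have : y - x - (y - x₀) = -(x - x₀) := by abel
        rw [this, norm_neg]; exact hx.1)
    · rw [← smul_sub, norm_smul, norm_pow, norm_norm] at hmv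
      have : y - x - (y - x₀) = -(x - x₀) := by abel
      rwa [this, norm_neg] at hmv
    · rw [fderiv_fun_const_smul (hdiff w), norm_smul, norm_pow, norm_norm,
        norm_fderiv_iteratedFDeriv]
      have hy : ‖y‖ ≤ (1 + ‖x₀‖) * (1 + ‖w‖) := by
        rw [Metric.mem_ball, dist_eq_norm] at hw
        have h3 : y = -(w - (y - x₀)) + w + x₀ := by abel
        have h4 : ‖y‖ ≤ ‖w - (y - x₀)‖ + ‖w‖ + ‖x₀‖ := by
          calc ‖y‖ = ‖-(w - (y - x₀)) + w + x₀‖ := by rw [← h3]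
            _ ≤ ‖-(w - (y - x₀))‖ + ‖w‖ + ‖x₀‖ := norm_add₃_le
            _ = _ := by rw [norm_neg]
        nlinarith [norm_nonneg w, norm_nonneg x₀]
      calc ‖y‖ ^ k * ‖iteratedFDeriv ℝ (n + 1) K w‖
          ≤ ((1 + ‖x₀‖) * (1 + ‖w‖)) ^ k * ‖iteratedFDeriv ℝ (n + 1) K w‖ := by gcongr
        _ = (1 + ‖x₀‖) ^ k * ((1 + ‖w‖) ^ k * ‖iteratedFDeriv ℝ (n + 1) K w‖) := by
            rw [mul_pow, mul_assoc]
        _ ≤ M := by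
            rw [hM]
            gcongr
            exact SchwartzMap.one_add_le_sup_seminorm_apply (𝕜 := ℂ) (m := (k, n + 1))
              le_rfl le_rfl K w
  refine lt_of_le_of_lt key ?_
  have h5 : ‖x - x₀‖ * (M + 1) < ε := (lt_div_iff₀ (by positivity)).1 hx.2
  nlinarith [norm_nonneg (x - x₀)]

theorem continuous_conv {d : ℕ} (K : 𝓢(Eucl d, ℂ)) (f : 𝓢'(Eucl d, ℂ)) :
    Continuous (conv K f) :=
  (map_continuous f).comp (continuous_translate _)

/-- The Schwartz function `ψ_l = 2^{ld} ψ(2^l ·)`. -/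
def dyadic {d : ℕ} (ψ : 𝓢(Eucl d, ℂ)) (l : ℕ) : 𝓢(Eucl d, ℂ) :=
  ((2 : ℂ) ^ (l * d)) • compCLMOfContinuousLinearEquiv ℂ
    (ContinuousLinearEquiv.smulLeft (Units.mk0 ((2 : ℝ) ^ l) (by positivity))) ψ

theorem dyadic_apply {d : ℕ} (ψ : 𝓢(Eucl d, ℂ)) (l : ℕ) (x : Eucl d) :
    dyadic ψ l x = 2 ^ (l * d) * ψ ((2 : ℝ) ^ l • x) := by
  simp [dyadic, Units.smul_def]

/-- Schwartz functions `φ₀, ψ` with `supp φ̂₀ ⊆ {|ξ| ≤ 2}`, `supp ψ̂ ⊆ {1/2 ≤ |ξ| ≤ 2}` and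
`φ̂₀(ξ) + ∑_{l ≥ 1} ψ̂(2^{-l} ξ) = 1` for all `ξ`. -/
structure LittlewoodPaley (d : ℕ) where
  φ₀ : 𝓢(Eucl d, ℂ)
  ψ : 𝓢(Eucl d, ℂ)
  support_φ₀ : ∀ ξ, hat φ₀ ξ ≠ 0 → ‖ξ‖ ≤ 2
  support_ψ : ∀ ξ, hat ψ ξ ≠ 0 → 1 / 2 ≤ ‖ξ‖ ∧ ‖ξ‖ ≤ 2
  partition : ∀ ξ, HasSum (fun l : ℕ => hat ψ (((2 : ℝ) ^ (l + 1))⁻¹ • ξ)) (1 - hat φ₀ ξ)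

/-! ### Spaces of tempered distributions given by an extended norm -/

/-- A `[0, ∞]`-valued seminorm on tempered distributions. -/
structure ExtSeminorm (d : ℕ) where
  toFun : 𝓢'(Eucl d, ℂ) → ℝ≥0∞
  smul' : ∀ (c : ℂ) f, toFun (c • f) = ‖c‖ₑ * toFun f
  add_le' : ∀ f g, toFun (f + g) ≤ toFun f + toFun g

namespace ExtSeminorm

variable {d : ℕ} (N : ExtSeminorm d)

/-- The subspace of tempered distributions `f` with `N f < ∞`. -/
def finite : Submodule ℂ 𝓢'(Eucl d, ℂ) where
  carrier := {f | N.toFun f < ∞}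
  zero_mem' := by
    have h : N.toFun 0 = 0 := by
      have e : (0 : ℂ) • (0 : 𝓢'(Eucl d, ℂ)) = 0 := by
        ext g
        exact smul_zero (0 : ℂ)
      calc N.toFun 0 = N.toFun ((0 : ℂ) • 0) := congrArg N.toFun e.symm
        _ = 0 := by rw [N.smul', enorm_zero, zero_mul]
    change N.toFun 0 < ∞
    rw [h]
    exact ENNReal.zero_lt_top
  add_mem' {f g} hf hg := (N.add_le' f g).trans_lt (ENNReal.add_lt_top.2 ⟨hf, hg⟩)
  smul_mem' c f hf := by
    change N.toFun (c • f) < ∞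
    rw [N.smul']
    exact ENNReal.mul_lt_top enorm_lt_top hf

/-- The space of all tempered distributions `f` with `N f < ∞`, to be normed by `N` (and not to
carry the topology of tempered distributions). -/
def Space : Type := N.finite

instance : AddCommGroup N.Space := inferInstanceAs (AddCommGroup N.finite)

instance : Module ℂ N.Space := inferInstanceAs (Module ℂ N.finite)

/-- The tempered distribution underlying an element of the space. -/
def Space.distr {N : ExtSeminorm d} (u : N.Space) : 𝓢'(Eucl d, ℂ) := N.finite.subtype u

theorem Space.toFun_distr_lt_top {N : ExtSeminorm d} (u : N.Space) : N.toFun u.distr < ∞ :=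
  Subtype.property (p := fun f => f ∈ N.finite) u

instance : Norm N.Space := ⟨fun u => (N.toFun u.distr).toReal⟩

theorem core : SeminormedSpace.Core ℂ N.Space where
  norm_nonneg _ := ENNReal.toReal_nonneg
  norm_smul c u := by
    change (N.toFun (c • u.distr)).toReal = ‖c‖ * (N.toFun u.distr).toReal
    rw [N.smul', ENNReal.toReal_mul, toReal_enorm]
  norm_triangle u v := by
    change (N.toFun (u.distr + v.distr)).toReal ≤
      (N.toFun u.distr).toReal + (N.toFun v.distr).toReal
    rw [← ENNReal.toReal_add u.toFun_distr_lt_top.ne v.toFun_distr_lt_top.ne]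
    exact ENNReal.toReal_mono
      (ENNReal.add_lt_top.2 ⟨u.toFun_distr_lt_top, v.toFun_distr_lt_top⟩).ne (N.add_le' _ _)

instance : SeminormedAddCommGroup N.Space := SeminormedAddCommGroup.ofCore N.core

instance : NormedSpace ℂ N.Space where
  norm_smul_le c u := (N.core.norm_smul c u).le

end ExtSeminorm

/-- `B_δ` is bounded on the space with norm `N`, in which the Schwartz functions are dense:
`‖B_δ f‖ ≤ C ‖f‖` for all Schwartz functions `f`. -/
def IsBoundedOn {d : ℕ} (δ : ℝ) (hδ : 0 < δ) (N : ExtSeminorm d) : Prop :=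
  ∃ C : ℝ≥0, ∀ f : 𝓢(Eucl d, ℂ), N.toFun (mean δ hδ f) ≤ C * N.toFun (f : 𝓢'(Eucl d, ℂ))

/-- The bounded operator `T` on the space with norm `N` is the Bochner-Riesz mean `B_δ`: it agrees
with `B_δ` on Schwartz functions. -/
def IsMeanOn {d : ℕ} (δ : ℝ) (hδ : 0 < δ) (N : ExtSeminorm d) (T : N.Space →L[ℂ] N.Space) : Prop :=
  ∀ (f : 𝓢(Eucl d, ℂ)) (u : N.Space), u.distr = (f : 𝓢'(Eucl d, ℂ)) → (T u).distr = mean δ hδ f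

/-! ### Triebel-Lizorkin and Besov norms -/

/-- The `L^p` norm `(∫ g^p)^{1/p}` of a `[0, ∞]`-valued function on `ℝᵈ`. -/
def lebNorm {d : ℕ} (p : ℝ) (g : Eucl d → ℝ≥0∞) : ℝ≥0∞ := (∫⁻ x, g x ^ p) ^ (1 / p)

/-- The `ℓ^q` norm `(∑ a_l^q)^{1/q}` of a `[0, ∞]`-valued sequence. -/
def seqNorm (q : ℝ) (a : ℕ → ℝ≥0∞) : ℝ≥0∞ := (∑' l, a l ^ q) ^ (1 / q)

section norms

variable {d : ℕ} {p q : ℝ}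

theorem lebNorm_mono (hp : 1 ≤ p) {g h : Eucl d → ℝ≥0∞} (H : ∀ x, g x ≤ h x) :
    lebNorm p g ≤ lebNorm p h := by
  unfold lebNorm
  have hp0 : 0 ≤ p := zero_le_one.trans hp
  exact ENNReal.rpow_le_rpow
    (lintegral_mono fun x => ENNReal.rpow_le_rpow (H x) hp0) (by positivity)

theorem seqNorm_mono (hq : 1 ≤ q) {a b : ℕ → ℝ≥0∞} (H : ∀ l, a l ≤ b l) :
    seqNorm q a ≤ seqNorm q b := by
  unfold seqNorm
  have hq0 : 0 ≤ q := zero_le_one.trans hq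
  exact ENNReal.rpow_le_rpow
    (ENNReal.tsum_le_tsum fun l => ENNReal.rpow_le_rpow (H l) hq0) (by positivity)

theorem lebNorm_add_le (hp : 1 ≤ p) {g h : Eucl d → ℝ≥0∞} (hg : Measurable g)
    (hh : Measurable h) :
    lebNorm p (fun x => g x + h x) ≤ lebNorm p g + lebNorm p h :=
  ENNReal.lintegral_Lp_add_le hg.aemeasurable hh.aemeasurable hp

theorem seqNorm_add_le (hq : 1 ≤ q) (a b : ℕ → ℝ≥0∞) :
    seqNorm q (fun l => a l + b l) ≤ seqNorm q a + seqNorm q b := by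
  have := ENNReal.lintegral_Lp_add_le (μ := Measure.count) (f := a) (g := b)
    (measurable_of_countable _).aemeasurable (measurable_of_countable _).aemeasurable hq
  simpa only [seqNorm, lintegral_count, Pi.add_apply] using this

theorem lebNorm_const_mul (hp : 1 ≤ p) {c : ℝ≥0∞} (hc : c ≠ ∞) (g : Eucl d → ℝ≥0∞) :
    lebNorm p (fun x => c * g x) = c * lebNorm p g := by
  have hp0 : 0 < p := by linarith
  simp only [lebNorm, ENNReal.mul_rpow_of_nonneg _ _ hp0.le]
  rw [lintegral_const_mul' _ _ (ENNReal.rpow_ne_top_of_nonneg hp0.le hc),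
    ENNReal.mul_rpow_of_nonneg _ _ (by positivity), ← ENNReal.rpow_mul,
    mul_one_div_cancel hp0.ne', ENNReal.rpow_one]

theorem seqNorm_const_mul (hq : 1 ≤ q) (c : ℝ≥0∞) (a : ℕ → ℝ≥0∞) :
    seqNorm q (fun l => c * a l) = c * seqNorm q a := by
  have hq0 : 0 < q := by linarith
  simp only [seqNorm, ENNReal.mul_rpow_of_nonneg _ _ hq0.le]
  rw [ENNReal.tsum_mul_left,
    ENNReal.mul_rpow_of_nonneg _ _ (by positivity), ← ENNReal.rpow_mul,
    mul_one_div_cancel hq0.ne', ENNReal.rpow_one]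

theorem measurable_seqNorm {a : Eucl d → ℕ → ℝ≥0∞} (ha : ∀ l, Measurable fun x => a x l) :
    Measurable fun x => seqNorm q (a x) := by
  unfold seqNorm
  exact (Measurable.tsum fun l => (ha l).pow_const q).pow_const _

end norms

/-- `x ↦ |(K * f)(x)|`. -/
def absConv {d : ℕ} (K : 𝓢(Eucl d, ℂ)) (f : 𝓢'(Eucl d, ℂ)) (x : Eucl d) : ℝ≥0∞ := ‖conv K f x‖ₑ

theorem measurable_absConv {d : ℕ} (K : 𝓢(Eucl d, ℂ)) (f : 𝓢'(Eucl d, ℂ)) :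
    Measurable (absConv K f) :=
  (continuous_conv K f).measurable.enorm

theorem absConv_smul {d : ℕ} (K : 𝓢(Eucl d, ℂ)) (c : ℂ) (f : 𝓢'(Eucl d, ℂ)) (x : Eucl d) :
    absConv K (c • f) x = ‖c‖ₑ * absConv K f x :=
  enorm_mul c (conv K f x)

theorem absConv_add_le {d : ℕ} (K : 𝓢(Eucl d, ℂ)) (f g : 𝓢'(Eucl d, ℂ)) (x : Eucl d) :
    absConv K (f + g) x ≤ absConv K f x + absConv K g x :=
  enorm_add_le (conv K f x) (conv K g x)

/-- The weight `2^{lα}`. -/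
def weight (α : ℝ) (l : ℕ) : ℝ≥0∞ := (2 : ℝ≥0∞) ^ ((l : ℝ) * α)

/-- The Triebel-Lizorkin norm
`‖φ₀ * f‖_p + ‖(∑_{l ≥ 1} 2^{lαq} |ψ_l * f|^q)^{1/q}‖_p`. -/
def triebelLizorkin {d : ℕ} (Φ : LittlewoodPaley d) (α p q : ℝ) (hp : 1 ≤ p) (hq : 1 ≤ q) :
    ExtSeminorm d where
  toFun f := lebNorm p (absConv Φ.φ₀ f) +
    lebNorm p (fun x => seqNorm q fun l => weight α (l + 1) * absConv (dyadic Φ.ψ (l + 1)) f x)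
  smul' c f := by
    have h1 : absConv Φ.φ₀ (c • f) = fun x => ‖c‖ₑ * absConv Φ.φ₀ f x :=
      funext fun x => absConv_smul _ c f x
    simp only [h1, absConv_smul, mul_left_comm _ ‖c‖ₑ]
    simp only [seqNorm_const_mul hq]
    rw [lebNorm_const_mul hp enorm_ne_top, lebNorm_const_mul hp enorm_ne_top, mul_add]
  add_le' f g := by
    have hm (f : 𝓢'(Eucl d, ℂ)) : Measurable fun x => seqNorm q fun l =>
        weight α (l + 1) * absConv (dyadic Φ.ψ (l + 1)) f x :=
      measurable_seqNorm fun l => (measurable_absConv _ f).const_mul _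
    have h1 := (lebNorm_mono hp (absConv_add_le Φ.φ₀ f g)).trans
      (lebNorm_add_le hp (measurable_absConv Φ.φ₀ f) (measurable_absConv Φ.φ₀ g))
    have h2 := (lebNorm_mono hp fun x => (seqNorm_mono hq fun l => (mul_le_mul_right
        (absConv_add_le (dyadic Φ.ψ (l + 1)) f g x) (weight α (l + 1))).trans_eq
          (mul_add _ _ _)).trans (seqNorm_add_le hq _ _)).trans
      (lebNorm_add_le hp (hm f) (hm g))
    exact (add_le_add h1 h2).trans_eq (add_add_add_comm _ _ _ _)

/-- The Besov norm `‖φ₀ * f‖_p + (∑_{l ≥ 1} 2^{lαq} ‖ψ_l * f‖_p^q)^{1/q}`. -/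
def besov {d : ℕ} (Φ : LittlewoodPaley d) (α p q : ℝ) (hp : 1 ≤ p) (hq : 1 ≤ q) :
    ExtSeminorm d where
  toFun f := lebNorm p (absConv Φ.φ₀ f) +
    seqNorm q fun l => weight α (l + 1) * lebNorm p (absConv (dyadic Φ.ψ (l + 1)) f)
  smul' c f := by
    have h1 (K : 𝓢(Eucl d, ℂ)) : absConv K (c • f) = fun x => ‖c‖ₑ * absConv K f x :=
      funext fun x => absConv_smul _ c f x
    simp only [h1, lebNorm_const_mul hp enorm_ne_top, mul_left_comm _ ‖c‖ₑ]
    rw [seqNorm_const_mul hq, mul_add]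
  add_le' f g := by
    have h1 (K : 𝓢(Eucl d, ℂ)) := (lebNorm_mono hp (absConv_add_le K f g)).trans
      (lebNorm_add_le hp (measurable_absConv K f) (measurable_absConv K g))
    have h2 := (seqNorm_mono hq fun l => (mul_le_mul_right
        (h1 (dyadic Φ.ψ (l + 1))) (weight α (l + 1))).trans_eq
          (mul_add _ _ _)).trans (seqNorm_add_le hq _ _)
    exact (add_le_add (h1 _) h2).trans_eq (add_add_add_comm _ _ _ _)

end

end BochnerRiesz

/-! Write m = (1 - |ξ|²)₊^δ. The transform of `φ₀` equals 1 on the closed unit ball, where m lives,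
so B_δ sees low frequencies only. There X is tied to L^p: the norm of X dominates ‖φ₀ * f‖_p, and on
band-limited functions it is dominated by an L^p norm. Since B_δ f = φ₀ * B_δ(φ₀ * f), boundedness
on X gives ‖B_δ f‖_p ≤ ‖B_δ(φ₀ * f)‖_X ≤ C ‖φ₀ * f‖_X ≤ C' ‖f‖_p, so m is the symbol of a bounded
operator A on L^p (`Admissible.exists_isMult_brSymbol`). Let J : X → L^p and E : L^p → X both be
convolution with `φ₀`. Then T = E A J extends B_δ, while A J E = A. As ab and ba have the same
nonzero spectrum (`notMem_spectrum_comp_swap`), T and A have the same spectrum away from 0.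

For z outside [0,1] the inverse of z - A is z⁻¹(1 + Q), where Q has symbol r = m/(z - m). This r may
fail to be smooth at the unit sphere, but m^k r has as many derivatives as desired once k is large,
hence an integrable kernel, and Young's inequality applies. The identity z m^j r = m^(j+1) + m^(j+1)
r then descends from m^k r to r (`exists_isMult_resSymbol`).

Conversely let z₀ = m(ξ₀) ≠ 0. If z₀ - A were invertible, the operators Q at z₀ + ε would stay
bounded as ε → 0. Their symbols take the value z₀/ε at ξ₀, and a multiplier norm dominates its
symbol at points of continuity (`IsMult.norm_symbol_le`), a contradiction. The point 0 is in the
spectrum because T kills every Littlewood-Paley piece ψ_l with l ≥ 1.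

Uniqueness of T is the density of Schwartz functions in X: low-frequency truncations converge in X
because p and q are finite, and a truncation is approximated in L^p by Schwartz functions. The two
scales of spaces enter only through the properties collected in `Admissible`. -/

namespace BochnerRiesz

/-! ### Convolution and dilation of Schwartz functions -/

/-- The convolution of two Schwartz functions. -/
noncomputable def star {d : ℕ} (K g : 𝓢(Eucl d, ℂ)) : 𝓢(Eucl d, ℂ) :=
  SchwartzMap.convolution (ContinuousLinearMap.mul ℂ ℂ) K g

section

variable {d : ℕ}

theorem star_apply (K g : 𝓢(Eucl d, ℂ)) (x : Eucl d) : star K g x = ∫ t, K t * g (x - t) := by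
  rw [star, SchwartzMap.convolution_apply]
  rfl

theorem fourier_star (K g : 𝓢(Eucl d, ℂ)) (η : Eucl d) :
    𝓕 (star K g) η = 𝓕 K η * 𝓕 g η := by
  rw [star, SchwartzMap.fourier_convolution]
  rfl

theorem eq_of_fourier_eq {f g : 𝓢(Eucl d, ℂ)} (h : ∀ η, 𝓕 f η = 𝓕 g η) : f = g := by
  have : 𝓕 f = 𝓕 g := by ext η; exact h η
  simpa using congrArg (fun u : 𝓢(Eucl d, ℂ) => 𝓕⁻ u) this

theorem star_comm (K g : 𝓢(Eucl d, ℂ)) : star K g = star g K :=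
  eq_of_fourier_eq fun η => by rw [fourier_star, fourier_star, mul_comm]

theorem star_assoc (K g h : 𝓢(Eucl d, ℂ)) : star (star K g) h = star K (star g h) :=
  eq_of_fourier_eq fun η => by simp only [fourier_star, mul_assoc]

theorem star_apply' (K g : 𝓢(Eucl d, ℂ)) (x : Eucl d) : star K g x = ∫ t, K (x - t) * g t := by
  rw [star_comm, star_apply]
  simp only [mul_comm]

theorem conv_coe (K g : 𝓢(Eucl d, ℂ)) (x : Eucl d) :
    conv K (g : 𝓢'(Eucl d, ℂ)) x = star K g x := by
  rw [conv, SchwartzMap.coe_apply, star_apply']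
  simp only [reflectTranslate_apply, smul_eq_mul]

theorem conv_add_left (K K' : 𝓢(Eucl d, ℂ)) (f : 𝓢'(Eucl d, ℂ)) (x : Eucl d) :
    conv (K + K') f x = conv K f x + conv K' f x := by
  rw [conv, conv, conv, ← map_add]
  congr 1

theorem conv_sub_right (K : 𝓢(Eucl d, ℂ)) (f g : 𝓢'(Eucl d, ℂ)) (x : Eucl d) :
    conv K (f - g) x = conv K f x - conv K g x := rfl

theorem conv_zero_left (f : 𝓢'(Eucl d, ℂ)) (x : Eucl d) : conv 0 f x = 0 := by
  rw [conv, ← map_zero f]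
  congr 1

theorem fourier_dyadic (K : 𝓢(Eucl d, ℂ)) (l : ℕ) (η : Eucl d) :
    𝓕 (dyadic K l) η = 𝓕 K (((2 : ℝ) ^ l)⁻¹ • η) := by
  rw [SchwartzMap.fourier_coe, SchwartzMap.fourier_coe, Real.fourier_eq', Real.fourier_eq']
  have h2 : (0 : ℝ) < 2 ^ l := by positivity
  have := Measure.integral_comp_smul (μ := (volume : Measure (Eucl d)))
    (fun v => Complex.exp (↑(-2 * Real.pi * inner ℝ v (((2 : ℝ) ^ l)⁻¹ • η)) * Complex.I) • K v)
    ((2 : ℝ) ^ l)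
  simp only [finrank_euclideanSpace, Fintype.card_fin] at this
  rw [eq_comm, abs_of_pos (by positivity), inv_smul_eq_iff₀ (by positivity)] at this
  rw [eq_comm, this, ← integral_smul]
  congr 1
  ext v
  rw [dyadic_apply, inner_smul_left, inner_smul_right]
  simp only [smul_eq_mul, conj_trivial, Complex.real_smul]
  rw [mul_inv_cancel_left₀ h2.ne']
  push_cast
  rw [pow_mul]
  ring

/-! ### The Littlewood-Paley functions in frequency -/

variable (Φ : LittlewoodPaley d)

theorem norm_two_pi_smul (η : Eucl d) : ‖(2 * Real.pi) • η‖ = 2 * Real.pi * ‖η‖ := by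
  rw [norm_smul, Real.norm_of_nonneg (by positivity)]

theorem continuous_hat (K : 𝓢(Eucl d, ℂ)) : Continuous (hat K) := by
  have : hat K = fun ξ => 𝓕 K ((2 * Real.pi)⁻¹ • ξ) := by
    ext ξ
    rw [fourier_eq_hat, smul_inv_smul₀ (by positivity)]
  rw [this]
  exact (𝓕 K).continuous.comp (continuous_const_smul _)

namespace LittlewoodPaley

/-- The low frequency cut-off `2^{Ld} φ₀(2^L ·)`. -/
noncomputable def low (L : ℕ) : 𝓢(Eucl d, ℂ) := dyadic Φ.φ₀ L

/-- The Littlewood-Paley piece `ψ_{l+1}`. -/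
noncomputable def piece (l : ℕ) : 𝓢(Eucl d, ℂ) := dyadic Φ.ψ (l + 1)

theorem fourier_low (L : ℕ) (η : Eucl d) :
    𝓕 (Φ.low L) η = hat Φ.φ₀ (((2 : ℝ) ^ L)⁻¹ • (2 * Real.pi) • η) := by
  rw [low, fourier_dyadic, fourier_eq_hat, smul_comm]

theorem fourier_piece (l : ℕ) (η : Eucl d) :
    𝓕 (Φ.piece l) η = hat Φ.ψ (((2 : ℝ) ^ (l + 1))⁻¹ • (2 * Real.pi) • η) := by
  rw [piece, fourier_dyadic, fourier_eq_hat, smul_comm]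

theorem norm_inv_two_pow_smul (L : ℕ) (ξ : Eucl d) :
    ‖((2 : ℝ) ^ L)⁻¹ • ξ‖ = ‖ξ‖ / 2 ^ L := by
  rw [norm_smul, norm_inv, norm_pow, Real.norm_ofNat, inv_mul_eq_div]

/-- For |ξ| < 1 every term of the partition series vanishes, the term of index l being supported in
|ξ| ≥ 2^l. -/
theorem hat_φ₀_eq_one_of_lt {ξ : Eucl d} (h : ‖ξ‖ < 1) : hat Φ.φ₀ ξ = 1 := by
  have h0 : (fun l : ℕ => hat Φ.ψ (((2 : ℝ) ^ (l + 1))⁻¹ • ξ)) = fun _ => 0 := by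
    ext l
    by_contra hne
    have := (Φ.support_ψ _ hne).1
    rw [norm_inv_two_pow_smul, le_div_iff₀ (by positivity), pow_succ] at this
    nlinarith [one_le_pow₀ (M₀ := ℝ) one_le_two (n := l)]
  have := Φ.partition ξ
  rw [h0] at this
  exact (sub_eq_zero.1 (this.unique hasSum_zero)).symm

/-- The boundary follows by continuity along the radius. The closed ball matters: the support bound
2^(M+1) of `low M` must lie in the set where the transform of `low (M+1)` is 1. -/
theorem hat_φ₀_eq_one {ξ : Eucl d} (h : ‖ξ‖ ≤ 1) : hat Φ.φ₀ ξ = 1 := by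
  have h1 : Tendsto (fun t : ℝ => hat Φ.φ₀ (t • ξ)) (𝓝[<] 1) (𝓝 (hat Φ.φ₀ ξ)) := by
    have : Continuous fun t : ℝ => hat Φ.φ₀ (t • ξ) :=
      (continuous_hat _).comp (continuous_id.smul continuous_const)
    simpa using (this.tendsto 1).mono_left nhdsWithin_le_nhds
  refine tendsto_nhds_unique h1 (tendsto_const_nhds.congr' ?_)
  filter_upwards [Ioo_mem_nhdsLT (zero_lt_one' ℝ)] with t ht
  rw [hat_φ₀_eq_one_of_lt]
  rw [norm_smul, Real.norm_of_nonneg ht.1.le]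
  nlinarith [ht.1, ht.2, norm_nonneg ξ]

theorem fourier_low_eq_one {L : ℕ} {η : Eucl d} (h : 2 * Real.pi * ‖η‖ ≤ 2 ^ L) :
    𝓕 (Φ.low L) η = 1 := by
  rw [fourier_low, hat_φ₀_eq_one]
  rw [norm_inv_two_pow_smul, norm_two_pi_smul]
  exact div_le_one_of_le₀ h (by positivity)

theorem le_of_fourier_low_ne_zero {L : ℕ} {η : Eucl d} (h : 𝓕 (Φ.low L) η ≠ 0) :
    2 * Real.pi * ‖η‖ ≤ 2 ^ (L + 1) := by
  rw [fourier_low] at h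
  have := Φ.support_φ₀ _ h
  rwa [norm_inv_two_pow_smul, norm_two_pi_smul, div_le_iff₀ (by positivity), ← pow_succ'] at this

theorem bounds_of_fourier_piece_ne_zero {l : ℕ} {η : Eucl d} (h : 𝓕 (Φ.piece l) η ≠ 0) :
    2 ^ l ≤ 2 * Real.pi * ‖η‖ ∧ 2 * Real.pi * ‖η‖ ≤ 2 ^ (l + 2) := by
  rw [fourier_piece] at h
  have := Φ.support_ψ _ h
  rw [norm_inv_two_pow_smul, norm_two_pi_smul, le_div_iff₀ (by positivity),
    div_le_iff₀ (by positivity)] at this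
  refine ⟨le_trans (le_of_eq ?_) this.1, this.2.trans (le_of_eq ?_)⟩ <;> ring

theorem low_zero : Φ.low 0 = Φ.φ₀ := by
  ext x
  simp [low, dyadic_apply]

/-- The partition identities at 2^(-L) ξ and 2^(-L-1) ξ contain the same series shifted by one
index, so their difference is a single term. -/
theorem low_succ (L : ℕ) : Φ.low (L + 1) = Φ.low L + Φ.piece L := by
  refine eq_of_fourier_eq fun η => ?_
  have hadd : 𝓕 (Φ.low L + Φ.piece L) η = 𝓕 (Φ.low L) η + 𝓕 (Φ.piece L) η := by
    rw [FourierTransform.fourier_add]; rfl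
  rw [hadd, fourier_low, fourier_low, fourier_piece]
  generalize (2 * Real.pi) • η = ξ
  have h1 := Φ.partition (((2 : ℝ) ^ L)⁻¹ • ξ)
  have h2 := Φ.partition (((2 : ℝ) ^ (L + 1))⁻¹ • ξ)
  rw [← hasSum_nat_add_iff' 1] at h1
  have e (l : ℕ) : ((2 : ℝ) ^ (l + 1 + 1))⁻¹ • ((2 : ℝ) ^ L)⁻¹ • ξ =
      ((2 : ℝ) ^ (l + 1))⁻¹ • ((2 : ℝ) ^ (L + 1))⁻¹ • ξ := by
    rw [smul_smul, smul_smul]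
    congr 1
    rw [← mul_inv, ← mul_inv]
    congr 1
    ring
  simp only [e] at h1
  have h3 := h1.unique h2
  simp only [Finset.range_one, Finset.sum_singleton, zero_add, pow_one] at h3
  have e0 : (2 : ℝ)⁻¹ • ((2 : ℝ) ^ L)⁻¹ • ξ = ((2 : ℝ) ^ (L + 1))⁻¹ • ξ := by
    rw [smul_smul, ← mul_inv, pow_succ']
  rw [e0] at h3
  linear_combination h3

/-- Low frequency cut-offs reproduce each other. -/
theorem star_low_low {L M : ℕ} (h : M + 1 ≤ L) : star (Φ.low L) (Φ.low M) = Φ.low M := by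
  refine eq_of_fourier_eq fun η => ?_
  rw [fourier_star]
  by_cases h0 : 𝓕 (Φ.low M) η = 0
  · rw [h0, mul_zero]
  · rw [Φ.fourier_low_eq_one, one_mul]
    exact (Φ.le_of_fourier_low_ne_zero h0).trans (pow_le_pow_right₀ one_le_two h)

theorem star_piece_low_of_le {l L : ℕ} (h : l + 2 ≤ L) :
    star (Φ.piece l) (Φ.low L) = Φ.piece l := by
  refine eq_of_fourier_eq fun η => ?_
  rw [fourier_star]
  by_cases h0 : 𝓕 (Φ.piece l) η = 0
  · rw [h0, zero_mul]
  · rw [Φ.fourier_low_eq_one, mul_one]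
    exact (Φ.bounds_of_fourier_piece_ne_zero h0).2.trans (pow_le_pow_right₀ one_le_two h)

theorem star_piece_low_eq_zero {l L : ℕ} (h : L + 2 ≤ l) :
    star (Φ.piece l) (Φ.low L) = 0 := by
  refine eq_of_fourier_eq fun η => ?_
  rw [fourier_star, show 𝓕 (0 : 𝓢(Eucl d, ℂ)) = 0 from FourierTransform.fourier_zero, zero_apply]
  by_contra hne
  have h0 := mul_ne_zero_iff.1 hne
  have h1 := (Φ.bounds_of_fourier_piece_ne_zero h0.1).1.trans (Φ.le_of_fourier_low_ne_zero h0.2)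
  have h2 := (pow_le_pow_iff_right₀ (one_lt_two (α := ℝ))).1 h1
  omega

end LittlewoodPaley

end

/-! ### Tempered distributions and convolution integrals -/

section

variable {d : ℕ}

open scoped LineDeriv BoundedContinuousFunction

theorem lineDeriv_star (g H : 𝓢(Eucl d, ℂ)) (v : Eucl d) : ∂_{v} (star g H) = star g (∂_{v} H) := by
  refine eq_of_fourier_eq fun η => ?_
  have hv : Function.HasTemperateGrowth (fun x : Eucl d => inner ℝ x v) := by fun_prop
  have h (f : 𝓢(Eucl d, ℂ)) : 𝓕 (∂_{v} f) η = (2 * Real.pi * Complex.I) * (inner ℝ η v * 𝓕 f η) := by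
    rw [SchwartzMap.fourier_lineDerivOp_eq]
    simp [SchwartzMap.smulLeftCLM_apply_apply hv]
  rw [h, fourier_star, fourier_star, h]
  ring

theorem iteratedLineDeriv_star (g H : 𝓢(Eucl d, ℂ)) {n : ℕ} (v : Fin n → Eucl d) :
    ∂^{v} (star g H) = star g (∂^{v} H) := by
  induction n with
  | zero => simp only [LineDeriv.iteratedLineDerivOp_fin_zero]
  | succ n ih => rw [LineDeriv.iteratedLineDerivOp_succ_left, ih, lineDeriv_star,
      LineDeriv.iteratedLineDerivOp_succ_left]

theorem iteratedFDeriv_star_apply (g H : 𝓢(Eucl d, ℂ)) {n : ℕ} (x : Eucl d) (v : Fin n → Eucl d) :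
    iteratedFDeriv ℝ n (star g H) x v = ∫ y, g y * iteratedFDeriv ℝ n H (x - y) v := by
  rw [← SchwartzMap.iteratedLineDerivOp_eq_iteratedFDeriv, iteratedLineDeriv_star, star_apply]
  simp only [SchwartzMap.iteratedLineDerivOp_eq_iteratedFDeriv]

/-- Bounded continuous functions with values in the `n`-linear forms. -/
abbrev BoundedForms (d n : ℕ) : Type :=
  @BoundedContinuousFunction (Eucl d) (Eucl d [×n]→L[ℝ] ℂ) _
    NormedAddCommGroup.toSeminormedAddCommGroup.toPseudoMetricSpace

/-- The map `φ ↦ ‖x‖^k D^n φ(x)` into bounded continuous functions. -/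
noncomputable def weightedDeriv (k n : ℕ) :
    𝓢(Eucl d, ℂ) →L[ℂ] BoundedForms d n :=
  SchwartzMap.mkCLMtoNormedSpace (σ := RingHom.id ℂ)
    (fun φ => BoundedContinuousFunction.ofNormedAddCommGroup
      (fun x => (‖x‖ ^ k) • iteratedFDeriv ℝ n φ x)
      ((continuous_norm.pow k).smul
        ((φ.smooth ⊤).continuous_iteratedFDeriv (by exact_mod_cast le_top)))
      (SchwartzMap.seminorm ℂ k n φ) fun x => by
        rw [norm_smul, norm_pow, norm_norm]
        exact φ.le_seminorm ℂ k n x)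
    (fun f g => by
      ext1 x
      simp only [BoundedContinuousFunction.coe_ofNormedAddCommGroup,
        BoundedContinuousFunction.coe_add, Pi.add_apply]
      rw [FunLike.coe_add, iteratedFDeriv_add_apply (f.smooth n).contDiffAt
        (g.smooth n).contDiffAt, smul_add])
    (fun a f => by
      ext1 x
      simp only [BoundedContinuousFunction.coe_ofNormedAddCommGroup,
        BoundedContinuousFunction.coe_smul, RingHom.id_apply]
      rw [FunLike.coe_smul, iteratedFDeriv_const_smul_apply (f.smooth n).contDiffAt, smul_comm])
    ⟨{(k, n)}, 1, zero_le_one, fun φ => by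
      rw [one_mul, Finset.sup_singleton]
      exact BoundedContinuousFunction.norm_ofNormedAddCommGroup_le _ (apply_nonneg _ _) _⟩

theorem weightedDeriv_apply (k n : ℕ) (φ : 𝓢(Eucl d, ℂ)) (x : Eucl d) :
    weightedDeriv k n φ x = (‖x‖ ^ k) • iteratedFDeriv ℝ n φ x := rfl

theorem seminorm_le_norm_weightedDeriv (k n : ℕ) (φ : 𝓢(Eucl d, ℂ)) :
    SchwartzMap.seminorm ℂ k n φ ≤ ‖weightedDeriv k n φ‖ := by
  refine SchwartzMap.seminorm_le_bound ℂ k n φ (norm_nonneg _) fun x => ?_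
  have := (weightedDeriv k n φ).norm_coe_le_norm x
  rwa [weightedDeriv_apply, norm_smul, norm_pow, norm_norm] at this

/-- Translation costs only polynomial growth, which a Schwartz weight absorbs. This makes the
Bochner integrals of translates below converge. -/
theorem norm_weightedDeriv_translate_le (k n : ℕ) (H : 𝓢(Eucl d, ℂ)) :
    ∃ C, ∀ y, ‖weightedDeriv k n (compSubConstCLM ℂ y H)‖ ≤ C * (1 + ‖y‖) ^ k := by
  refine ⟨2 ^ k * (Finset.Iic ((k, n) : ℕ × ℕ)).sup
    (fun m => SchwartzMap.seminorm ℂ m.1 m.2) H, fun y => ?_⟩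
  refine (BoundedContinuousFunction.norm_le (by positivity)).2 fun x => ?_
  rw [weightedDeriv_apply, norm_smul, norm_pow, norm_norm]
  have h1 : (⇑(compSubConstCLM ℂ y H)) = fun z => H (z - y) := by ext z; simp
  rw [h1, iteratedFDeriv_comp_sub]
  -- A form of Peetre's inequality: the weight at x splits into a weight in y and a weight at the
  -- translated point.
  have h2 : ‖x‖ ≤ (1 + ‖y‖) * (1 + ‖x - y‖) := by
    have := norm_le_norm_add_norm_sub' x y
    nlinarith [norm_nonneg y, norm_nonneg (x - y)]
  calc ‖x‖ ^ k * ‖iteratedFDeriv ℝ n H (x - y)‖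
      ≤ ((1 + ‖y‖) * (1 + ‖x - y‖)) ^ k * ‖iteratedFDeriv ℝ n H (x - y)‖ := by gcongr
    _ = (1 + ‖y‖) ^ k * ((1 + ‖x - y‖) ^ k * ‖iteratedFDeriv ℝ n H (x - y)‖) := by
        rw [mul_pow, mul_assoc]
    _ ≤ (1 + ‖y‖) ^ k * (2 ^ k * (Finset.Iic ((k, n) : ℕ × ℕ)).sup
          (fun m => SchwartzMap.seminorm ℂ m.1 m.2) H) := by
        exact mul_le_mul_of_nonneg_left (SchwartzMap.one_add_le_sup_seminorm_apply (𝕜 := ℂ)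
          (m := (k, n)) le_rfl le_rfl H _) (by positivity)
    _ = _ := mul_comm _ _

theorem integrable_mul_one_add_norm_pow (g : 𝓢(Eucl d, ℂ)) (C : ℝ) (k : ℕ) :
    Integrable fun y => ‖g y‖ * (C * (1 + ‖y‖) ^ k) := by
  have h1 : Integrable fun y => ‖y‖ ^ k * ‖g y‖ := g.integrable_pow_mul volume k
  have h2 : Integrable fun y => ‖g y‖ := g.integrable.norm
  refine Integrable.mono' ((h1.add h2).const_mul (|C| * 2 ^ k)) ?_ (ae_of_all _ fun y => ?_)
  · have := g.continuous
    exact (by fun_prop : Continuous fun y => ‖g y‖ * (C * (1 + ‖y‖) ^ k)).aestronglyMeasurable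
  · have h3 : (1 + ‖y‖) ^ k ≤ 2 ^ k * (‖y‖ ^ k + 1) := by
      rcases le_total 1 ‖y‖ with h | h
      · calc (1 + ‖y‖) ^ k ≤ (2 * ‖y‖) ^ k := by gcongr; linarith
          _ = 2 ^ k * ‖y‖ ^ k := mul_pow _ _ _
          _ ≤ _ := by gcongr; linarith
      · calc (1 + ‖y‖) ^ k ≤ 2 ^ k := by gcongr; linarith
          _ ≤ _ := by
            have : (0 : ℝ) ≤ 2 ^ k * ‖y‖ ^ k := by positivity
            linarith
    rw [Real.norm_eq_abs, abs_mul, abs_norm, abs_mul, abs_of_nonneg (by positivity : 0 ≤ (1 + ‖y‖) ^ k)]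
    calc ‖g y‖ * (|C| * (1 + ‖y‖) ^ k) ≤ ‖g y‖ * (|C| * (2 ^ k * (‖y‖ ^ k + 1))) := by gcongr
      _ = _ := by simp only [Pi.add_apply]; ring

theorem integrable_weightedDeriv_translate (k n : ℕ) (g H : 𝓢(Eucl d, ℂ)) :
    Integrable fun y => g y • weightedDeriv k n (compSubConstCLM ℂ y H) := by
  obtain ⟨C, hC⟩ := norm_weightedDeriv_translate_le k n H
  refine (integrable_mul_one_add_norm_pow g C k).mono' ?_ (ae_of_all _ fun y => ?_)
  · exact (g.continuous.smul
      ((weightedDeriv k n).continuous.comp (continuous_translate H))).aestronglyMeasurable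
  · rw [norm_smul]
    gcongr
    exact hC y

/-- All derivatives can be put on H. Point evaluation, applied to vectors, is a bounded functional
and reduces the Banach-valued identity to a scalar one. -/
theorem weightedDeriv_star (k n : ℕ) (g H : 𝓢(Eucl d, ℂ)) :
    weightedDeriv k n (star g H) = ∫ y, g y • weightedDeriv k n (compSubConstCLM ℂ y H) := by
  have hint := integrable_weightedDeriv_translate k n g H
  ext x v
  have h1 := ((ContinuousMultilinearMap.apply ℝ (fun _ : Fin n => Eucl d) ℂ v) ∘L
    (BoundedContinuousFunction.evalCLM ℝ x)).integral_comp_comm hint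
  change _ = ((ContinuousMultilinearMap.apply ℝ (fun _ : Fin n => Eucl d) ℂ v) ∘L
    (BoundedContinuousFunction.evalCLM ℝ x)) _
  rw [← h1, weightedDeriv_apply, smul_apply, iteratedFDeriv_star_apply,
    ← integral_smul]
  congr 1
  ext y
  have h2 : (⇑(compSubConstCLM ℂ y H)) = fun z => H (z - y) := by ext z; simp
  simp only [ContinuousLinearMap.comp_apply, BoundedContinuousFunction.evalCLM_apply,
    ContinuousMultilinearMap.apply_apply, BoundedContinuousFunction.coe_smul,
    smul_apply, weightedDeriv_apply, h2, iteratedFDeriv_comp_sub,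
    Complex.real_smul, smul_eq_mul]
  ring

/-- Every tempered distribution factors through a Banach space of weighted derivatives. -/
theorem exists_weightedDeriv_factor (f : 𝓢'(Eucl d, ℂ)) :
    ∃ (s : Finset (ℕ × ℕ))
      (ℓ : StrongDual ℂ ((m : s) → BoundedForms d m.1.2)),
      ∀ φ, f φ = ℓ fun m => weightedDeriv m.1.1 m.1.2 φ := by
  let q : Seminorm ℂ 𝓢(Eucl d, ℂ) := (normSeminorm ℂ ℂ).comp (f : 𝓢(Eucl d, ℂ) →ₗ[ℂ] ℂ)
  obtain ⟨s, C, -, hC⟩ := Seminorm.bound_of_continuous (schwartz_withSeminorms ℂ (Eucl d) ℂ) q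
    (continuous_norm.comp (map_continuous f))
  let W : 𝓢(Eucl d, ℂ) →ₗ[ℂ] ((m : s) → BoundedForms d m.1.2) :=
    LinearMap.pi fun m => (weightedDeriv m.1.1 m.1.2).toLinearMap
  have hb : ∀ φ, ‖(f : 𝓢(Eucl d, ℂ) →ₗ[ℂ] ℂ) φ‖ ≤ C * ‖W φ‖ := fun φ => by
    refine (hC φ).trans ?_
    rw [smul_apply, NNReal.smul_def, smul_eq_mul]
    gcongr
    refine Seminorm.finset_sup_apply_le (norm_nonneg _) fun m hm => ?_
    exact (seminorm_le_norm_weightedDeriv m.1 m.2 φ).trans (norm_le_pi_norm (W φ) ⟨m, hm⟩)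
  -- The bound `hb` makes f well defined and continuous on the range of W; Hahn-Banach extends it to
  -- the whole product.
  obtain ⟨ℓ, hℓ, -⟩ := exists_extension_norm_eq (LinearMap.range W)
    ((f : 𝓢(Eucl d, ℂ) →ₗ[ℂ] ℂ).compLeftInverse W)
  refine ⟨s, ℓ, fun φ => ?_⟩
  have h1 := hℓ ⟨W φ, φ, rfl⟩
  rw [LinearMap.compLeftInverse_apply_of_bdd _ _ ⟨C, hb⟩ φ (W φ) rfl] at h1
  exact h1.symm

/-- A bounded functional on a Banach space commutes with the Bochner integral, so the factorization
of f through weighted derivatives lets f pass under the integral over translates of H. -/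
theorem distr_star (f : 𝓢'(Eucl d, ℂ)) (g H : 𝓢(Eucl d, ℂ)) :
    Integrable (fun y => g y * f (compSubConstCLM ℂ y H)) ∧
      f (star g H) = ∫ y, g y * f (compSubConstCLM ℂ y H) := by
  obtain ⟨s, ℓ, hℓ⟩ := exists_weightedDeriv_factor f
  have hint : Integrable fun y => fun m : s => g y • weightedDeriv m.1.1 m.1.2 (compSubConstCLM ℂ y H) :=
    Integrable.of_eval fun m => integrable_weightedDeriv_translate _ _ g H
  have h1 (y : Eucl d) : g y * f (compSubConstCLM ℂ y H) =
      ℓ (fun m : s => g y • weightedDeriv m.1.1 m.1.2 (compSubConstCLM ℂ y H)) := by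
    rw [hℓ, ← smul_eq_mul, ← map_smul]
    rfl
  simp only [h1]
  refine ⟨ℓ.integrable_comp hint, ?_⟩
  rw [ℓ.integral_comp_comm hint, hℓ]
  congr 1
  ext1 m
  rw [eval_integral fun m => integrable_weightedDeriv_translate _ _ g H, weightedDeriv_star]

/-- Provides the majorant for dominated convergence in `distr_star_dyadic_tendsto`. -/
theorem distr_translate_bound (f : 𝓢'(Eucl d, ℂ)) (H : 𝓢(Eucl d, ℂ)) :
    ∃ (C : ℝ) (k : ℕ), ∀ y, ‖f (compSubConstCLM ℂ y H)‖ ≤ C * (1 + ‖y‖) ^ k := by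
  obtain ⟨s, ℓ, hℓ⟩ := exists_weightedDeriv_factor f
  choose C hC using fun m : ℕ × ℕ => norm_weightedDeriv_translate_le m.1 m.2 H
  refine ⟨‖ℓ‖ * ∑ m ∈ s, |C m|, s.sup Prod.fst, fun y => ?_⟩
  rw [hℓ, mul_assoc]
  refine (ℓ.le_opNorm _).trans ?_
  gcongr
  refine (pi_norm_le_iff_of_nonneg (by positivity)).2 fun m => (hC m.1 y).trans ?_
  calc C m.1 * (1 + ‖y‖) ^ m.1.1 ≤ |C m.1| * (1 + ‖y‖) ^ m.1.1 := by gcongr; exact le_abs_self _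
    _ ≤ (∑ m ∈ s, |C m|) * (1 + ‖y‖) ^ s.sup Prod.fst := by
      gcongr
      · exact Finset.single_le_sum (f := fun m => |C m|) (fun _ _ => abs_nonneg _) m.2
      · linarith [norm_nonneg y]
      · exact Finset.le_sup (f := Prod.fst) m.2

end

/-! ### Associativity of convolution with tempered distributions, and approximate identities. -/

section

variable {d : ℕ}

theorem reflectTranslate_eq (K : 𝓢(Eucl d, ℂ)) (x : Eucl d) :
    reflectTranslate K x = compSubConstCLM ℂ x (reflectTranslate K 0) := by
  ext y
  rw [reflectTranslate_apply, compSubConstCLM_apply, reflectTranslate_apply]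
  congr 1
  abel

theorem integral_mul_conv (g K : 𝓢(Eucl d, ℂ)) (f : 𝓢'(Eucl d, ℂ)) :
    ∫ y, g y * conv K f y = f (star g (reflectTranslate K 0)) := by
  rw [(distr_star f g (reflectTranslate K 0)).2]
  simp only [conv, ← reflectTranslate_eq]

theorem star_reflectTranslate (K' K : 𝓢(Eucl d, ℂ)) (x : Eucl d) :
    star (reflectTranslate K' x) (reflectTranslate K 0) = reflectTranslate (star K' K) x := by
  ext t
  rw [reflectTranslate_apply, star_apply, star_apply',
    ← integral_sub_right_eq_self (fun s => K' (x - t - s) * K s) t]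
  simp only [reflectTranslate_apply]
  congr 1
  ext y
  congr 2 <;> abel

/-- This associativity transfers frequency identities between Schwartz functions, such as
`star_low_low`, to arbitrary tempered distributions. -/
theorem integral_conv_eq_conv_star (K' K : 𝓢(Eucl d, ℂ)) (f : 𝓢'(Eucl d, ℂ)) (x : Eucl d) :
    ∫ y, K' (x - y) * conv K f y = conv (star K' K) f x := by
  rw [conv, ← star_reflectTranslate, ← integral_mul_conv]
  simp only [reflectTranslate_apply]

/-- Rescaling moves the dilation from K to the translation parameter, which becomes 2^(-L) y and
tends to 0 under a polynomial majorant uniform in L. -/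
theorem distr_star_dyadic_tendsto (f : 𝓢'(Eucl d, ℂ)) (K g : 𝓢(Eucl d, ℂ)) (hK : ∫ x, K x = 1) :
    Tendsto (fun L => f (star (dyadic K L) g)) atTop (𝓝 (f g)) := by
  have h1 (L : ℕ) : f (star (dyadic K L) g) =
      ∫ y, K y * f (compSubConstCLM ℂ (((2 : ℝ) ^ L)⁻¹ • y) g) := by
    have h2 : (0 : ℝ) < 2 ^ L := by positivity
    rw [(distr_star f _ g).2]
    have := Measure.integral_comp_smul (μ := (volume : Measure (Eucl d)))
      (fun y => K y * f (compSubConstCLM ℂ (((2 : ℝ) ^ L)⁻¹ • y) g)) ((2 : ℝ) ^ L)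
    simp only [finrank_euclideanSpace, Fintype.card_fin] at this
    rw [eq_comm, abs_of_pos (by positivity), inv_smul_eq_iff₀ (by positivity)] at this
    rw [this, ← integral_smul]
    congr 1
    ext v
    rw [dyadic_apply, inv_smul_smul₀ h2.ne', Complex.real_smul]
    push_cast
    rw [pow_mul]
    ring
  simp only [h1]
  obtain ⟨C, k, hC⟩ := distr_translate_bound f g
  have hcont : Continuous fun y : Eucl d => f (compSubConstCLM ℂ y g) :=
    (map_continuous f).comp (continuous_translate g)
  have hlim : f g = ∫ y, K y * f g := by rw [integral_mul_const, hK, one_mul]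
  have hC0 : 0 ≤ C := by simpa using (norm_nonneg _).trans (hC 0)
  rw [hlim]
  refine tendsto_integral_of_dominated_convergence _ (fun L => ?_)
    (integrable_mul_one_add_norm_pow K C k) (fun L => ae_of_all _ fun y => ?_)
    (ae_of_all _ fun y => ?_)
  · exact (K.continuous.mul (hcont.comp (continuous_const_smul _))).aestronglyMeasurable
  · rw [norm_mul]
    gcongr
    refine (hC _).trans ?_
    rw [LittlewoodPaley.norm_inv_two_pow_smul]
    gcongr
    exact div_le_self (norm_nonneg _) (one_le_pow₀ one_le_two)
  · have h3 : Tendsto (fun L : ℕ => ((2 : ℝ) ^ L)⁻¹ • y) atTop (𝓝 0) := by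
      have := tendsto_pow_atTop_nhds_zero_of_lt_one (r := (2 : ℝ)⁻¹) (by norm_num) (by norm_num)
      simpa using this.smul_const y
    have h4 := ((hcont.tendsto 0).comp h3).const_mul (K y)
    simpa [compSubConstCLM_zero] using h4

theorem integral_eq_one_of_fourier {K : 𝓢(Eucl d, ℂ)} (h : 𝓕 K 0 = 1) : ∫ x, K x = 1 := by
  rw [SchwartzMap.fourier_coe, Real.fourier_eq'] at h
  simpa using h

theorem integral_reflectTranslate (K : 𝓢(Eucl d, ℂ)) : ∫ x, reflectTranslate K 0 x = ∫ x, K x := by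
  simp only [reflectTranslate_apply, zero_sub]
  exact integral_neg_eq_self (fun x => K x) volume

theorem reflectTranslate_dyadic (K : 𝓢(Eucl d, ℂ)) (L : ℕ) :
    reflectTranslate (dyadic K L) 0 = dyadic (reflectTranslate K 0) L := by
  ext x
  simp [reflectTranslate_apply, dyadic_apply]

/-- A tempered distribution all of whose Littlewood-Paley pieces vanish is zero. -/
theorem LittlewoodPaley.eq_zero_of_conv (Φ : LittlewoodPaley d) {f : 𝓢'(Eucl d, ℂ)}
    (h0 : ∀ x, conv Φ.φ₀ f x = 0) (h : ∀ l x, conv (Φ.piece l) f x = 0) : f = 0 := by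
  have hlow (L : ℕ) (x : Eucl d) : conv (Φ.low L) f x = 0 := by
    induction L with
    | zero => rw [Φ.low_zero, h0]
    | succ L ih => rw [Φ.low_succ, conv_add_left, ih, h, add_zero]
  ext g
  have hK : ∫ x, reflectTranslate Φ.φ₀ 0 x = 1 := by
    rw [integral_reflectTranslate]
    refine integral_eq_one_of_fourier ?_
    rw [← Φ.low_zero]
    exact Φ.fourier_low_eq_one (by simp)
  -- f is the limit of its low-frequency truncations when tested against g, and all of these vanish.
  refine tendsto_nhds_unique (distr_star_dyadic_tendsto f _ g hK) ?_
  refine tendsto_const_nhds.congr fun L => ?_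
  rw [← reflectTranslate_dyadic, star_comm, ← integral_mul_conv]
  have : ∀ y, conv (dyadic Φ.φ₀ L) f y = 0 := hlow L
  simp [this]

end

/-! ### Young's inequality and dominated convergence in `L^p` -/

section

variable {d : ℕ}

/-- Hölder's inequality after splitting k = k^(1 - 1/r) · k^(1/r); the exponent 1 - 1/r may be 0. -/
theorem lintegral_mul_rpow_le {X : Type*} [MeasurableSpace X] {μ : Measure X} {k h : X → ℝ≥0∞}
    (hk : Measurable k) (hh : Measurable h) {r : ℝ} (hr : 1 ≤ r) :
    (∫⁻ y, k y * h y ∂μ) ^ r ≤ (∫⁻ y, k y ∂μ) ^ (r - 1) * ∫⁻ y, k y * h y ^ r ∂μ := by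
  have hr0 : 0 < r := by linarith
  have hi : r⁻¹ ≤ 1 := inv_le_one_of_one_le₀ hr
  have h1 := ENNReal.lintegral_mul_norm_pow_le (μ := μ) hk.aemeasurable
    (hk.mul (hh.pow_const r)).aemeasurable (p := 1 - r⁻¹) (q := r⁻¹) (by linarith) (by positivity)
    (by ring)
  have h2 (y : X) : k y ^ (1 - r⁻¹) * (k y * h y ^ r) ^ r⁻¹ = k y * h y := by
    rw [ENNReal.mul_rpow_of_nonneg _ _ (by positivity), ← ENNReal.rpow_mul, mul_inv_cancel₀ hr0.ne',
      ENNReal.rpow_one, ← mul_assoc, ← ENNReal.rpow_add_of_nonneg _ _ (by linarith) (by positivity),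
      sub_add_cancel, ENNReal.rpow_one]
  simp only [Pi.mul_apply, h2] at h1
  refine (ENNReal.rpow_le_rpow h1 hr0.le).trans_eq ?_
  rw [ENNReal.mul_rpow_of_nonneg _ _ hr0.le, ← ENNReal.rpow_mul, ← ENNReal.rpow_mul,
    inv_mul_cancel₀ hr0.ne', ENNReal.rpow_one, sub_mul, inv_mul_cancel₀ hr0.ne', one_mul]

/-- The pointwise Hölder bound reduces to r-th powers of g; Tonelli and translation invariance then
contribute one more factor ∫ k, for a total exponent (r - 1) + 1. -/
theorem lintegral_conv_rpow_le {k g : Eucl d → ℝ≥0∞} (hk : Measurable k) (hg : Measurable g)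
    {r : ℝ} (hr : 1 ≤ r) :
    ∫⁻ x, (∫⁻ y, k y * g (x - y)) ^ r ≤ (∫⁻ y, k y) ^ r * ∫⁻ x, g x ^ r := by
  have hm : Measurable fun z : Eucl d × Eucl d => k z.2 * g (z.1 - z.2) ^ r :=
    (hk.comp measurable_snd).mul ((hg.comp (measurable_fst.sub measurable_snd)).pow_const r)
  calc ∫⁻ x, (∫⁻ y, k y * g (x - y)) ^ r
      ≤ ∫⁻ x, (∫⁻ y, k y) ^ (r - 1) * ∫⁻ y, k y * g (x - y) ^ r := lintegral_mono fun x =>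
        lintegral_mul_rpow_le hk (hg.comp (measurable_const.sub measurable_id)) hr
    _ = (∫⁻ y, k y) ^ (r - 1) * ∫⁻ x, ∫⁻ y, k y * g (x - y) ^ r :=
        lintegral_const_mul _ hm.lintegral_prod_right'
    _ = (∫⁻ y, k y) ^ (r - 1) * ∫⁻ y, ∫⁻ x, k y * g (x - y) ^ r := by
        rw [lintegral_lintegral_swap hm.aemeasurable]
    _ = (∫⁻ y, k y) ^ (r - 1) * ((∫⁻ y, k y) * ∫⁻ x, g x ^ r) := by
        congr 1
        rw [← lintegral_mul_const _ hk]
        refine lintegral_congr fun y => ?_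
        have hm' : Measurable fun x => g (x - y) ^ r :=
          (hg.comp (measurable_id.sub measurable_const)).pow_const r
        rw [lintegral_const_mul _ hm', lintegral_sub_right_eq_self fun x => g x ^ r]
    _ = _ := by
        rw [← mul_assoc]
        congr 1
        nth_rewrite 2 [← ENNReal.rpow_one (∫⁻ y, k y)]
        rw [← ENNReal.rpow_add_of_nonneg _ _ (by linarith) zero_le_one, sub_add_cancel]

variable {p : ℝ≥0∞} [hp1 : Fact (1 ≤ p)]

theorem eLpNorm_eq_lintegral_rpow (hp : p ≠ ∞) (f : Eucl d → ℂ) :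
    eLpNorm f p = (∫⁻ x, ‖f x‖ₑ ^ p.toReal) ^ (1 / p.toReal) :=
  eLpNorm_eq_lintegral_rpow_enorm_toReal (zero_lt_one.trans_le hp1.out).ne' hp

theorem one_le_toReal (hp : p ≠ ∞) : 1 ≤ p.toReal := by
  simpa using ENNReal.toReal_mono hp hp1.out

/-- Young's inequality `‖k * g‖_p ≤ ‖k‖_1 ‖g‖_p`. -/
theorem eLpNorm_conv_le (hp : p ≠ ∞) {k g : Eucl d → ℂ} (hk : Measurable k) (hg : Measurable g) :
    eLpNorm (fun x => ∫ y, k y * g (x - y)) p ≤ eLpNorm k 1 * eLpNorm g p := by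
  have hr := one_le_toReal hp
  have hr0 : 0 < p.toReal := by linarith
  rw [eLpNorm_eq_lintegral_rpow hp, eLpNorm_eq_lintegral_rpow hp, eLpNorm_one_eq_lintegral_enorm]
  have h1 : ∫⁻ x, ‖∫ y, k y * g (x - y)‖ₑ ^ p.toReal ≤
      (∫⁻ y, ‖k y‖ₑ) ^ p.toReal * ∫⁻ x, ‖g x‖ₑ ^ p.toReal := by
    refine le_trans (lintegral_mono fun x => ENNReal.rpow_le_rpow
      (enorm_integral_le_lintegral_enorm _) hr0.le) ?_
    simp only [enorm_mul]
    exact lintegral_conv_rpow_le hk.enorm hg.enorm hr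
  refine (ENNReal.rpow_le_rpow h1 (by positivity)).trans_eq ?_
  rw [ENNReal.mul_rpow_of_nonneg _ _ (by positivity), ← ENNReal.rpow_mul,
    mul_one_div_cancel hr0.ne', ENNReal.rpow_one]

/-- The limit is its own majorant, so |F n - f|^p ≤ (2|f|)^p, which is integrable because p is
finite. -/
theorem tendsto_eLpNorm_sub_of_dominated (hp : p ≠ ∞) {F : ℕ → Eucl d → ℂ} {f : Eucl d → ℂ}
    (hF : ∀ n, AEStronglyMeasurable (F n)) (hf : MemLp f p)
    (hbound : ∀ n, ∀ᵐ x, ‖F n x‖ ≤ ‖f x‖)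
    (hlim : ∀ᵐ x, Tendsto (fun n => F n x) atTop (𝓝 (f x))) :
    Tendsto (fun n => eLpNorm (F n - f) p) atTop (𝓝 0) := by
  have hr0 : 0 < p.toReal := zero_lt_one.trans_le (one_le_toReal hp)
  simp only [eLpNorm_eq_lintegral_rpow hp]
  have h0 : (0 : ℝ≥0∞) = 0 ^ (1 / p.toReal) := by
    rw [ENNReal.zero_rpow_of_pos (by positivity)]
  rw [h0]
  refine ((ENNReal.continuous_rpow_const (y := 1 / p.toReal)).tendsto 0).comp ?_
  have h1 : ∫⁻ _ : Eucl d, (0 : ℝ≥0∞) = 0 := lintegral_zero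
  rw [← h1]
  refine tendsto_lintegral_of_dominated_convergence' (fun x => (2 * ‖f x‖ₑ) ^ p.toReal)
    (fun n => (((hF n).sub hf.1).enorm.pow_const _)) (fun n => ?_) ?_ ?_
  · filter_upwards [hbound n] with x hx
    refine ENNReal.rpow_le_rpow ?_ hr0.le
    refine (enorm_sub_le (a := F n x) (b := f x)).trans ?_
    rw [two_mul]
    gcongr
    exact enorm_le_iff_norm_le.2 hx
  · simp only [ENNReal.mul_rpow_of_nonneg _ _ hr0.le]
    rw [lintegral_const_mul' _ _ (by finiteness)]
    refine ENNReal.mul_ne_top (by finiteness) ?_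
    exact (lintegral_rpow_enorm_lt_top_of_eLpNorm_lt_top (zero_lt_one.trans_le hp1.out).ne' hp
      hf.2).ne
  · filter_upwards [hlim] with x hx
    have h2 : Tendsto (fun n => ‖F n x - f x‖ₑ) atTop (𝓝 0) := by
      have := (continuous_enorm.tendsto _).comp (hx.sub_const (f x))
      rwa [sub_self, enorm_zero] at this
    have h3 := ((ENNReal.continuous_rpow_const (y := p.toReal)).tendsto 0).comp h2
    rwa [ENNReal.zero_rpow_of_pos hr0] at h3

theorem conv_toTemperedDistribution (K : 𝓢(Eucl d, ℂ)) (G : Lp ℂ p (volume : Measure (Eucl d)))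
    (x : Eucl d) :
    conv K (Lp.toTemperedDistribution G) x = ∫ y, K (x - y) * G y := by
  rw [conv, Lp.toTemperedDistribution_apply]
  simp only [reflectTranslate_apply, smul_eq_mul]

theorem eLpNorm_conv_Lp_le (hp : p ≠ ∞) (K : 𝓢(Eucl d, ℂ))
    (G : Lp ℂ p (volume : Measure (Eucl d))) :
    eLpNorm (conv K (Lp.toTemperedDistribution G)) p ≤ eLpNorm K 1 * eLpNorm G p := by
  refine le_trans (le_of_eq ?_) (eLpNorm_conv_le hp K.continuous.measurable
    (Lp.stronglyMeasurable G).measurable)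
  congr 1
  ext x
  rw [conv_toTemperedDistribution, ← integral_sub_left_eq_self _ volume x]
  simp

theorem memLp_conv_Lp (hp : p ≠ ∞) (K : 𝓢(Eucl d, ℂ)) (G : Lp ℂ p (volume : Measure (Eucl d))) :
    MemLp (conv K (Lp.toTemperedDistribution G)) p :=
  ⟨(continuous_conv K (Lp.toTemperedDistribution G)).aestronglyMeasurable,
    (eLpNorm_conv_Lp_le hp K G).trans_lt
      (ENNReal.mul_lt_top (K.memLp 1 volume).2 (Lp.memLp G).2)⟩

/-- Convolution with a Schwartz function, as a linear operator on `L^p`. -/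
noncomputable def convLp (hp : p ≠ ∞) (K : 𝓢(Eucl d, ℂ)) :
    Lp ℂ p (volume : Measure (Eucl d)) →ₗ[ℂ] Lp ℂ p (volume : Measure (Eucl d)) where
  toFun G := (memLp_conv_Lp hp K G).toLp _
  map_add' G H := by
    rw [← MemLp.toLp_add]
    congr 1
    ext x
    change conv K (Lp.toTemperedDistributionCLM ℂ volume p (G + H)) x = _
    rw [map_add]
    rfl
  map_smul' c G := by
    rw [RingHom.id_apply, ← MemLp.toLp_const_smul]
    congr 1
    ext x
    change conv K (Lp.toTemperedDistributionCLM ℂ volume p (c • G)) x = _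
    rw [map_smul]
    rfl

theorem coeFn_convLp (hp : p ≠ ∞) (K : 𝓢(Eucl d, ℂ)) (G : Lp ℂ p (volume : Measure (Eucl d))) :
    convLp hp K G =ᵐ[volume] conv K (Lp.toTemperedDistribution G) :=
  MemLp.coeFn_toLp (memLp_conv_Lp hp K G)

theorem conv_convLp (hp : p ≠ ∞) (K' K : 𝓢(Eucl d, ℂ)) (G : Lp ℂ p (volume : Measure (Eucl d)))
    (x : Eucl d) :
    conv K' (Lp.toTemperedDistribution (convLp hp K G)) x =
      conv (star K' K) (Lp.toTemperedDistribution G) x := by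
  rw [conv_toTemperedDistribution, ← integral_conv_eq_conv_star]
  refine integral_congr_ae ?_
  filter_upwards [coeFn_convLp hp K G] with y hy
  rw [hy]

end

/-! ### Fourier multipliers with bounded symbols supported in the unit ball -/

section

variable {d : ℕ}

/-- Bounded measurable functions supported in the unit ball. -/
structure IsSymbol (a : Eucl d → ℂ) : Prop where
  measurable : Measurable a
  bounded : ∃ C, ∀ η, ‖a η‖ ≤ C
  support : ∀ η, 1 < ‖η‖ → a η = 0

theorem integrable_of_bounded_of_support {a : Eucl d → ℂ} (hm : Measurable a) {C R : ℝ}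
    (hC : ∀ η, ‖a η‖ ≤ C) (hR : ∀ η, R < ‖η‖ → a η = 0) : Integrable a := by
  have hsub : Function.support a ⊆ Metric.closedBall 0 R := fun η hη => by
    rw [mem_closedBall_zero_iff]
    by_contra hlt
    exact hη (hR η (not_le.1 hlt))
  rw [← integrableOn_iff_integrable_of_support_subset hsub]
  exact Measure.integrableOn_of_bounded measure_closedBall_lt_top.ne hm.aestronglyMeasurable
    (M := C) (ae_of_all _ hC)

namespace IsSymbol

variable {a b : Eucl d → ℂ}

theorem integrable (ha : IsSymbol a) : Integrable a :=
  let ⟨_, hC⟩ := ha.bounded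
  integrable_of_bounded_of_support ha.measurable hC ha.support

theorem mul_bounded (ha : IsSymbol a) (hb : Measurable b) (hbb : ∃ C, ∀ η, ‖b η‖ ≤ C) :
    IsSymbol fun η => a η * b η := by
  obtain ⟨A, hA⟩ := ha.bounded
  obtain ⟨B, hB⟩ := hbb
  refine ⟨ha.measurable.mul hb, ⟨A * B, fun η => ?_⟩, fun η hη => by rw [ha.support η hη, zero_mul]⟩
  rw [norm_mul]
  exact mul_le_mul (hA η) (hB η) (norm_nonneg _) ((norm_nonneg _).trans (hA η))

theorem mul (ha : IsSymbol a) (hb : IsSymbol b) : IsSymbol fun η => a η * b η :=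
  ha.mul_bounded hb.measurable hb.bounded

theorem mul_schwartz (ha : IsSymbol a) (f : 𝓢(Eucl d, ℂ)) : IsSymbol fun η => a η * f η :=
  ha.mul_bounded f.continuous.measurable ⟨_, fun η => f.norm_le_seminorm ℂ η⟩

theorem add (ha : IsSymbol a) (hb : IsSymbol b) : IsSymbol fun η => a η + b η := by
  obtain ⟨A, hA⟩ := ha.bounded
  obtain ⟨B, hB⟩ := hb.bounded
  exact ⟨ha.measurable.add hb.measurable, ⟨A + B, fun η => norm_add_le_of_le (hA η) (hB η)⟩,
    fun η hη => by rw [ha.support η hη, hb.support η hη, add_zero]⟩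

end IsSymbol

/-- The inverse Fourier transform `∫ h(η) e^{2π i x·η} dη`. -/
noncomputable def ift (h : Eucl d → ℂ) : Eucl d → ℂ := 𝓕⁻ h

theorem ift_eq (h : Eucl d → ℂ) (x : Eucl d) :
    ift h x = ∫ v, Complex.exp (↑(2 * Real.pi * inner ℝ v x) * Complex.I) • h v :=
  Real.fourierInv_eq' h x

theorem coe_fourierInv_eq_ift (g : 𝓢(Eucl d, ℂ)) : ⇑(𝓕⁻ g : 𝓢(Eucl d, ℂ)) = ift g := SchwartzMap.fourierInv_coe g

theorem continuous_fourierInv {h : Eucl d → ℂ} (hh : Integrable h) : Continuous (ift h) := by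
  rw [ift, Real.fourierInv_eq_fourier_comp_neg]
  exact VectorFourier.fourierIntegral_continuous (L := innerₗ (Eucl d))
    Real.continuous_fourierChar
    (show Continuous fun z : Eucl d × Eucl d => inner ℝ z.1 z.2 from continuous_inner) hh.comp_neg

theorem tendsto_fourierInv_of_dominated {F : ℕ → Eucl d → ℂ} {h : Eucl d → ℂ} {b : Eucl d → ℝ}
    (hF : ∀ n, Measurable (F n)) (hb : Integrable b) (hbound : ∀ n η, ‖F n η‖ ≤ b η)
    (hlim : ∀ᵐ η, Tendsto (fun n => F n η) atTop (𝓝 (h η))) (x : Eucl d) :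
    Tendsto (fun n => ift (F n) x) atTop (𝓝 (ift h x)) := by
  simp only [ift_eq]
  refine tendsto_integral_of_dominated_convergence b (fun n => ?_) hb
    (fun n => ae_of_all _ fun η => ?_) ?_
  · exact (by fun_prop : Continuous fun η : Eucl d =>
      Complex.exp (↑(2 * Real.pi * inner ℝ η x) * Complex.I)).aestronglyMeasurable.smul
        (hF n).aestronglyMeasurable
  · rw [norm_smul, Complex.norm_exp_ofReal_mul_I, one_mul]
    exact hbound n η
  · filter_upwards [hlim] with η hη
    exact hη.const_smul _

theorem norm_fourierInv_le (h : Eucl d → ℂ) (x : Eucl d) : ‖ift h x‖ ≤ ∫ η, ‖h η‖ := by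
  rw [ift_eq]
  refine (norm_integral_le_integral_norm _).trans_eq ?_
  simp only [norm_smul, Complex.norm_exp_ofReal_mul_I, one_mul]

/-- A band-limited function is approximated by band-limited Schwartz functions, both in space and
in frequency. -/
theorem IsSymbol.exists_schwartz_approx {h : Eucl d → ℂ} (hh : IsSymbol h) :
    ∃ f : ℕ → 𝓢(Eucl d, ℂ), (∀ n x, ‖f n x‖ ≤ ‖ift h x‖) ∧
      (∃ C, ∀ n η, ‖𝓕 (f n) η‖ ≤ C) ∧ (∀ n η, 2 < ‖η‖ → 𝓕 (f n) η = 0) ∧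
      ∀ᵐ η, Tendsto (fun n => 𝓕 (f n) η) atTop (𝓝 (h η)) := by
  obtain ⟨C, hC⟩ := hh.bounded
  -- Outer radius at most 1 keeps the mollified symbol inside the ball of radius 2. The ratio 2 of
  -- the radii is the bounded eccentricity required by Lebesgue differentiation at the end.
  let φ (n : ℕ) : ContDiffBump (0 : Eucl d) :=
    ⟨(1 / ((n : ℝ) + 1)) / 2, 1 / ((n : ℝ) + 1), by positivity, half_lt_self (by positivity)⟩
  have hφ1 (n : ℕ) : (φ n).rOut ≤ 1 := by
    change 1 / ((n : ℝ) + 1) ≤ 1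
    rw [div_le_one (by positivity)]
    linarith [(Nat.cast_nonneg n : (0 : ℝ) ≤ n)]
  let H (n : ℕ) : Eucl d → ℂ :=
    MeasureTheory.convolution ((φ n).normed volume) h (ContinuousLinearMap.lsmul ℝ ℝ) volume
  have hHeq (n : ℕ) (x : Eucl d) : H n x = ∫ t, (φ n).normed volume t • h (x - t) := rfl
  have hHs (n : ℕ) : ContDiff ℝ ((⊤ : ℕ∞) : WithTop ℕ∞) (H n) :=
    (φ n).hasCompactSupport_normed.contDiff_convolution_left _ (φ n).contDiff_normed
      hh.integrable.locallyIntegrable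
  have hcs : HasCompactSupport h := HasCompactSupport.of_support_subset_isCompact
    (isCompact_closedBall (0 : Eucl d) 1) fun η hη => by
      rw [mem_closedBall_zero_iff]
      by_contra hlt
      exact hη (hh.support η (not_le.1 hlt))
  have hHc (n : ℕ) : HasCompactSupport (H n) :=
    (φ n).hasCompactSupport_normed.convolution _ hcs
  have hHb (n : ℕ) (η : Eucl d) : ‖H n η‖ ≤ C := by
    rw [hHeq]
    refine (norm_integral_le_of_norm_le (g := fun t => (φ n).normed volume t * C)
      ((φ n).integrable_normed.mul_const C) (ae_of_all _ fun t => ?_)).trans_eq ?_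
    · rw [norm_smul, Real.norm_of_nonneg ((φ n).nonneg_normed t)]
      exact mul_le_mul_of_nonneg_left (hC _) ((φ n).nonneg_normed t)
    · rw [integral_mul_const, (φ n).integral_normed, one_mul]
  have hH0 (n : ℕ) (η : Eucl d) (hη : 2 < ‖η‖) : H n η = 0 := by
    rw [hHeq]
    refine integral_eq_zero_of_ae (ae_of_all _ fun t => ?_)
    by_cases ht : (φ n).normed volume t = 0
    · simp [ht]
    · have h1 : t ∈ Function.support ((φ n).normed volume) := ht
      rw [(φ n).support_normed_eq, mem_ball_zero_iff] at h1
      have h2 := norm_sub_norm_le η t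
      change _ • h (η - t) = 0
      rw [hh.support _ (by linarith [hφ1 n]), smul_zero]
  have hF (n : ℕ) : 𝓕 (𝓕⁻ ((hHc n).toSchwartzMap (hHs n))) = (hHc n).toSchwartzMap (hHs n) :=
    FourierTransform.fourier_fourierInv_eq _
  refine ⟨fun n => 𝓕⁻ ((hHc n).toSchwartzMap (hHs n)), fun n x => ?_, ⟨C, fun n η => ?_⟩,
    fun n η hη => ?_, ?_⟩
  · rw [coe_fourierInv_eq_ift]
    change ‖ift (H n) x‖ ≤ _
    -- Mollifying in frequency multiplies in space by the inverse transform of the bump, of modulus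
    -- at most ∫ φ = 1. Hence the domination by `ift h`; the complex form of H n fits the
    -- convolution theorem.
    have hc : H n = MeasureTheory.convolution (fun t => ((φ n).normed volume t : ℂ)) h
        (ContinuousLinearMap.lsmul ℂ ℂ) volume := by
      ext η
      rw [hHeq]
      rfl
    have hm := Real.fourier_smul_convolution_eq (f₁ := fun t => ((φ n).normed volume t : ℂ))
      (φ n).integrable_normed.ofReal hh.integrable (-x)
    rw [← hc, ← Real.fourierInv_eq_fourier_neg, ← Real.fourierInv_eq_fourier_neg,
      ← Real.fourierInv_eq_fourier_neg] at hm
    rw [ift, ift, hm, norm_smul]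
    refine mul_le_of_le_one_left (norm_nonneg _) ((norm_fourierInv_le _ _).trans_eq ?_)
    simp only [Complex.norm_real, Real.norm_of_nonneg ((φ n).nonneg_normed _)]
    exact (φ n).integral_normed
  · rw [hF]
    exact hHb n η
  · rw [hF]
    exact hH0 n η hη
  · have := ContDiffBump.ae_convolution_tendsto_right_of_locallyIntegrable (μ := volume)
      (φ := φ) (l := atTop) (K := 2) (g := h) tendsto_one_div_add_atTop_nhds_zero_nat
      (Eventually.of_forall fun n => by change _ ≤ 2 * ((1 / ((n : ℝ) + 1)) / 2); linarith)
      hh.integrable.locallyIntegrable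
    filter_upwards [this] with η hη
    simp only [hF]
    exact hη

variable {p : ℝ≥0∞} [hp1 : Fact (1 ≤ p)]

/-- The operator `A` on `L^p` is the Fourier multiplier with symbol `a`. -/
def IsMult (A : Lp ℂ p (volume : Measure (Eucl d)) →L[ℂ] Lp ℂ p (volume : Measure (Eucl d)))
    (a : Eucl d → ℂ) : Prop :=
  ∀ f : 𝓢(Eucl d, ℂ), A (f.toLp p) =ᵐ[volume] ift (fun η => a η * 𝓕 f η)

theorem Lp_clm_ext (hp : p ≠ ∞)
    {F : Type*} [NormedAddCommGroup F] [NormedSpace ℂ F]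
    {A B : Lp ℂ p (volume : Measure (Eucl d)) →L[ℂ] F}
    (h : ∀ f : 𝓢(Eucl d, ℂ), A (f.toLp p) = B (f.toLp p)) : A = B := by
  have hd := SchwartzMap.denseRange_toLpCLM (E := Eucl d) (F := ℂ) (μ := volume) hp
  exact DFunLike.coe_injective (hd.equalizer A.continuous B.continuous (funext h))

theorem IsMult.unique (hp : p ≠ ∞)
    {A B : Lp ℂ p (volume : Measure (Eucl d)) →L[ℂ] Lp ℂ p (volume : Measure (Eucl d))}
    {a : Eucl d → ℂ} (hA : IsMult A a) (hB : IsMult B a) : A = B :=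
  Lp_clm_ext hp fun f => Lp.ext ((hA f).trans (hB f).symm)

theorem IsMult.add
    {A B : Lp ℂ p (volume : Measure (Eucl d)) →L[ℂ] Lp ℂ p (volume : Measure (Eucl d))}
    {a b : Eucl d → ℂ} (ha : IsSymbol a) (hb : IsSymbol b) (hA : IsMult A a) (hB : IsMult B b) :
    IsMult (A + B) fun η => a η + b η := fun f => by
  rw [add_apply]
  filter_upwards [Lp.coeFn_add (A (f.toLp p)) (B (f.toLp p)), hA f, hB f] with x h1 h2 h3
  rw [h1, Pi.add_apply, h2, h3]
  simp only [ift, Real.fourierInv_eq, add_mul, smul_add]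
  rw [integral_add]
  · simpa [Real.fourierIntegral_convergent_iff] using
      (Real.fourierIntegral_convergent_iff (-x)).2 (ha.mul_schwartz (𝓕 f)).integrable
  · simpa [Real.fourierIntegral_convergent_iff] using
      (Real.fourierIntegral_convergent_iff (-x)).2 (hb.mul_schwartz (𝓕 f)).integrable

theorem IsMult.smul
    {A : Lp ℂ p (volume : Measure (Eucl d)) →L[ℂ] Lp ℂ p (volume : Measure (Eucl d))}
    {a : Eucl d → ℂ} (hA : IsMult A a) (c : ℂ) :
    IsMult (c • A) fun η => c * a η := fun f => by
  rw [smul_apply]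
  filter_upwards [Lp.coeFn_smul c (A (f.toLp p)), hA f] with x h1 h2
  rw [h1, Pi.smul_apply, h2]
  simp only [ift_eq]
  rw [← integral_smul]
  congr 1
  ext η
  simp only [smul_eq_mul]
  ring

/-- Fatou's lemma for the L^p norm of g n - G identifies the L^p limit with the pointwise one,
without extracting a subsequence. -/
theorem ae_eq_of_tendsto_Lp {g : ℕ → Lp ℂ p (volume : Measure (Eucl d))}
    {G : Lp ℂ p (volume : Measure (Eucl d))} {F : ℕ → Eucl d → ℂ} {f : Eucl d → ℂ}
    (hG : Tendsto g atTop (𝓝 G)) (hgF : ∀ n, g n =ᵐ[volume] F n)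
    (hlim : ∀ x, Tendsto (fun n => F n x) atTop (𝓝 (f x))) (hf : AEStronglyMeasurable f) :
    G =ᵐ[volume] f := by
  rw [Lp.tendsto_Lp_iff_tendsto_eLpNorm'] at hG
  have h1 := Lp.eLpNorm_lim_le_liminf_eLpNorm (p := p) (μ := (volume : Measure (Eucl d)))
    (f := fun n x => g n x - G x) (fun n => (Lp.aestronglyMeasurable _).sub (Lp.aestronglyMeasurable _))
    (fun x => f x - G x) (by
      filter_upwards [ae_all_iff.2 hgF] with x hx
      simp only [hx]
      exact (hlim x).sub_const _)
  have h0 : liminf (fun n => eLpNorm (fun x => g n x - G x) p volume) atTop = 0 := hG.liminf_eq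
  rw [h0, nonpos_iff_eq_zero] at h1
  have h2 : AEStronglyMeasurable fun x => f x - G x := hf.sub (Lp.aestronglyMeasurable _)
  rw [eLpNorm_eq_zero_iff h2 (zero_lt_one.trans_le hp1.out).ne'] at h1
  filter_upwards [h1] with x hx
  exact (sub_eq_zero.1 hx).symm

theorem tendsto_toLp_of_dominated (hp : p ≠ ∞) {f : ℕ → 𝓢(Eucl d, ℂ)} {v : Eucl d → ℂ}
    {u : Lp ℂ p (volume : Measure (Eucl d))} (hu : u =ᵐ[volume] v)
    (hbound : ∀ n x, ‖f n x‖ ≤ ‖v x‖) (hlim : ∀ x, Tendsto (fun n => f n x) atTop (𝓝 (v x))) :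
    Tendsto (fun n => (f n).toLp p) atTop (𝓝 u) := by
  have hmem : MemLp v p := (memLp_congr_ae hu).1 (Lp.memLp u)
  rw [Lp.tendsto_Lp_iff_tendsto_eLpNorm']
  have h1 := tendsto_eLpNorm_sub_of_dominated hp (F := fun n x => f n x)
    (fun n => (f n).continuous.aestronglyMeasurable) hmem (fun n => ae_of_all _ (hbound n))
    (ae_of_all _ hlim)
  refine h1.congr fun n => eLpNorm_congr_ae ?_
  filter_upwards [(f n).coeFn_toLp p volume, hu] with x hx1 hx2
  rw [Pi.sub_apply, Pi.sub_apply, hx1, hx2]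

/-- A multiplier acts as expected on all band-limited functions in `L^p`. -/
theorem IsMult.apply_bandLimited (hp : p ≠ ∞)
    {A : Lp ℂ p (volume : Measure (Eucl d)) →L[ℂ] Lp ℂ p (volume : Measure (Eucl d))}
    {a h : Eucl d → ℂ} (ha : IsSymbol a) (hA : IsMult A a) (hh : IsSymbol h)
    {u : Lp ℂ p (volume : Measure (Eucl d))} (hu : u =ᵐ[volume] ift h) :
    A u =ᵐ[volume] ift (fun η => a η * h η) := by
  -- u need not be Schwartz, so the formula is passed to the limit along Schwartz approximants: in
  -- L^p on the operator side, pointwise on the integral side.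
  obtain ⟨f, hfu, ⟨C, hC⟩, hf2, hlim⟩ := hh.exists_schwartz_approx
  have hpt (x : Eucl d) : Tendsto (fun n => f n x) atTop (𝓝 (ift h x)) := by
    have h1 : ∀ n, f n x = ift (fun η => 𝓕 (f n) η) x := fun n => by
      have : 𝓕⁻ (𝓕 (f n)) x = f n x := by rw [FourierTransform.fourierInv_fourier_eq]
      rw [← this, coe_fourierInv_eq_ift]
    simp only [h1]
    refine tendsto_fourierInv_of_dominated (b := (Metric.closedBall 0 2).indicator fun _ => C)
      (fun n => (𝓕 (f n)).continuous.measurable) ?_ (fun n η => ?_) hlim x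
    · exact (integrable_indicator_iff measurableSet_closedBall).2
        (integrableOn_const measure_closedBall_lt_top.ne)
    · by_cases hη : η ∈ Metric.closedBall (0 : Eucl d) 2
      · rw [Set.indicator_of_mem hη]
        exact hC n η
      · rw [Set.indicator_of_notMem hη]
        rw [mem_closedBall_zero_iff, not_le] at hη
        rw [hf2 n η hη, norm_zero]
  have hA2 : Tendsto (fun n => A ((f n).toLp p)) atTop (𝓝 (A u)) :=
    (A.continuous.tendsto u).comp (tendsto_toLp_of_dominated hp hu hfu hpt)
  refine ae_eq_of_tendsto_Lp hA2 (fun n => hA (f n)) (fun x => ?_)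
    (continuous_fourierInv (ha.mul hh).integrable).aestronglyMeasurable
  refine tendsto_fourierInv_of_dominated (b := fun η => ‖a η‖ * C)
    (fun n => (ha.mul_schwartz (𝓕 (f n))).measurable) (ha.integrable.norm.mul_const C)
    (fun n η => ?_) ?_ x
  · rw [norm_mul]
    exact mul_le_mul_of_nonneg_left (hC n η) (norm_nonneg _)
  · filter_upwards [hlim] with η hη
    exact hη.const_mul _

/-- B may send a Schwartz function outside the Schwartz class, but the image is still band-limited,
which is what `IsMult.apply_bandLimited` handles. -/
theorem IsMult.comp (hp : p ≠ ∞)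
    {A B : Lp ℂ p (volume : Measure (Eucl d)) →L[ℂ] Lp ℂ p (volume : Measure (Eucl d))}
    {a b : Eucl d → ℂ} (ha : IsSymbol a) (hb : IsSymbol b) (hA : IsMult A a) (hB : IsMult B b) :
    IsMult (A * B) fun η => a η * b η := fun f => by
  have := hA.apply_bandLimited hp ha (hb.mul_schwartz (𝓕 f)) (hB f)
  simp only [mul_assoc]
  exact this

end

/-! ### Construction of L^p multipliers, their kernels, and a lower bound for their norms. -/

section

variable {d : ℕ} {p : ℝ≥0∞} [hp1 : Fact (1 ≤ p)]

theorem fourierInv_add {g h : Eucl d → ℂ} (hg : Integrable g) (hh : Integrable h) (x : Eucl d) :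
    ift (fun η => g η + h η) x = ift g x + ift h x := by
  simp only [ift, Real.fourierInv_eq, smul_add]
  have hi {g : Eucl d → ℂ} (hg : Integrable g) : Integrable fun v => Real.fourierChar (inner ℝ v x) • g v := by
    simpa using (Real.fourierIntegral_convergent_iff (-x)).2 hg
  exact integral_add (hi hg) (hi hh)

theorem fourierInv_const_mul (c : ℂ) (h : Eucl d → ℂ) (x : Eucl d) :
    ift (fun η => c * h η) x = c * ift h x := by
  simp only [ift_eq]
  rw [← integral_const_mul]
  congr 1
  ext η
  simp only [smul_eq_mul]
  ring

theorem IsSymbol.fourierInv_mul_fourier_add {a : Eucl d → ℂ} (ha : IsSymbol a) (f g : 𝓢(Eucl d, ℂ))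
    (x : Eucl d) : ift (fun η => a η * 𝓕 (f + g) η) x =
      ift (fun η => a η * 𝓕 f η) x + ift (fun η => a η * 𝓕 g η) x := by
  rw [← fourierInv_add (ha.mul_schwartz (𝓕 f)).integrable (ha.mul_schwartz (𝓕 g)).integrable]
  have h : (fun η => a η * 𝓕 (f + g) η) = fun η => a η * 𝓕 f η + a η * 𝓕 g η := by
    ext η
    rw [FourierTransform.fourier_add, add_apply, mul_add]
  rw [h]

theorem fourierInv_mul_fourier_smul (a : Eucl d → ℂ) (c : ℂ) (f : 𝓢(Eucl d, ℂ)) (x : Eucl d) :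
    ift (fun η => a η * 𝓕 (c • f) η) x = c * ift (fun η => a η * 𝓕 f η) x := by
  rw [← fourierInv_const_mul]
  have h : (fun η => a η * 𝓕 (c • f) η) = fun η => c * (a η * 𝓕 f η) := by
    ext η
    rw [FourierTransform.fourier_smul, smul_apply, smul_eq_mul]
    ring
  rw [h]

theorem IsSymbol.memLp_of_le {a : Eucl d → ℂ} (ha : IsSymbol a) {C : ℝ≥0}
    (hC : ∀ f : 𝓢(Eucl d, ℂ), eLpNorm (ift fun η => a η * 𝓕 f η) p ≤ C * eLpNorm f p)
    (f : 𝓢(Eucl d, ℂ)) : MemLp (ift fun η => a η * 𝓕 f η) p :=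
  ⟨(continuous_fourierInv (ha.mul_schwartz (𝓕 f)).integrable).aestronglyMeasurable,
    (hC f).trans_lt (ENNReal.mul_lt_top ENNReal.coe_lt_top (f.memLp p volume).2)⟩

/-- The operator with symbol `a`, from Schwartz functions to `L^p`. -/
noncomputable def schwartzMult {a : Eucl d → ℂ} (ha : IsSymbol a)
    (hmem : ∀ f : 𝓢(Eucl d, ℂ), MemLp (ift fun η => a η * 𝓕 f η) p) :
    𝓢(Eucl d, ℂ) →ₗ[ℂ] Lp ℂ p (volume : Measure (Eucl d)) where
  toFun f := (hmem f).toLp _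
  map_add' f g := by
    rw [← MemLp.toLp_add, MemLp.toLp_eq_toLp_iff]
    exact ae_of_all _ fun x => ha.fourierInv_mul_fourier_add f g x
  map_smul' c f := by
    rw [RingHom.id_apply, ← MemLp.toLp_const_smul, MemLp.toLp_eq_toLp_iff]
    exact ae_of_all _ fun x => fourierInv_mul_fourier_smul a c f x

theorem schwartzMult_apply {a : Eucl d → ℂ} (ha : IsSymbol a)
    (hmem : ∀ f : 𝓢(Eucl d, ℂ), MemLp (ift fun η => a η * 𝓕 f η) p) (f : 𝓢(Eucl d, ℂ)) :
    schwartzMult ha hmem f = (hmem f).toLp _ := rfl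

theorem schwartzMult_norm_le {a : Eucl d → ℂ} (ha : IsSymbol a)
    (hmem : ∀ f : 𝓢(Eucl d, ℂ), MemLp (ift fun η => a η * 𝓕 f η) p) {C : ℝ≥0}
    (hC : ∀ f : 𝓢(Eucl d, ℂ), eLpNorm (ift fun η => a η * 𝓕 f η) p ≤ C * eLpNorm f p)
    (f : 𝓢(Eucl d, ℂ)) : ‖schwartzMult ha hmem f‖ ≤ (C : ℝ) * ‖f.toLp p volume‖ := by
  rw [schwartzMult_apply, Lp.norm_toLp, SchwartzMap.norm_toLp (f := f) (p := p) (μ := volume),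
    ← ENNReal.coe_toReal, ← ENNReal.toReal_mul]
  exact ENNReal.toReal_mono
    (ENNReal.mul_ne_top ENNReal.coe_ne_top (f.memLp p volume).2.ne) (hC f)

/-- A symbol which satisfies a multiplier bound on Schwartz functions defines an operator on
`L^p`. -/
theorem IsSymbol.exists_isMult (hp : p ≠ ∞) {a : Eucl d → ℂ} (ha : IsSymbol a) (C : ℝ≥0)
    (hC : ∀ f : 𝓢(Eucl d, ℂ), eLpNorm (ift fun η => a η * 𝓕 f η) p ≤ C * eLpNorm f p) :
    ∃ A : Lp ℂ p (volume : Measure (Eucl d)) →L[ℂ] Lp ℂ p (volume : Measure (Eucl d)),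
      IsMult A a := by
  have hd : DenseRange (SchwartzMap.toLpCLM ℂ ℂ p (volume : Measure (Eucl d))).toLinearMap :=
    SchwartzMap.denseRange_toLpCLM (E := Eucl d) (F := ℂ) (μ := volume) hp
  have hmem := ha.memLp_of_le hC
  refine ⟨(schwartzMult ha hmem).extendOfNorm
    (SchwartzMap.toLpCLM ℂ ℂ p (volume : Measure (Eucl d))).toLinearMap, fun f => ?_⟩
  have h := LinearMap.extendOfNorm_eq hd ⟨C, schwartzMult_norm_le ha hmem hC⟩ f
  have h1 : (SchwartzMap.toLpCLM ℂ ℂ p (volume : Measure (Eucl d))).toLinearMap f = f.toLp p := rfl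
  rw [h1] at h
  rw [h, schwartzMult_apply]
  exact (hmem f).coeFn_toLp

/-- The Fourier transform is symmetric for the bilinear pairing ∫ uv. Applied to a and the translate
of f by x, this moves the transform from f onto a. -/
theorem fourierInv_mul_fourier_eq {a : Eucl d → ℂ} (ha : Integrable a) (f : 𝓢(Eucl d, ℂ))
    (x : Eucl d) : ift (fun η => a η * 𝓕 f η) x = ∫ y, ift a y * f (x - y) := by
  have hfx : Integrable fun y => f (y + x) := f.integrable.comp_add_right x
  have h1 := VectorFourier.integral_fourierIntegral_smul_eq_flip (L := innerₗ (Eucl d))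
    (μ := volume) (ν := volume) Real.continuous_fourierChar
    (show Continuous fun z : Eucl d × Eucl d => inner ℝ z.1 z.2 from continuous_inner) ha hfx
  have h2 := VectorFourier.fourierIntegral_comp_add_right Real.fourierChar
    (volume : Measure (Eucl d)) (innerₗ (Eucl d)) f x
  rw [flip_innerₗ] at h1
  change ∫ ξ, 𝓕 a ξ • f (ξ + x) = ∫ η, a η • VectorFourier.fourierIntegral Real.fourierChar
    volume (innerₗ (Eucl d)) (f ∘ fun v => v + x) η at h1
  rw [h2] at h1
  rw [← integral_neg_eq_self]
  simp only [ift, Real.fourierInv_eq_fourier_neg a, neg_neg, sub_neg_eq_add, add_comm x]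
  simp only [smul_eq_mul] at h1
  rw [h1, Real.fourierInv_eq]
  congr 1
  ext η
  rw [SchwartzMap.fourier_coe]
  change Real.fourierChar (inner ℝ η x) • (a η * 𝓕 (f : Eucl d → ℂ) η) =
    a η * (Real.fourierChar (inner ℝ x η) • 𝓕 (f : Eucl d → ℂ) η)
  rw [real_inner_comm, Circle.smul_def, Circle.smul_def, smul_eq_mul, smul_eq_mul]
  ring

theorem IsSymbol.exists_isMult_of_integrable (hp : p ≠ ∞) {a : Eucl d → ℂ} (ha : IsSymbol a)
    (hk : Integrable (ift a)) :
    ∃ A : Lp ℂ p (volume : Measure (Eucl d)) →L[ℂ] Lp ℂ p (volume : Measure (Eucl d)),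
      IsMult A a := by
  have hk1 : eLpNorm (ift a) 1 ≠ ∞ := (memLp_one_iff_integrable.2 hk).2.ne
  refine ha.exists_isMult hp (eLpNorm (ift a) 1).toNNReal fun f => ?_
  rw [ENNReal.coe_toNNReal hk1]
  have h1 : (ift fun η => a η * 𝓕 f η) = fun x => ∫ y, ift a y * f (x - y) :=
    funext fun x => fourierInv_mul_fourier_eq ha.integrable f x
  rw [h1]
  exact eLpNorm_conv_le hp (continuous_fourierInv ha.integrable).measurable f.continuous.measurable

theorem fourierInv_comp_dilate (b : Eucl d → ℂ) (ξ₀ x : Eucl d) {s : ℝ} (hs : 0 < s) :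
    ift (fun η => b (s • (η - ξ₀))) x = ((s ^ d)⁻¹ : ℝ) •
      (Complex.exp (↑(2 * Real.pi * inner ℝ ξ₀ x) * Complex.I) * ift b (s⁻¹ • x)) := by
  have h1 := Measure.integral_comp_smul (μ := (volume : Measure (Eucl d)))
    (fun v => Complex.exp (↑(2 * Real.pi * inner ℝ v (s⁻¹ • x)) * Complex.I) • b v) s
  simp only [finrank_euclideanSpace, Fintype.card_fin] at h1
  rw [abs_of_pos (by positivity)] at h1
  rw [ift_eq, ift_eq, ← mul_smul_comm, ← h1,
    ← integral_add_right_eq_self _ ξ₀, ← integral_const_mul]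
  congr 1
  ext η
  rw [add_sub_cancel_right, inner_smul_left, inner_smul_right, inner_add_left, conj_trivial,
    mul_inv_cancel_left₀ hs.ne', smul_eq_mul, smul_eq_mul, ← mul_assoc, ← Complex.exp_add]
  congr 2
  push_cast
  ring

theorem eLpNorm_dilate (hp : p ≠ ∞) (g : Eucl d → ℂ) {s : ℝ} (hs : 0 < s) :
    eLpNorm (fun x => g (s • x)) p =
      ENNReal.ofReal ((s ^ d)⁻¹) ^ (1 / p).toReal * eLpNorm g p := by
  have hemb : MeasurableEmbedding fun x : Eucl d => s • x :=
    (Homeomorph.smulOfNeZero s hs.ne').measurableEmbedding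
  have h1 := hemb.eLpNorm_map_measure (g := g) (p := p) (μ := volume)
  rw [Measure.map_addHaar_smul _ hs.ne', eLpNorm_smul_measure_of_ne_top hp] at h1
  simp only [finrank_euclideanSpace, Fintype.card_fin] at h1
  rw [abs_of_pos (by positivity)] at h1
  exact h1.symm

/-- Modulation is isometric and dilation scales all L^p norms alike. Since κ does not depend on the
function, it cancels from both sides of an operator bound. -/
theorem eLpNorm_fourierInv_dilate (hp : p ≠ ∞) (ξ₀ : Eucl d) {s : ℝ} (hs : 0 < s) :
    ∃ κ : ℝ≥0∞, κ ≠ 0 ∧ κ ≠ ∞ ∧ ∀ b c : Eucl d → ℂ,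
      (∀ η, c η = b (s • (η - ξ₀))) → eLpNorm (ift c) p = κ * eLpNorm (ift b) p := by
  have hpos : 0 < ((s⁻¹) ^ d)⁻¹ := by positivity
  refine ⟨‖((s ^ d)⁻¹ : ℝ)‖ₑ * ENNReal.ofReal (((s⁻¹) ^ d)⁻¹) ^ (1 / p).toReal, ?_, ?_, fun b c hbc => ?_⟩
  · refine mul_ne_zero ?_ ?_
    · rw [enorm_ne_zero]
      positivity
    · exact (ENNReal.rpow_pos (ENNReal.ofReal_pos.2 hpos) ENNReal.ofReal_ne_top).ne'
  · exact ENNReal.mul_ne_top enorm_ne_top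
      (ENNReal.rpow_ne_top_of_nonneg ENNReal.toReal_nonneg ENNReal.ofReal_ne_top)
  · obtain rfl : c = fun η => b (s • (η - ξ₀)) := funext hbc
    rw [mul_assoc, ← eLpNorm_dilate hp _ (inv_pos.2 hs)]
    have h1 : (ift fun η => b (s • (η - ξ₀))) = ((s ^ d)⁻¹ : ℝ) • fun x =>
        Complex.exp (↑(2 * Real.pi * inner ℝ ξ₀ x) * Complex.I) * ift b (s⁻¹ • x) :=
      funext fun x => fourierInv_comp_dilate b ξ₀ x hs
    rw [h1, eLpNorm_const_smul]
    congr 1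
    refine eLpNorm_congr_norm_ae (ae_of_all _ fun x => ?_)
    rw [norm_mul, Complex.norm_exp_ofReal_mul_I, one_mul]

/-- The norm of a multiplier dominates its symbol at points of continuity. -/
theorem IsMult.norm_symbol_le (hp : p ≠ ∞)
    {A : Lp ℂ p (volume : Measure (Eucl d)) →L[ℂ] Lp ℂ p (volume : Measure (Eucl d))}
    {a : Eucl d → ℂ} (ha : IsSymbol a) (hA : IsMult A a) {ξ₀ : Eucl d} (hc : ContinuousAt a ξ₀)
    {w : 𝓢(Eucl d, ℂ)} (hw : w ≠ 0) : ‖a ξ₀‖ ≤ ‖A‖ := by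
  obtain ⟨C, hC⟩ := ha.bounded
  set ω : 𝓢(Eucl d, ℂ) := 𝓕 w with hω
  have hωw : (ift (ω : Eucl d → ℂ)) = w := by
    rw [← coe_fourierInv_eq_ift, hω, FourierTransform.fourierInv_fourier_eq]
  -- A is tested on functions whose frequencies concentrate at ξ₀ at scale 1/(n+1). Rescaled to unit
  -- size, the symbol becomes a(ξ₀ + ζ/(n+1)), which tends to a(ξ₀).
  let v (n : ℕ) : Eucl d → ℂ := fun ζ => a (ξ₀ + ((n : ℝ) + 1)⁻¹ • ζ) * ω ζ
  have hv (n : ℕ) (ζ : Eucl d) : v n ζ = a (ξ₀ + ((n : ℝ) + 1)⁻¹ • ζ) * ω ζ := rfl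
  have hvm (n : ℕ) : Measurable (v n) :=
    (ha.measurable.comp (by fun_prop)).mul ω.continuous.measurable
  have hvb (n : ℕ) (ζ : Eucl d) : ‖v n ζ‖ ≤ C * ‖ω ζ‖ := by
    rw [hv, norm_mul]
    exact mul_le_mul_of_nonneg_right (hC _) (norm_nonneg _)
  clear_value v ω
  have hvi (n : ℕ) : Integrable (v n) :=
    (ω.integrable.norm.const_mul C).mono' (hvm n).aestronglyMeasurable (ae_of_all _ (hvb n))
  have hle (n : ℕ) : eLpNorm (ift (v n)) p ≤ ‖A‖ₑ * eLpNorm w p := by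
    have hs : (0 : ℝ) < n + 1 := by positivity
    obtain ⟨κ, hκ0, hκ1, hκ⟩ := eLpNorm_fourierInv_dilate (p := p) hp ξ₀ hs
    obtain ⟨g, hg⟩ : ∃ g : 𝓢(Eucl d, ℂ), ∀ η, g η = ω (((n : ℝ) + 1) • (η - ξ₀)) :=
      ⟨compSubConstCLM ℂ ξ₀ (compCLMOfContinuousLinearEquiv ℂ
        (ContinuousLinearEquiv.smulLeft (Units.mk0 ((n : ℝ) + 1) hs.ne')) ω),
        fun η => by simp [Units.smul_def]⟩
    have h1 := A.le_opENorm ((𝓕⁻ g).toLp p)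
    have hR : eLpNorm ((𝓕⁻ g).toLp p) p = eLpNorm (ift (g : Eucl d → ℂ)) p := by
      rw [← coe_fourierInv_eq_ift]
      exact eLpNorm_congr_ae ((𝓕⁻ g).coeFn_toLp p volume)
    have hL : eLpNorm (A ((𝓕⁻ g).toLp p)) p = eLpNorm (ift fun η => a η * g η) p := by
      rw [eLpNorm_congr_ae (hA (𝓕⁻ g)), FourierTransform.fourier_fourierInv_eq]
    rw [Lp.enorm_def, Lp.enorm_def, hL, hR] at h1
    have h4 := hκ (v n) (fun η => a η * g η) fun η => by
      rw [hv, hg, inv_smul_smul₀ hs.ne', add_sub_cancel]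
    have h5 := hκ ω g hg
    rw [h4, h5, hωw, mul_left_comm] at h1
    exact (ENNReal.mul_le_mul_iff_right hκ0 hκ1).1 h1
  have hlim (x : Eucl d) : Tendsto (fun n => ift (v n) x) atTop (𝓝 (a ξ₀ * w x)) := by
    rw [← hωw, ← fourierInv_const_mul]
    refine tendsto_fourierInv_of_dominated hvm (ω.integrable.norm.const_mul C) hvb
      (ae_of_all _ fun ζ => ?_) x
    simp only [hv]
    refine Tendsto.mul_const _ (hc.tendsto.comp ?_)
    have h4 : Tendsto (fun n : ℕ => ((n : ℝ) + 1)⁻¹) atTop (𝓝 0) := by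
      simpa using tendsto_one_div_add_atTop_nhds_zero_nat (𝕜 := ℝ)
    simpa using (h4.smul_const ζ).const_add ξ₀
  -- Pointwise convergence suffices: Fatou bounds the norm of the limit a(ξ₀) w by the uniform bound
  -- `hle`.
  have hfatou := Lp.eLpNorm_lim_le_liminf_eLpNorm (p := p) (μ := (volume : Measure (Eucl d)))
    (f := fun n => ift (v n)) (fun n => (continuous_fourierInv (hvi n)).aestronglyMeasurable)
    (a ξ₀ • (w : Eucl d → ℂ)) (ae_of_all _ hlim)
  rw [eLpNorm_const_smul] at hfatou
  have hfin := hfatou.trans (liminf_le_of_le (by isBoundedDefault) fun b hb =>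
    (hb.exists.choose_spec).trans (hle _))
  have hw0 : eLpNorm w p ≠ 0 := by
    rw [Ne, eLpNorm_eq_zero_iff w.continuous.aestronglyMeasurable
      (zero_lt_one.trans_le hp1.out).ne']
    intro h0
    have := (w.continuous.ae_eq_iff_eq volume continuous_const).1 h0
    exact hw (SchwartzMap.ext fun x => congrFun this x)
  exact enorm_le_iff_norm_le.1
    ((ENNReal.mul_le_mul_iff_left hw0 (w.memLp p volume).2.ne).1 hfin)

end

/-! ### Smoothness of powers of the symbol divided by the resolvent denominator -/

section

theorem hasDerivAt_max_zero_rpow {a : ℝ} (ha : 1 < a) (t : ℝ) :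
    HasDerivAt (fun t : ℝ => (max t 0) ^ a) (a * (max t 0) ^ (a - 1)) t := by
  have h0 : (0 : ℝ) ^ a = 0 := Real.zero_rpow (by linarith)
  have h1 : (0 : ℝ) ^ (a - 1) = 0 := Real.zero_rpow (by linarith)
  rcases lt_trichotomy t 0 with ht | rfl | ht
  · rw [max_eq_right ht.le, h1, mul_zero]
    refine (hasDerivAt_const t (0 : ℝ)).congr_of_eventuallyEq ?_
    filter_upwards [Iio_mem_nhds ht] with s hs
    rw [max_eq_right (le_of_lt hs), h0]
  · have hl : HasDerivWithinAt (fun t : ℝ => (max t 0) ^ a) (a * (max 0 0) ^ (a - 1))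
        (Set.Iic 0) 0 := by
      rw [max_self, h1, mul_zero]
      refine (hasDerivWithinAt_const 0 _ (0 : ℝ)).congr (fun s hs => ?_) ?_
      · rw [max_eq_right hs, h0]
      · rw [max_self, h0]
    have hr : HasDerivWithinAt (fun t : ℝ => (max t 0) ^ a) (a * (max 0 0) ^ (a - 1))
        (Set.Ici 0) 0 := by
      rw [max_self]
      refine (Real.hasDerivAt_rpow_const (Or.inr ha.le)).hasDerivWithinAt.congr
        (fun s hs => ?_) ?_
      · rw [max_eq_left hs]
      · rw [max_self]
    simpa using hl.union hr
  · rw [max_eq_left ht.le]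
    refine (Real.hasDerivAt_rpow_const (Or.inl ht.ne')).congr_of_eventuallyEq ?_
    filter_upwards [Ioi_mem_nhds ht] with s hs
    rw [max_eq_left (le_of_lt hs)]

/-- `t₊^a / (z - t₊^δ)^j`. -/
noncomputable def powResolvent (z : ℂ) (δ a : ℝ) (j : ℕ) (t : ℝ) : ℂ :=
  (((max t 0) ^ a : ℝ) : ℂ) * ((z - (((max t 0) ^ δ : ℝ) : ℂ)) ^ j)⁻¹

variable {z : ℂ} {δ : ℝ}

theorem continuous_max_zero_rpow {a : ℝ} (ha : 0 < a) :
    Continuous fun t : ℝ => (((max t 0) ^ a : ℝ) : ℂ) :=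
  Complex.continuous_ofReal.comp
    ((continuous_id.max continuous_const).rpow_const fun _ => Or.inr ha.le)

theorem continuousAt_resolvent_factor (hδ : 0 < δ) (j : ℕ) {t : ℝ}
    (ht : z - (((max t 0) ^ δ : ℝ) : ℂ) ≠ 0) :
    ContinuousAt (fun t : ℝ => ((z - (((max t 0) ^ δ : ℝ) : ℂ)) ^ j)⁻¹) t :=
  (((continuous_const.sub (continuous_max_zero_rpow hδ)).pow j).continuousAt).inv₀
    (pow_ne_zero _ ht)

/-- The family `powResolvent` is closed under differentiation: each derivative lowers the exponent
of t₊ by at most one, since δ > 0, and raises j by at most one. -/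
theorem hasDerivAt_powResolvent (hδ : 0 < δ) {a : ℝ} (ha : 1 < a) (j : ℕ) {t : ℝ}
    (ht : z - (((max t 0) ^ δ : ℝ) : ℂ) ≠ 0) :
    HasDerivAt (powResolvent z δ a j)
      (a * powResolvent z δ (a - 1) j t + j * δ * powResolvent z δ (a + δ - 1) (j + 1) t) t := by
  have h1 : (0 : ℝ) ^ (a - 1) = 0 := Real.zero_rpow (by linarith)
  have h2 : (0 : ℝ) ^ (a + δ - 1) = 0 := Real.zero_rpow (by linarith)
  have h0 : (0 : ℝ) ^ a = 0 := Real.zero_rpow (by linarith)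
  rcases lt_or_ge 0 t with hpos | hneg
  · have hA := (hasDerivAt_max_zero_rpow ha t).ofReal_comp
    have hB : HasDerivAt (fun t : ℝ => (((max t 0) ^ δ : ℝ) : ℂ))
        ((δ * t ^ (δ - 1) : ℝ) : ℂ) t := by
      refine HasDerivAt.ofReal_comp ?_
      refine (Real.hasDerivAt_rpow_const (Or.inl hpos.ne')).congr_of_eventuallyEq ?_
      filter_upwards [Ioi_mem_nhds hpos] with s hs
      rw [max_eq_left (le_of_lt hs)]
    have hC := hA.mul (((hB.const_sub z).pow j).inv (pow_ne_zero j ht))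
    refine hC.congr_deriv ?_
    have e1 : t ^ (a + δ - 1) = t ^ a * t ^ (δ - 1) := by
      rw [← Real.rpow_add hpos]; congr 1; ring
    simp only [powResolvent, max_eq_left hpos.le, e1, Pi.inv_apply, Pi.pow_apply] at ht ⊢
    set D := z - ((t ^ δ : ℝ) : ℂ)
    -- The derivative of D^j carries the truncated exponent j - 1, so j = 0 is separate.
    rcases j with _ | j
    · simp
    · push_cast
      field_simp
      ring
  · have hv : (a * powResolvent z δ (a - 1) j t +
        j * δ * powResolvent z δ (a + δ - 1) (j + 1) t) = 0 := by
      simp [powResolvent, max_eq_right hneg, h1, h2]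
    -- For t ≤ 0 the function vanishes at t, so its slope is the slope of t₊^a, which tends to 0,
    -- times a factor continuous at t.
    rw [hv, hasDerivAt_iff_tendsto_slope]
    have hs := ((hasDerivAt_max_zero_rpow ha t).ofReal_comp).tendsto_slope
    rw [max_eq_right hneg, h1, mul_zero, Complex.ofReal_zero] at hs
    have hs' := hs.mul ((continuousAt_resolvent_factor hδ j ht).tendsto.mono_left
      (nhdsWithin_le_nhds (s := {t}ᶜ)))
    rw [zero_mul] at hs'
    refine hs'.congr fun s => ?_
    simp only [slope_def_module, powResolvent, max_eq_right hneg, h0, Complex.ofReal_zero, zero_mul,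
      sub_zero, smul_mul_assoc]

/-- Each derivative uses up one unit of the exponent, so the induction on N runs over all a and j at
once. -/
theorem contDiffOn_powResolvent (hδ : 0 < δ) (N : ℕ) : ∀ {a : ℝ} (_ : N < a) (j : ℕ),
    ContDiffOn ℝ N (powResolvent z δ a j) {t | z - (((max t 0) ^ δ : ℝ) : ℂ) ≠ 0} := by
  have hU : IsOpen {t : ℝ | z - (((max t 0) ^ δ : ℝ) : ℂ) ≠ 0} :=
    isOpen_ne_fun (continuous_const.sub (continuous_max_zero_rpow hδ)) continuous_const
  induction N with
  | zero =>
    intro a ha j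
    rw [Nat.cast_zero] at ha ⊢
    exact contDiffOn_zero.2 fun t ht => ((continuous_max_zero_rpow ha).continuousAt.mul
      (continuousAt_resolvent_factor hδ j ht)).continuousWithinAt
  | succ N ih =>
    intro a ha j
    push_cast at ha ⊢
    have hN : (0 : ℝ) ≤ N := N.cast_nonneg
    rw [contDiffOn_succ_iff_deriv_of_isOpen hU]
    refine ⟨fun t ht => (hasDerivAt_powResolvent hδ (by linarith) j ht).differentiableAt.differentiableWithinAt,
      fun h => by simp at h, ?_⟩
    refine ContDiffOn.congr (f := fun t => a * powResolvent z δ (a - 1) j t +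
      j * δ * powResolvent z δ (a + δ - 1) (j + 1) t) ?_
      fun t ht => (hasDerivAt_powResolvent hδ (by linarith) j ht).deriv
    exact (contDiffOn_const.mul (ih (by linarith) _)).add
      (contDiffOn_const.mul (ih (by linarith) _))

end

/-! ### Integrability of the kernel of a sufficiently smooth symbol. -/

section

variable {d : ℕ}

/-- N derivatives with compact support make the transform bounded and O(|x|^(-N)); `integrablePower`
is an N for which such decay is integrable. -/
theorem integrable_ift_of_contDiff {a : Eucl d → ℂ}
    (ha : ContDiff ℝ (volume : Measure (Eucl d)).integrablePower a) (hc : HasCompactSupport a) :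
    Integrable (ift a) := by
  set N := (volume : Measure (Eucl d)).integrablePower
  have hint (k n : ℕ) (hk : (k : ℕ∞) ≤ (0 : ℕ)) (hn : (n : ℕ∞) ≤ N) :
      Integrable fun v => ‖v‖ ^ k * ‖iteratedFDeriv ℝ n a v‖ := by
    have hcont : Continuous (iteratedFDeriv ℝ n a) :=
      ha.continuous_iteratedFDeriv (by exact_mod_cast hn)
    refine Continuous.integrable_of_hasCompactSupport (by fun_prop) ?_
    exact ((hc.iteratedFDeriv n).norm).mul_left
  have hai : Integrable a := ha.continuous.integrable_of_hasCompactSupport hc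
  have hF : Integrable (𝓕 a) := by
    have key : Integrable (fun x => ‖x‖ ^ 0 * ‖𝓕 a x‖) := by
      refine integrable_of_le_of_pow_mul_le (k := 0) (C₁ := ∫ v, ‖a v‖) (fun x => ?_)
        (C₂ := (2 * Real.pi) ^ 0 * (2 * (0 : ℕ) + 2) ^ N *
          ∑ p ∈ Finset.range (0 + 1) ×ˢ Finset.range (N + 1),
            ∫ v, ‖v‖ ^ p.1 * ‖iteratedFDeriv ℝ p.2 a v‖) (fun x => ?_) ?_
      · exact VectorFourier.norm_fourierIntegral_le_integral_norm _ _ _ _ _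
      · have h := Real.pow_mul_norm_iteratedFDeriv_fourier_le (K := (0 : ℕ)) (N := N)
          (by exact_mod_cast ha) hint (k := 0) (n := N) le_rfl le_rfl x
        rw [norm_iteratedFDeriv_zero] at h
        rw [zero_add]
        exact_mod_cast h
      · exact (VectorFourier.fourierIntegral_continuous Real.continuous_fourierChar
          (show Continuous fun z : Eucl d × Eucl d => inner ℝ z.1 z.2 from continuous_inner)
          hai).aestronglyMeasurable
    simp only [pow_zero, one_mul] at key
    refine (integrable_norm_iff ?_).1 key
    exact (VectorFourier.fourierIntegral_continuous Real.continuous_fourierChar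
          (show Continuous fun z : Eucl d × Eucl d => inner ℝ z.1 z.2 from continuous_inner)
          hai).aestronglyMeasurable
  have : ift a = fun x => 𝓕 a (-x) := funext fun x => Real.fourierInv_eq_fourier_neg a x
  rw [this]
  exact hF.comp_neg

end

/-! ### The Bochner-Riesz symbol and the resolvent on `L^p` -/

section

variable {d : ℕ} {δ : ℝ}

/-- The Bochner-Riesz symbol in the frequency variable of Mathlib's Fourier transform. -/
noncomputable def brSymbol (d : ℕ) (δ : ℝ) (η : Eucl d) : ℂ := (symbol d δ ((2 * Real.pi) • η) : ℂ)

theorem symbol_mem_Icc (hδ : 0 ≤ δ) (ξ : Eucl d) : symbol d δ ξ ∈ Set.Icc 0 1 := by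
  have h0 : 0 ≤ symbol d δ ξ := Real.rpow_nonneg (le_max_right _ _) _
  exact ⟨h0, (Real.norm_of_nonneg h0).symm.trans_le (norm_symbol_le hδ ξ)⟩

theorem continuous_brSymbol (hδ : 0 < δ) : Continuous (brSymbol d δ) := by
  refine Complex.continuous_ofReal.comp ?_
  unfold symbol
  exact ((by fun_prop : Continuous fun η : Eucl d =>
    max (1 - ‖(2 * Real.pi) • η‖ ^ 2) 0).rpow_const fun _ => Or.inr hδ.le)

theorem brSymbol_eq_zero (hδ : 0 < δ) {η : Eucl d} (hη : 1 ≤ ‖(2 * Real.pi) • η‖) :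
    brSymbol d δ η = 0 := by
  rw [brSymbol, symbol, max_eq_right (by nlinarith), Real.zero_rpow hδ.ne', Complex.ofReal_zero]

theorem norm_brSymbol_le (hδ : 0 < δ) (η : Eucl d) : ‖brSymbol d δ η‖ ≤ 1 := by
  rw [brSymbol, Complex.norm_real]
  exact norm_symbol_le hδ.le _

theorem one_le_norm_two_pi_smul {η : Eucl d} (hη : 1 ≤ ‖η‖) : 1 ≤ ‖(2 * Real.pi) • η‖ := by
  rw [norm_two_pi_smul]
  nlinarith [Real.pi_gt_three]

theorem isSymbol_brSymbol (hδ : 0 < δ) : IsSymbol (brSymbol d δ) :=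
  ⟨(continuous_brSymbol hδ).measurable, ⟨1, norm_brSymbol_le hδ⟩, fun _ hη =>
    brSymbol_eq_zero hδ (one_le_norm_two_pi_smul hη.le)⟩

theorem IsSymbol.pow_succ {a : Eucl d → ℂ} (ha : IsSymbol a) (n : ℕ) :
    IsSymbol fun η => a η ^ (n + 1) := by
  induction n with
  | zero => simpa using ha
  | succ n ih => simpa only [_root_.pow_succ _ (n + 1)] using ih.mul ha

/-- The closed unit interval in the complex plane. -/
abbrev unitSegment : Set ℂ := (fun t : ℝ => (t : ℂ)) '' Set.Icc 0 1

theorem isClosed_unitSegment : IsClosed unitSegment :=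
  (isCompact_Icc.image Complex.continuous_ofReal).isClosed

theorem brSymbol_mem (hδ : 0 < δ) (η : Eucl d) : brSymbol d δ η ∈ unitSegment :=
  ⟨_, symbol_mem_Icc hδ.le _, rfl⟩

variable {z : ℂ}

/-- The symbol `m / (z - m)`. -/
noncomputable def resSymbol (d : ℕ) (δ : ℝ) (z : ℂ) (η : Eucl d) : ℂ :=
  brSymbol d δ η * (z - brSymbol d δ η)⁻¹

theorem sub_brSymbol_ne_zero (hδ : 0 < δ) (hz : z ∉ unitSegment) (η : Eucl d) :
    z - brSymbol d δ η ≠ 0 := fun h => hz (sub_eq_zero.1 h ▸ brSymbol_mem hδ η)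

theorem continuous_resSymbol (hδ : 0 < δ) (hz : z ∉ unitSegment) : Continuous (resSymbol d δ z) :=
  (continuous_brSymbol hδ).mul ((continuous_const.sub (continuous_brSymbol hδ)).inv₀
    (sub_brSymbol_ne_zero hδ hz))

theorem isSymbol_resSymbol (hδ : 0 < δ) (hz : z ∉ unitSegment) : IsSymbol (resSymbol d δ z) := by
  have hpos : 0 < Metric.infDist z unitSegment :=
    (isClosed_unitSegment.notMem_iff_infDist_pos ⟨0, 0, by simp⟩).1 hz
  refine (isSymbol_brSymbol hδ).mul_bounded ((continuous_const.sub (continuous_brSymbol hδ)).inv₀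
    (sub_brSymbol_ne_zero hδ hz)).measurable ⟨(Metric.infDist z unitSegment)⁻¹, fun η => ?_⟩
  rw [norm_inv]
  refine inv_anti₀ hpos ?_
  rw [← dist_eq_norm]
  exact Metric.infDist_le_dist_of_mem (brSymbol_mem hδ η)

/-- Read from right to left, this trades a factor m in front of r for multiplication by z and the
known symbol m. -/
theorem resSymbol_eq (hδ : 0 < δ) (hz : z ∉ unitSegment) (η : Eucl d) :
    z * resSymbol d δ z η = brSymbol d δ η + brSymbol d δ η * resSymbol d δ z η := by
  have := sub_brSymbol_ne_zero hδ hz η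
  rw [resSymbol]
  field_simp
  ring

theorem contDiff_one_sub_norm_sq (N : ℕ) :
    ContDiff ℝ N fun η : Eucl d => 1 - ‖(2 * Real.pi) • η‖ ^ 2 := by
  have h : ContDiff ℝ N fun η : Eucl d => (2 * Real.pi) • η := contDiff_id.const_smul _
  exact contDiff_const.sub (h.norm_sq ℝ)

/-- The factors m merge into (1 - |ξ|²)₊ to the power δ(n+2) over a denominator that never vanishes,
so smoothness at the sphere grows with n. -/
theorem contDiff_pow_mul_resSymbol (hδ : 0 < δ) (hz : z ∉ unitSegment) {N n : ℕ}
    (hnN : (N : ℝ) < δ * (n + 2 : ℕ)) :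
    ContDiff ℝ N fun η : Eucl d => brSymbol d δ η ^ (n + 1) * resSymbol d δ z η := by
  have h1 : (fun η : Eucl d => brSymbol d δ η ^ (n + 1) * resSymbol d δ z η) =
      fun η => powResolvent z δ (δ * (n + 2 : ℕ)) 1 (1 - ‖(2 * Real.pi) • η‖ ^ 2) := by
    ext η
    rw [powResolvent, Real.rpow_mul (le_max_right _ _), Real.rpow_natCast, resSymbol, brSymbol,
      symbol, pow_one, ← mul_assoc, ← _root_.pow_succ, Complex.ofReal_pow]
  rw [h1]
  exact (contDiffOn_powResolvent hδ N hnN 1).comp_contDiff (contDiff_one_sub_norm_sq N) fun η =>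
    sub_brSymbol_ne_zero hδ hz η

theorem hasCompactSupport_pow_mul_resSymbol (hδ : 0 < δ) (n : ℕ) :
    HasCompactSupport fun η : Eucl d => brSymbol d δ η ^ (n + 1) * resSymbol d δ z η := by
  refine HasCompactSupport.of_support_subset_isCompact (isCompact_closedBall 0 1) fun η hη => ?_
  rw [mem_closedBall_zero_iff]
  by_contra! hlt
  refine hη ?_
  simp only [brSymbol_eq_zero hδ (one_le_norm_two_pi_smul hlt.le)]
  rw [_root_.pow_succ, mul_zero, zero_mul]

theorem integrable_ift_pow_mul_resSymbol (hδ : 0 < δ) (hz : z ∉ unitSegment) :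
    ∃ n : ℕ, Integrable (ift fun η => brSymbol d δ η ^ (n + 1) * resSymbol d δ z η) := by
  set N := (volume : Measure (Eucl d)).integrablePower
  obtain ⟨n, hn⟩ := exists_nat_gt (N / δ)
  have hnN : (N : ℝ) < δ * (n + 2 : ℕ) := by
    rw [div_lt_iff₀ hδ] at hn
    push_cast
    nlinarith
  exact ⟨n, integrable_ift_of_contDiff (contDiff_pow_mul_resSymbol hδ hz hnN)
    (hasCompactSupport_pow_mul_resSymbol hδ n)⟩

variable {p : ℝ≥0∞} [hp1 : Fact (1 ≤ p)]
  {A : Lp ℂ p (volume : Measure (Eucl d)) →L[ℂ] Lp ℂ p (volume : Measure (Eucl d))}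

theorem IsMult.pow_succ (hp : p ≠ ∞) {a : Eucl d → ℂ} (ha : IsSymbol a) (hA : IsMult A a) (n : ℕ) :
    IsMult (A ^ (n + 1)) fun η => a η ^ (n + 1) := by
  induction n with
  | zero => simpa using hA
  | succ n ih =>
    rw [_root_.pow_succ]
    simpa only [_root_.pow_succ _ (n + 1)] using ih.comp hp (ha.pow_succ n) ha hA

theorem exists_isMult_resSymbol (hp : p ≠ ∞) (hδ : 0 < δ) (hA : IsMult A (brSymbol d δ))
    (hz : z ∉ unitSegment) :
    ∃ Q : Lp ℂ p (volume : Measure (Eucl d)) →L[ℂ] Lp ℂ p (volume : Measure (Eucl d)),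
      IsMult Q (resSymbol d δ z) := by
  have hz0 : z ≠ 0 := fun h => hz ⟨0, by simp, by simp [h]⟩
  have hm := isSymbol_brSymbol (d := d) hδ
  have hr := isSymbol_resSymbol (d := d) hδ hz
  -- `resSymbol_eq` multiplied by b: a multiplier for b·m·r yields one for b·r.
  have key (b : Eucl d → ℂ) (hb : IsSymbol b) (B : _) (hB : IsMult B fun η => b η * brSymbol d δ η)
      (C : Lp ℂ p (volume : Measure (Eucl d)) →L[ℂ] Lp ℂ p (volume : Measure (Eucl d)))
      (hC : IsMult C fun η => b η * brSymbol d δ η * resSymbol d δ z η) :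
      IsMult (z⁻¹ • (B + C)) fun η => b η * resSymbol d δ z η := by
    have h := ((IsMult.add (hb.mul hm) ((hb.mul hm).mul hr) hB hC).smul z⁻¹)
    have e (η : Eucl d) : z⁻¹ * (b η * brSymbol d δ η +
        b η * brSymbol d δ η * resSymbol d δ z η) = b η * resSymbol d δ z η := by
      rw [mul_assoc, ← mul_add, ← resSymbol_eq hδ hz]
      field_simp
    simpa only [e] using h
  -- Descent from m^(n+1) r to m r, one factor of m at a time.
  have step (n : ℕ) : (∃ C : Lp ℂ p (volume : Measure (Eucl d)) →L[ℂ]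
      Lp ℂ p (volume : Measure (Eucl d)),
      IsMult C fun η => brSymbol d δ η ^ (n + 1) * resSymbol d δ z η) →
      ∃ Q : Lp ℂ p (volume : Measure (Eucl d)) →L[ℂ] Lp ℂ p (volume : Measure (Eucl d)),
      IsMult Q fun η => brSymbol d δ η * resSymbol d δ z η := by
    induction n with
    | zero => simp
    | succ n ih =>
      rintro ⟨C, hC⟩
      have hB := hA.pow_succ hp hm (n + 1)
      simp only [_root_.pow_succ _ (n + 1)] at hB hC
      exact ih ⟨_, key _ (hm.pow_succ n) _ hB C hC⟩
  obtain ⟨n, hn⟩ := integrable_ift_pow_mul_resSymbol (d := d) hδ hz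
  obtain ⟨C, hC⟩ := step n (((hm.pow_succ n).mul hr).exists_isMult_of_integrable hp hn)
  -- The last factor is removed separately, because `key` would need b = 1, which is not supported
  -- in the unit ball.
  have h := ((IsMult.add hm (hm.mul hr) hA hC).smul z⁻¹)
  have e (η : Eucl d) : z⁻¹ * (brSymbol d δ η + brSymbol d δ η * resSymbol d δ z η) =
      resSymbol d δ z η := by
    rw [← resSymbol_eq hδ hz]
    field_simp
  simp only [e] at h
  exact ⟨_, h⟩

theorem smul_eq_add_mul (hp : p ≠ ∞) (hδ : 0 < δ) (hA : IsMult A (brSymbol d δ))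
    (hz : z ∉ unitSegment)
    {Q : Lp ℂ p (volume : Measure (Eucl d)) →L[ℂ] Lp ℂ p (volume : Measure (Eucl d))}
    (hQ : IsMult Q (resSymbol d δ z)) : z • Q = A + A * Q ∧ A * Q = Q * A := by
  have hm := isSymbol_brSymbol (d := d) hδ
  have hr := isSymbol_resSymbol (d := d) hδ hz
  have h1 := hQ.smul z
  have h2 := IsMult.add hm (hm.mul hr) hA (hA.comp hp hm hr hQ)
  have h3 := hQ.comp hp hr hm hA
  have h4 := hA.comp hp hm hr hQ
  simp only [resSymbol_eq hδ hz] at h1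
  simp only [mul_comm (resSymbol d δ z _)] at h3
  exact ⟨h1.unique hp h2, h4.unique hp h3⟩

end

/-! ### Resolvent identities in a normed algebra. -/

section

variable {R : Type*} [NormedRing R] [NormedAlgebra ℂ R]

theorem algebraMap_sub_mul_one_add {A Q : R} {z : ℂ} (h : z • Q = A + A * Q) :
    (algebraMap ℂ R z - A) * (1 + Q) = algebraMap ℂ R z := by
  rw [sub_mul, mul_add, mul_add, mul_one, mul_one, ← Algebra.smul_def, h]
  abel

/-- The hypothesis says (z - A)(1 + Q) = z, and Q commutes with A, so z⁻¹(1 + Q) is a two-sided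
inverse. -/
theorem notMem_spectrum_of_smul_eq {A Q : R} {z : ℂ} (hz : z ≠ 0) (h : z • Q = A + A * Q)
    (h' : A * Q = Q * A) : z ∉ spectrum ℂ A := by
  have h1 := algebraMap_sub_mul_one_add h
  have hc : Commute (algebraMap ℂ R z - A) (1 + Q) :=
    (Commute.one_right _).add_right (((show Commute (algebraMap ℂ R z) Q from Algebra.commutes z Q).sub_left h'))
  have h2 : (1 + Q) * (algebraMap ℂ R z - A) = algebraMap ℂ R z := hc.eq ▸ h1
  have hzz : z⁻¹ • algebraMap ℂ R z = 1 := by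
    rw [Algebra.algebraMap_eq_smul_one, inv_smul_smul₀ hz]
  exact spectrum.notMem_iff.2 ⟨⟨algebraMap ℂ R z - A, z⁻¹ • (1 + Q),
    by rw [mul_smul_comm, h1, hzz], by rw [smul_mul_assoc, h2, hzz]⟩, rfl⟩

/-- The resolvent stays bounded near a point where it exists. -/
theorem norm_le_of_resolvent {A S Q : R} {z₀ ε : ℂ} (hS : S * (algebraMap ℂ R z₀ - A) = 1)
    (hε : ‖ε‖ * ‖S‖ ≤ 1 / 2) (h : (z₀ + ε) • Q = A + A * Q) :
    ‖Q‖ ≤ 2 * (‖z₀ + ε‖ * ‖S‖) + ‖(1 : R)‖ := by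
  have h1 := algebraMap_sub_mul_one_add h
  -- Multiplying (z₀ + ε - A)(1 + Q) = z₀ + ε by S on the left. The term containing ε is then
  -- absorbed, since ‖ε‖‖S‖ ≤ 1/2.
  have h2 : 1 + Q = (z₀ + ε) • S - ε • (S * (1 + Q)) := by
    have h3 : S * ((algebraMap ℂ R z₀ - A + algebraMap ℂ R ε) * (1 + Q)) =
        S * algebraMap ℂ R (z₀ + ε) := by
      rw [← h1, map_add]
      congr 2
      abel
    rw [add_mul, mul_add, ← mul_assoc, hS, one_mul, ← Algebra.smul_def, mul_smul_comm,
      ← Algebra.commutes, ← Algebra.smul_def] at h3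
    rw [← h3]
    abel
  have h4 : ‖1 + Q‖ ≤ ‖z₀ + ε‖ * ‖S‖ + ‖ε‖ * ‖S‖ * ‖1 + Q‖ := by
    calc ‖1 + Q‖ = ‖(z₀ + ε) • S - ε • (S * (1 + Q))‖ := by rw [← h2]
      _ ≤ ‖(z₀ + ε) • S‖ + ‖ε • (S * (1 + Q))‖ := norm_sub_le _ _
      _ ≤ _ := by
        rw [norm_smul, norm_smul, mul_assoc]
        gcongr
        exact norm_mul_le _ _
  have h5 : ‖Q‖ ≤ ‖1 + Q‖ + ‖(1 : R)‖ := by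
    have := norm_sub_le (1 + Q) 1
    rwa [add_sub_cancel_left] at this
  nlinarith [norm_nonneg (1 + Q)]

end

/-! ### The spectrum of the Bochner-Riesz operator on L^p. -/

section

variable {d : ℕ} {δ : ℝ} {p : ℝ≥0∞} [hp1 : Fact (1 ≤ p)]
  {A : Lp ℂ p (volume : Measure (Eucl d)) →L[ℂ] Lp ℂ p (volume : Measure (Eucl d))}

theorem notMem_spectrum_of_isMult (hp : p ≠ ∞) (hδ : 0 < δ) (hA : IsMult A (brSymbol d δ)) {z : ℂ}
    (hz : z ∉ unitSegment) : z ∉ spectrum ℂ A := by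
  have hz0 : z ≠ 0 := fun h => hz ⟨0, by simp, by simp [h]⟩
  obtain ⟨Q, hQ⟩ := exists_isMult_resSymbol hp hδ hA hz
  obtain ⟨h1, h2⟩ := smul_eq_add_mul hp hδ hA hz hQ
  exact notMem_spectrum_of_smul_eq hz0 h1 h2

/-- An inverse S at z₀ is not known to be a multiplier, so it cannot be compared with a symbol
directly. The multipliers Q at nearby points can: S keeps them bounded, while their symbols at ξ₀
equal z₀/ε. -/
theorem brSymbol_mem_spectrum (hp : p ≠ ∞) (hδ : 0 < δ) (hA : IsMult A (brSymbol d δ))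
    {w : 𝓢(Eucl d, ℂ)} (hw : w ≠ 0) {ξ₀ : Eucl d} (hξ : brSymbol d δ ξ₀ ≠ 0) :
    brSymbol d δ ξ₀ ∈ spectrum ℂ A := by
  by_contra hcon
  obtain ⟨S, hS⟩ := (spectrum.notMem_iff.1 hcon).exists_left_inv
  set z₀ := brSymbol d δ ξ₀ with hz₀
  have hreal : z₀.im = 0 := Complex.ofReal_im _
  have hbound (n : ℕ) (hn : ((n : ℝ) + 1)⁻¹ * ‖S‖ ≤ 1 / 2) :
      ‖z₀‖ * (n + 1) ≤ 2 * (2 * ‖S‖) + ‖(1 : Lp ℂ p (volume : Measure (Eucl d)) →L[ℂ]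
        Lp ℂ p (volume : Measure (Eucl d)))‖ := by
    have hn0 : (0 : ℝ) < n + 1 := by positivity
    -- A purely imaginary perturbation of the real number z₀ leaves the segment, so the multiplier Q
    -- exists.
    set ε : ℂ := (((n : ℝ) + 1)⁻¹ : ℝ) * Complex.I with hε
    have hεn : ‖ε‖ = ((n : ℝ) + 1)⁻¹ := by
      rw [hε, norm_mul, Complex.norm_I, mul_one, Complex.norm_real,
        Real.norm_of_nonneg (by positivity)]
    have hz : z₀ + ε ∉ unitSegment := by
      rintro ⟨t, -, ht⟩
      have := congrArg Complex.im ht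
      rw [Complex.ofReal_im, Complex.add_im, hreal, hε, Complex.im_ofReal_mul, Complex.I_im] at this
      linarith [inv_pos.2 hn0]
    obtain ⟨Q, hQ⟩ := exists_isMult_resSymbol hp hδ hA hz
    have h1 := norm_le_of_resolvent hS (by rwa [hεn]) (smul_eq_add_mul hp hδ hA hz hQ).1
    have h2 := hQ.norm_symbol_le hp (isSymbol_resSymbol hδ hz)
      (continuous_resSymbol hδ hz).continuousAt (ξ₀ := ξ₀) hw
    rw [resSymbol, ← hz₀, add_sub_cancel_left, norm_mul, norm_inv, hεn, inv_inv] at h2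
    have h3 : ‖z₀ + ε‖ ≤ 2 := by
      refine (norm_add_le _ _).trans ?_
      rw [hεn]
      have : ((n : ℝ) + 1)⁻¹ ≤ 1 := inv_le_one_of_one_le₀ (by linarith [n.cast_nonneg (α := ℝ)])
      linarith [norm_brSymbol_le hδ ξ₀]
    refine h2.trans (h1.trans ?_)
    gcongr
  have hpos : 0 < ‖z₀‖ := norm_pos_iff.2 hξ
  -- The first entry of the maximum makes ε small enough for `hbound`, the second contradicts its
  -- conclusion.
  obtain ⟨n, hn⟩ := exists_nat_gt (max (2 * ‖S‖) ((2 * (2 * ‖S‖) +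
    ‖(1 : Lp ℂ p (volume : Measure (Eucl d)) →L[ℂ] Lp ℂ p (volume : Measure (Eucl d)))‖) / ‖z₀‖))
  rw [max_lt_iff, div_lt_iff₀ hpos] at hn
  have h := hbound n (by
    rw [inv_mul_le_iff₀ (by positivity)]
    linarith)
  nlinarith

end

/-! ### Tempered distributions and their convolutions with Schwartz functions -/

section

variable {d : ℕ}

/-- The value f(u) is the convolution of f with the reflection of u, taken at 0. -/
theorem distr_ext_conv {f g : 𝓢'(Eucl d, ℂ)} (h : ∀ K x, conv K f x = conv K g x) : f = g := by
  ext u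
  have h1 : reflectTranslate (reflectTranslate u 0) 0 = u := by
    ext y
    rw [reflectTranslate_apply, reflectTranslate_apply, zero_sub, zero_sub, neg_neg]
  have h2 := h (reflectTranslate u 0) 0
  rwa [conv, conv, h1] at h2

theorem fourierInv_reflectTranslate (K : 𝓢(Eucl d, ℂ)) (x η : Eucl d) :
    𝓕⁻ (reflectTranslate K x) η =
      Complex.exp (↑(2 * Real.pi * inner ℝ η x) * Complex.I) * 𝓕 K η := by
  rw [coe_fourierInv_eq_ift, ift_eq, SchwartzMap.fourier_coe, Real.fourier_eq',
    ← integral_const_mul, ← integral_sub_left_eq_self _ volume x]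
  congr 1
  ext y
  rw [reflectTranslate_apply, sub_sub_cancel, smul_eq_mul, smul_eq_mul, ← mul_assoc,
    ← Complex.exp_add, inner_sub_left, real_inner_comm η x]
  congr 2
  push_cast
  ring

theorem conv_mean {δ : ℝ} (hδ : 0 < δ) (K f : 𝓢(Eucl d, ℂ)) (x : Eucl d) :
    conv K (mean δ hδ f) x = ift (fun η => 𝓕 K η * (brSymbol d δ η * 𝓕 f η)) x := by
  rw [conv, mean, ift_eq]
  change Lp.toTemperedDistribution ((memLp_symbol_mul_fourier hδ.le f).toLp _)
    (𝓕⁻ (reflectTranslate K x)) = _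
  rw [Lp.toTemperedDistribution_apply]
  refine integral_congr_ae ?_
  filter_upwards [(memLp_symbol_mul_fourier hδ.le f).coeFn_toLp] with η hη
  rw [hη, fourierInv_reflectTranslate, smul_eq_mul, smul_eq_mul, brSymbol]
  ring

theorem integral_mul_ift (K : 𝓢(Eucl d, ℂ)) {a : Eucl d → ℂ} (ha : Integrable a) (x : Eucl d) :
    ∫ y, K (x - y) * ift a y = ift (fun η => 𝓕 K η * a η) x := by
  simp only [mul_comm]
  exact (fourierInv_mul_fourier_eq ha K x).symm

theorem mean_congr {δ : ℝ} (hδ : 0 < δ) {f g : 𝓢(Eucl d, ℂ)}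
    (h : ∀ η, brSymbol d δ η * 𝓕 f η = brSymbol d δ η * 𝓕 g η) : mean δ hδ f = mean δ hδ g :=
  distr_ext_conv fun K x => by simp only [conv_mean, h]

variable (Φ : LittlewoodPaley d)

theorem fourier_φ₀_mul_brSymbol {δ : ℝ} (hδ : 0 < δ) (η : Eucl d) :
    𝓕 Φ.φ₀ η * brSymbol d δ η = brSymbol d δ η := by
  by_cases h : brSymbol d δ η = 0
  · rw [h, mul_zero]
  · have h1 : ‖(2 * Real.pi) • η‖ < 1 := by
      by_contra! h1
      exact h (brSymbol_eq_zero hδ h1)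
    rw [norm_two_pi_smul] at h1
    rw [← Φ.low_zero, Φ.fourier_low_eq_one (by simpa using h1.le), one_mul]

theorem conv_φ₀_mean {δ : ℝ} (hδ : 0 < δ) (f : 𝓢(Eucl d, ℂ)) (x : Eucl d) :
    conv Φ.φ₀ (mean δ hδ f) x = ift (fun η => brSymbol d δ η * 𝓕 f η) x := by
  simp only [conv_mean, ← mul_assoc, fourier_φ₀_mul_brSymbol Φ hδ]

theorem mean_star_φ₀ {δ : ℝ} (hδ : 0 < δ) (f : 𝓢(Eucl d, ℂ)) :
    mean δ hδ (star Φ.φ₀ f) = mean δ hδ f :=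
  mean_congr hδ fun η => by
    rw [fourier_star, ← mul_assoc, mul_comm (brSymbol d δ η), fourier_φ₀_mul_brSymbol Φ hδ]

variable {p : ℝ≥0∞} [hp1 : Fact (1 ≤ p)]

theorem conv_toTemperedDistribution_of_ae (K : 𝓢(Eucl d, ℂ))
    {G : Lp ℂ p (volume : Measure (Eucl d))} {g : Eucl d → ℂ} (hG : G =ᵐ[volume] g) (x : Eucl d) :
    conv K (Lp.toTemperedDistribution G) x = ∫ y, K (x - y) * g y := by
  rw [conv_toTemperedDistribution]
  refine integral_congr_ae ?_
  filter_upwards [hG] with y hy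
  rw [hy]

theorem coe_star_eq_convLp (hp : p ≠ ∞) (K f : 𝓢(Eucl d, ℂ)) :
    ((star K f : 𝓢(Eucl d, ℂ)) : 𝓢'(Eucl d, ℂ)) =
      Lp.toTemperedDistribution (convLp hp K (f.toLp p volume)) :=
  distr_ext_conv fun K' x => by
    rw [conv_convLp, conv_toTemperedDistribution_of_ae _ (f.coeFn_toLp p volume), ← star_apply',
      conv_coe, star_assoc]

theorem mean_eq_convLp (hp : p ≠ ∞) {δ : ℝ} (hδ : 0 < δ) (f : 𝓢(Eucl d, ℂ))
    {G : Lp ℂ p (volume : Measure (Eucl d))}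
    (hG : G =ᵐ[volume] ift fun η => brSymbol d δ η * 𝓕 f η) :
    mean δ hδ f = Lp.toTemperedDistribution (convLp hp Φ.φ₀ G) :=
  distr_ext_conv fun K x => by
    rw [conv_convLp, conv_toTemperedDistribution_of_ae _ hG,
      integral_mul_ift _ ((isSymbol_brSymbol hδ).mul_schwartz (𝓕 f)).integrable, conv_mean]
    simp only [fourier_star]
    congr 1
    ext η
    rw [mul_assoc, ← mul_assoc (𝓕 Φ.φ₀ η), fourier_φ₀_mul_brSymbol Φ hδ]

theorem eLpNorm_conv_star_le (hp : p ≠ ∞) (K K' : 𝓢(Eucl d, ℂ)) (f : 𝓢'(Eucl d, ℂ)) :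
    eLpNorm (conv (star K K') f) p ≤ eLpNorm K 1 * eLpNorm (conv K' f) p := by
  have h : conv (star K K') f = fun x => ∫ y, K y * conv K' f (x - y) := by
    ext x
    rw [← integral_conv_eq_conv_star, ← integral_sub_left_eq_self _ volume x]
    simp only [sub_sub_cancel]
  rw [h]
  exact eLpNorm_conv_le hp K.continuous.measurable (continuous_conv K' f).measurable

/-- The factor 2^(Ld) makes the L¹ norm scale invariant, so truncations are bounded on L^p uniformly
in L. -/
theorem eLpNorm_dyadic (K : 𝓢(Eucl d, ℂ)) (L : ℕ) : eLpNorm (dyadic K L) 1 = eLpNorm K 1 := by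
  have h1 : (dyadic K L : Eucl d → ℂ) = ((2 : ℂ) ^ (L * d)) • fun x => K ((2 : ℝ) ^ L • x) := by
    ext x
    rw [dyadic_apply, Pi.smul_apply, smul_eq_mul]
  have : Fact ((1 : ℝ≥0∞) ≤ 1) := ⟨le_rfl⟩
  rw [h1, eLpNorm_const_smul, eLpNorm_dilate ENNReal.one_ne_top _ (by positivity : (0 : ℝ) < 2 ^ L),
    ← mul_assoc]
  have h2 : ‖(2 : ℂ) ^ (L * d)‖ₑ = ENNReal.ofReal ((2 ^ L) ^ d) := by
    rw [← ofReal_norm, norm_pow, Complex.norm_ofNat, pow_mul]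
  rw [h2, div_one, ENNReal.toReal_one, ENNReal.rpow_one, ← ENNReal.ofReal_mul (by positivity),
    mul_inv_cancel₀ (by positivity), ENNReal.ofReal_one, one_mul]

end

/-! ### The nonzero spectra of ab and ba. -/

section

variable {V W : Type*} [SeminormedAddCommGroup V] [NormedSpace ℂ V] [SeminormedAddCommGroup W]
  [NormedSpace ℂ W]

/-- The inverse of z - ab is z⁻¹(1 + a (z - ba)⁻¹ b). -/
theorem notMem_spectrum_comp_swap {z : ℂ} (hz : z ≠ 0) (a : V →L[ℂ] W) (b : W →L[ℂ] V)
    (h : z ∉ spectrum ℂ (b.comp a)) : z ∉ spectrum ℂ (a.comp b) := by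
  obtain ⟨u, hu⟩ := spectrum.notMem_iff.1 h
  set S : V →L[ℂ] V := ↑u⁻¹ with hS
  have h1 (v : V) : z • S v - b (a (S v)) = v := by
    have := DFunLike.congr_fun (hu ▸ u.mul_inv) v
    simpa [Algebra.algebraMap_eq_smul_one] using this
  have h2 (v : V) : S (z • v - b (a v)) = v := by
    have := DFunLike.congr_fun (hu ▸ u.inv_mul) v
    simpa [Algebra.algebraMap_eq_smul_one] using this
  refine spectrum.notMem_iff.2 ⟨⟨algebraMap ℂ _ z - a.comp b,
    z⁻¹ • (1 + a.comp (S.comp b)), ?_, ?_⟩, rfl⟩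
  · ext w
    have h3 := congrArg a (h1 (b w))
    rw [map_sub, map_smul, sub_eq_iff_eq_add] at h3
    rw [Algebra.algebraMap_eq_smul_one]
    change z • z⁻¹ • (w + a (S (b w))) - a (b (z⁻¹ • (w + a (S (b w))))) = w
    rw [map_smul, map_smul, map_add, map_add, ← h3, inv_smul_smul₀ hz, smul_inv_smul₀ hz,
      add_sub_cancel_right]
  · ext w
    have h3 := h2 (b w)
    rw [Algebra.algebraMap_eq_smul_one]
    change z⁻¹ • ((z • w - a (b w)) + a (S (b (z • w - a (b w))))) = w
    rw [map_sub b, map_smul b, h3, sub_add_cancel, inv_smul_smul₀ hz]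

end

/-! ### Spaces of Littlewood-Paley type -/

section

variable {d : ℕ} {Φ : LittlewoodPaley d} {p : ℝ≥0∞}

/-- An extended norm built from the `L^p` norms of the Littlewood-Paley pieces in such a way that
high frequency tails of elements of finite norm are small. -/
structure Admissible (Φ : LittlewoodPaley d) (p : ℝ≥0∞) (N : ExtSeminorm d) (w : ℕ → ℝ≥0∞) :
    Prop where
  weight_ne_zero : ∀ l, w l ≠ 0
  weight_ne_top : ∀ l, w l ≠ ∞
  low_le : ∀ f, eLpNorm (conv Φ.φ₀ f) p ≤ N.toFun f
  piece_le : ∀ f l, w l * eLpNorm (conv (Φ.piece l) f) p ≤ N.toFun f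
  le_sum : ∀ f M, (∀ l, M ≤ l → conv (Φ.piece l) f = 0) → N.toFun f ≤
    eLpNorm (conv Φ.φ₀ f) p + ∑ l ∈ Finset.range M, w l * eLpNorm (conv (Φ.piece l) f) p
  tail : ∀ f, N.toFun f < ∞ → ∃ τ : ℕ → ℝ≥0∞, Tendsto τ atTop (𝓝 0) ∧
    (∀ L l, L ≤ l → w l * eLpNorm (conv (Φ.piece l) f) p ≤ τ L) ∧
    ∀ L g, conv Φ.φ₀ g = 0 → (∀ l, l < L → conv (Φ.piece l) g = 0) →
      (∀ l, L + 3 ≤ l → conv (Φ.piece l) g = conv (Φ.piece l) f) →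
      N.toFun g ≤ τ L + ∑ i ∈ Finset.range 3, w (L + i) * eLpNorm (conv (Φ.piece (L + i)) g) p

namespace ExtSeminorm

variable {N : ExtSeminorm d}

/-- The element of the space of finite norm given by a tempered distribution. -/
def ofFinite (f : 𝓢'(Eucl d, ℂ)) (hf : N.toFun f < ∞) : N.Space := (⟨f, hf⟩ : N.finite)

theorem distr_sub (u v : N.Space) : (u - v).distr = u.distr - v.distr := rfl

theorem distr_ext {u v : N.Space} (h : u.distr = v.distr) : u = v :=
  Subtype.ext (p := fun f => f ∈ N.finite) h

theorem norm_eq (u : N.Space) : ‖u‖ = (N.toFun u.distr).toReal := rfl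

end ExtSeminorm

namespace Admissible

variable {N : ExtSeminorm d} {w : ℕ → ℝ≥0∞} [hp1 : Fact (1 ≤ p)]

theorem eLpNorm_low_lt_top (h : Admissible Φ p N w) {f : 𝓢'(Eucl d, ℂ)} (hf : N.toFun f < ∞)
    (M : ℕ) : eLpNorm (conv (Φ.low M) f) p < ∞ := by
  induction M with
  | zero =>
    rw [Φ.low_zero]
    exact (h.low_le f).trans_lt hf
  | succ M ih =>
    have h1 : conv (Φ.low (M + 1)) f = conv (Φ.low M) f + conv (Φ.piece M) f := by
      ext x
      rw [Φ.low_succ, conv_add_left, Pi.add_apply]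
    have h2 : eLpNorm (conv (Φ.piece M) f) p < ∞ :=
      ENNReal.lt_top_of_mul_ne_top_right ((h.piece_le f M).trans_lt hf).ne (h.weight_ne_zero M)
    rw [h1]
    exact (eLpNorm_add_le (continuous_conv _ f).aestronglyMeasurable
      (continuous_conv _ f).aestronglyMeasurable hp1.out).trans_lt (ENNReal.add_lt_top.2 ⟨ih, h2⟩)

theorem memLp_low (h : Admissible Φ p N w) {f : 𝓢'(Eucl d, ℂ)} (hf : N.toFun f < ∞)
    (M : ℕ) : MemLp (conv (Φ.low M) f) p :=
  ⟨(continuous_conv _ f).aestronglyMeasurable, h.eLpNorm_low_lt_top hf M⟩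

theorem conv_eq_zero_of_eLpNorm {K : 𝓢(Eucl d, ℂ)} {f : 𝓢'(Eucl d, ℂ)}
    (h : eLpNorm (conv K f) p = 0) (x : Eucl d) : conv K f x = 0 := by
  rw [eLpNorm_eq_zero_iff (continuous_conv K f).aestronglyMeasurable
    (zero_lt_one.trans_le hp1.out).ne'] at h
  exact congrFun ((continuous_conv K f).ae_eq_iff_eq volume continuous_const |>.1 h) x

/-- `N.Space` is a priori only seminormed; this definiteness turns norm statements into equalities
of distributions. -/
theorem eq_zero (h : Admissible Φ p N w) {f : 𝓢'(Eucl d, ℂ)} (hf : N.toFun f = 0) : f = 0 := by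
  refine Φ.eq_zero_of_conv (conv_eq_zero_of_eLpNorm (p := p) ?_)
    fun l => conv_eq_zero_of_eLpNorm (p := p) ?_
  · exact le_antisymm ((h.low_le f).trans_eq hf) zero_le
  · exact (mul_eq_zero.1 (le_antisymm ((h.piece_le f l).trans_eq hf) zero_le)).resolve_left
      (h.weight_ne_zero l)

theorem norm_eq_zero (h : Admissible Φ p N w) {u : N.Space} (hu : ‖u‖ = 0) : u.distr = 0 :=
  h.eq_zero (((ENNReal.toReal_eq_zero_iff _).1 hu).resolve_right u.toFun_distr_lt_top.ne)

theorem conv_zero_left' (f : 𝓢'(Eucl d, ℂ)) : conv 0 f = 0 := funext (conv_zero_left f)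

/-- The norm of a band-limited function is controlled by its `L^p` norm. -/
theorem exists_bound (hp : p ≠ ∞) (h : Admissible Φ p N w) (M : ℕ) :
    ∃ C : ℝ≥0, ∀ G : Lp ℂ p (volume : Measure (Eucl d)),
      N.toFun (Lp.toTemperedDistribution (convLp hp (Φ.low M) G)) ≤ C * ‖G‖ₑ := by
  -- Only the pieces of index below M + 2 meet the frequencies of `low M`, so D is a finite sum of
  -- Young constants.
  set D : ℝ≥0∞ := eLpNorm (star Φ.φ₀ (Φ.low M)) 1 +
    ∑ l ∈ Finset.range (M + 2), w l * eLpNorm (star (Φ.piece l) (Φ.low M)) 1 with hD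
  have hDt : D ≠ ∞ := by
    refine ENNReal.add_ne_top.2 ⟨((star Φ.φ₀ (Φ.low M)).memLp 1 volume).2.ne,
      ENNReal.sum_ne_top.2 fun l _ => ?_⟩
    exact ENNReal.mul_ne_top (h.weight_ne_top l)
      ((star (Φ.piece l) (Φ.low M)).memLp 1 volume).2.ne
  refine ⟨D.toNNReal, fun G => ?_⟩
  have hc (K : 𝓢(Eucl d, ℂ)) : conv K (Lp.toTemperedDistribution (convLp hp (Φ.low M) G)) =
      conv (star K (Φ.low M)) (Lp.toTemperedDistribution G) :=
    funext fun x => conv_convLp hp K (Φ.low M) G x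
  have hb (K : 𝓢(Eucl d, ℂ)) :
      eLpNorm (conv K (Lp.toTemperedDistribution (convLp hp (Φ.low M) G))) p ≤
      eLpNorm (star K (Φ.low M)) 1 * ‖G‖ₑ := by
    rw [hc, Lp.enorm_def]
    exact eLpNorm_conv_Lp_le hp _ G
  rw [ENNReal.coe_toNNReal hDt, hD, add_mul, Finset.sum_mul]
  refine (h.le_sum _ (M + 2) fun l hl => ?_).trans (add_le_add (hb _) (Finset.sum_le_sum
    fun l _ => ?_))
  · rw [hc, Φ.star_piece_low_eq_zero hl, conv_zero_left']
  · rw [mul_assoc]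
    exact mul_le_mul_right (hb _) _

/-- The map from `L^p` to the space, given by convolution with a low frequency cutoff. -/
theorem exists_ofLp (hp : p ≠ ∞) (h : Admissible Φ p N w) (M : ℕ) :
    ∃ E : Lp ℂ p (volume : Measure (Eucl d)) →L[ℂ] N.Space,
      ∀ G, (E G).distr = Lp.toTemperedDistribution (convLp hp (Φ.low M) G) := by
  obtain ⟨C, hC⟩ := h.exists_bound hp M
  have hfin (G : Lp ℂ p (volume : Measure (Eucl d))) :
      N.toFun (Lp.toTemperedDistribution (convLp hp (Φ.low M) G)) < ∞ :=
    (hC G).trans_lt (ENNReal.mul_lt_top ENNReal.coe_lt_top enorm_lt_top)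
  let D := (Lp.toTemperedDistributionCLM ℂ (volume : Measure (Eucl d)) p).toLinearMap ∘ₗ
    convLp hp (Φ.low M)
  have hD (G) : D G = Lp.toTemperedDistribution (convLp hp (Φ.low M) G) := rfl
  simp only [← hD] at hC hfin ⊢
  let E : Lp ℂ p (volume : Measure (Eucl d)) →ₗ[ℂ] N.Space :=
    { toFun := fun G => ExtSeminorm.ofFinite (D G) (hfin G)
      map_add' := fun G H => ExtSeminorm.distr_ext (map_add D G H)
      map_smul' := fun c G => ExtSeminorm.distr_ext (map_smul D c G) }
  refine ⟨E.mkContinuous C fun G => ?_, fun G => rfl⟩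
  have h1 := ENNReal.toReal_mono (ENNReal.mul_ne_top ENNReal.coe_ne_top enorm_ne_top) (hC G)
  rwa [ENNReal.toReal_mul, toReal_enorm, ENNReal.coe_toReal] at h1

/-- The map from the space to `L^p`, given by convolution with `φ₀`. -/
theorem exists_toLp (h : Admissible Φ p N w) :
    ∃ J : N.Space →L[ℂ] Lp ℂ p (volume : Measure (Eucl d)),
      ∀ u, J u =ᵐ[volume] conv Φ.φ₀ u.distr := by
  have hmem (u : N.Space) : MemLp (conv Φ.φ₀ u.distr) p :=
    ⟨(continuous_conv _ _).aestronglyMeasurable, (h.low_le _).trans_lt u.toFun_distr_lt_top⟩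
  let J : N.Space →ₗ[ℂ] Lp ℂ p (volume : Measure (Eucl d)) :=
    { toFun := fun u => (hmem u).toLp _
      map_add' := fun u v => by
        rw [← MemLp.toLp_add, MemLp.toLp_eq_toLp_iff]
        exact ae_of_all _ fun x => rfl
      map_smul' := fun c u => by
        rw [RingHom.id_apply, ← MemLp.toLp_const_smul, MemLp.toLp_eq_toLp_iff]
        exact ae_of_all _ fun x => rfl }
  refine ⟨J.mkContinuous 1 fun u => ?_, fun u => (hmem u).coeFn_toLp⟩
  rw [one_mul]
  have h1 : ‖J u‖ = (eLpNorm (conv Φ.φ₀ u.distr) p).toReal := Lp.norm_toLp _ (hmem u)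
  rw [h1]
  exact ENNReal.toReal_mono u.toFun_distr_lt_top.ne (h.low_le _)

theorem conv_sub_truncation (h : Admissible Φ p N w) {f : 𝓢'(Eucl d, ℂ)} (hf : N.toFun f < ∞)
    (M : ℕ) (K : 𝓢(Eucl d, ℂ)) (x : Eucl d) :
    conv K (f - Lp.toTemperedDistribution ((h.memLp_low hf M).toLp _)) x =
      conv K f x - conv (star K (Φ.low M)) f x := by
  rw [conv_sub_right, conv_toTemperedDistribution_of_ae K (h.memLp_low hf M).coeFn_toLp,
    integral_conv_eq_conv_star]

theorem eLpNorm_conv_le_of_truncation (hp : p ≠ ∞) {f v : 𝓢'(Eucl d, ℂ)} {M : ℕ} {K : 𝓢(Eucl d, ℂ)}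
    (hv : ∀ x, conv K v x = conv K f x - conv (star K (Φ.low M)) f x) :
    eLpNorm (conv K v) p ≤ (1 + eLpNorm Φ.φ₀ 1) * eLpNorm (conv K f) p := by
  have h3 : conv K v = conv K f - conv (star (Φ.low M) K) f := by
    ext x
    rw [hv, star_comm, Pi.sub_apply]
  have h4 := eLpNorm_conv_star_le hp (Φ.low M) K f
  have h5 : eLpNorm (Φ.low M) 1 = eLpNorm Φ.φ₀ 1 := eLpNorm_dyadic Φ.φ₀ M
  rw [h5] at h4
  rw [h3, add_mul, one_mul]
  exact (eLpNorm_sub_le (continuous_conv K f).aestronglyMeasurable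
    (continuous_conv _ f).aestronglyMeasurable hp1.out).trans (add_le_add le_rfl h4)

/-- Here v is f minus its truncation by `low (L+1)`. Its pieces vanish below L and agree with those
of f from L + 3 on. Only the three pieces in between are distorted, and Young's inequality bounds
each by those of f. -/
theorem toFun_le_of_truncation (hp : p ≠ ∞) {f v : 𝓢'(Eucl d, ℂ)} {L : ℕ} {t : ℝ≥0∞}
    (hle : ∀ l, L ≤ l → w l * eLpNorm (conv (Φ.piece l) f) p ≤ t)
    (htail : conv Φ.φ₀ v = 0 → (∀ l, l < L → conv (Φ.piece l) v = 0) →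
      (∀ l, L + 3 ≤ l → conv (Φ.piece l) v = conv (Φ.piece l) f) →
      N.toFun v ≤ t + ∑ i ∈ Finset.range 3, w (L + i) * eLpNorm (conv (Φ.piece (L + i)) v) p)
    (hc : ∀ K x, conv K v x = conv K f x - conv (star K (Φ.low (L + 1))) f x) :
    N.toFun v ≤ (1 + 3 * (1 + eLpNorm Φ.φ₀ 1)) * t := by
  set B : ℝ≥0∞ := 1 + eLpNorm Φ.φ₀ 1 with hB
  have h2 (i : ℕ) : w (L + i) * eLpNorm (conv (Φ.piece (L + i)) v) p ≤ B * t := by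
    have h3 : eLpNorm (conv (Φ.piece (L + i)) v) p ≤ B * eLpNorm (conv (Φ.piece (L + i)) f) p :=
      eLpNorm_conv_le_of_truncation (M := L + 1) hp (hc (Φ.piece (L + i)))
    have h4 := mul_le_mul_right (hle (L + i) (Nat.le_add_right _ _)) B
    refine le_trans (mul_le_mul_right h3 _) (le_of_eq_of_le ?_ h4)
    exact mul_left_comm _ _ _
  refine (htail ?_ ?_ ?_).trans ?_
  · ext x
    rw [hc, star_comm, ← Φ.low_zero, Φ.star_low_low (by omega), sub_self, Pi.zero_apply]
  · intro l hl
    ext x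
    rw [hc, Φ.star_piece_low_of_le (by omega), sub_self, Pi.zero_apply]
  · intro l hl
    ext x
    rw [hc, Φ.star_piece_low_eq_zero (by omega), conv_zero_left, sub_zero]
  · rw [add_mul, one_mul, mul_assoc]
    refine add_le_add le_rfl ((Finset.sum_le_sum fun i _ => h2 i).trans_eq ?_)
    rw [Finset.sum_const, Finset.card_range, nsmul_eq_mul, Nat.cast_ofNat]

/-- Low frequency truncations converge in the space. -/
theorem tendsto_truncation (hp : p ≠ ∞) (h : Admissible Φ p N w) {f : 𝓢'(Eucl d, ℂ)}
    (hf : N.toFun f < ∞) :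
    Tendsto (fun L => N.toFun (f - Lp.toTemperedDistribution ((h.memLp_low hf (L + 1)).toLp _)))
      atTop (𝓝 0) := by
  obtain ⟨τ, hτ, hle, htail⟩ := h.tail f hf
  have hCt : 1 + 3 * (1 + eLpNorm Φ.φ₀ 1) ≠ ∞ := by
    have := (Φ.φ₀.memLp 1 volume).2.ne
    exact ENNReal.add_ne_top.2 ⟨ENNReal.one_ne_top, ENNReal.mul_ne_top (by simp)
      (ENNReal.add_ne_top.2 ⟨ENNReal.one_ne_top, this⟩)⟩
  have hC0 : Tendsto (fun L => (1 + 3 * (1 + eLpNorm Φ.φ₀ 1)) * τ L) atTop (𝓝 0) := by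
    have h1 := ENNReal.Tendsto.const_mul hτ (Or.inr hCt)
    rwa [mul_zero] at h1
  exact tendsto_of_tendsto_of_tendsto_of_le_of_le tendsto_const_nhds hC0 (fun _ => zero_le)
    fun L => toFun_le_of_truncation hp (hle L) (htail L _) (h.conv_sub_truncation hf (L + 1))

end Admissible

end

/-! ### The Bochner-Riesz operator on spaces of Littlewood-Paley type -/

section

variable {d : ℕ} {Φ : LittlewoodPaley d} {p : ℝ≥0∞} {δ : ℝ}

namespace LittlewoodPaley

theorem φ₀_ne_zero (Φ : LittlewoodPaley d) : Φ.φ₀ ≠ 0 := by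
  intro h
  have h1 := Φ.hat_φ₀_eq_one (ξ := 0) (by simp)
  rw [h] at h1
  simp [hat] at h1

theorem exists_eucl_norm_eq (hd : 1 ≤ d) {r : ℝ} (hr : 0 ≤ r) : ∃ ξ : Eucl d, ‖ξ‖ = r := by
  have : Nonempty (Fin d) := ⟨⟨0, hd⟩⟩
  exact exists_norm_eq (Eucl d) hr

/-- If ψ vanished, the transform of `φ₀` would be 1 everywhere, also at a point of norm 3, outside
its support. Such a point exists because d ≥ 1. -/
theorem piece_ne_zero (hd : 1 ≤ d) (Φ : LittlewoodPaley d) (l : ℕ) : Φ.piece l ≠ 0 := by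
  intro h
  have hψ : Φ.ψ = 0 := by
    ext x
    have h1 : Φ.piece l (((2 : ℝ) ^ (l + 1))⁻¹ • x) = 0 := by rw [h]; rfl
    rw [piece, dyadic_apply, smul_inv_smul₀ (by positivity)] at h1
    exact (mul_eq_zero.1 h1).resolve_left (pow_ne_zero _ two_ne_zero)
  obtain ⟨ξ, hξ⟩ := exists_eucl_norm_eq (d := d) hd (by norm_num : (0 : ℝ) ≤ 3)
  have h2 := Φ.partition ξ
  have h3 : (fun l : ℕ => hat Φ.ψ (((2 : ℝ) ^ (l + 1))⁻¹ • ξ)) = fun _ => 0 := by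
    ext l
    rw [hψ]
    simp [hat]
  rw [h3] at h2
  have h4 := h2.unique hasSum_zero
  have h5 := Φ.support_φ₀ ξ (by
    intro h6
    rw [h6, sub_zero] at h4
    exact one_ne_zero h4)
  rw [hξ] at h5
  norm_num at h5

theorem brSymbol_mul_fourier_piece (hδ : 0 < δ) (Φ : LittlewoodPaley d) (l : ℕ) (η : Eucl d) :
    brSymbol d δ η * 𝓕 (Φ.piece l) η = 0 := by
  by_cases h : 𝓕 (Φ.piece l) η = 0
  · rw [h, mul_zero]
  · have h1 := (Φ.bounds_of_fourier_piece_ne_zero h).1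
    rw [brSymbol_eq_zero hδ, zero_mul]
    rw [norm_two_pi_smul]
    exact (one_le_pow₀ one_le_two).trans h1

end LittlewoodPaley

theorem exists_brSymbol_eq (hd : 1 ≤ d) (hδ : 0 < δ) {t : ℝ} (ht : t ∈ Set.Icc (0 : ℝ) 1) :
    ∃ η : Eucl d, brSymbol d δ η = t := by
  have h1 : t ^ (1 / δ) ≤ 1 := Real.rpow_le_one ht.1 ht.2 (by positivity)
  have h0 : 0 ≤ t ^ (1 / δ) := Real.rpow_nonneg ht.1 _
  obtain ⟨η, hη⟩ := LittlewoodPaley.exists_eucl_norm_eq (d := d) hd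
    (by positivity : 0 ≤ √(1 - t ^ (1 / δ)) / (2 * Real.pi))
  refine ⟨η, ?_⟩
  have h2 : ‖(2 * Real.pi) • η‖ ^ 2 = 1 - t ^ (1 / δ) := by
    rw [norm_two_pi_smul, hη, mul_div_cancel₀ _ (by positivity), Real.sq_sqrt (by linarith)]
  rw [brSymbol, symbol, h2, sub_sub_cancel, max_eq_left h0, ← Real.rpow_mul ht.1,
    one_div_mul_cancel hδ.ne', Real.rpow_one]

theorem coe_schwartz_eq_zero (Φ : LittlewoodPaley d) {l : ℕ}
    (h : ((Φ.piece l : 𝓢(Eucl d, ℂ)) : 𝓢'(Eucl d, ℂ)) = 0) : Φ.piece l = 0 := by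
  rw [← Φ.star_piece_low_of_le (le_refl (l + 2)), star_comm]
  ext x
  rw [← conv_coe, h]
  rfl

namespace Admissible

variable {N : ExtSeminorm d} {w : ℕ → ℝ≥0∞} [hp1 : Fact (1 ≤ p)]

/-- A bounded Bochner-Riesz mean satisfies a multiplier bound on `L^p`. -/
theorem exists_isMult_brSymbol (hp : p ≠ ∞) (h : Admissible Φ p N w) (hδ : 0 < δ)
    (hb : IsBoundedOn δ hδ N) :
    ∃ A : Lp ℂ p (volume : Measure (Eucl d)) →L[ℂ] Lp ℂ p (volume : Measure (Eucl d)),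
      IsMult A (brSymbol d δ) := by
  obtain ⟨C, hC⟩ := hb
  obtain ⟨C', hC'⟩ := h.exists_bound hp 0
  -- C is the bound on the space, and C' bounds f ↦ φ₀ * f from L^p into the space.
  refine (isSymbol_brSymbol hδ).exists_isMult hp (C * C') fun f => ?_
  have h1 : (ift fun η => brSymbol d δ η * 𝓕 f η) = conv Φ.φ₀ (mean δ hδ (star Φ.φ₀ f)) := by
    ext x
    rw [mean_star_φ₀, conv_φ₀_mean]
  have h2 := hC' (f.toLp p volume)
  have h3 : ‖f.toLp p volume‖ₑ = eLpNorm f p := by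
    rw [Lp.enorm_def]
    exact eLpNorm_congr_ae (f.coeFn_toLp p volume)
  rw [Φ.low_zero, ← coe_star_eq_convLp, h3] at h2
  rw [h1, ENNReal.coe_mul, mul_assoc]
  exact (h.low_le _).trans ((hC _).trans (mul_le_mul_right h2 _))

/-- The difference D vanishes on low-frequency cutoffs of Schwartz functions, hence by density in
L^p on all of E(L^p), and these ranges contain the truncations of every element. -/
theorem eq_of_isMeanOn (hp : p ≠ ∞) (h : Admissible Φ p N w) (hδ : 0 < δ)
    {T T' : N.Space →L[ℂ] N.Space} (hT : IsMeanOn δ hδ N T) (hT' : IsMeanOn δ hδ N T') :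
    T' = T := by
  set D := T' - T with hD
  have hDv (u : N.Space) : D u = T' u - T u := rfl
  have hband (M : ℕ) (E : Lp ℂ p (volume : Measure (Eucl d)) →L[ℂ] N.Space)
      (hE : ∀ G, (E G).distr = Lp.toTemperedDistribution (convLp hp (Φ.low M) G))
      (G : Lp ℂ p (volume : Measure (Eucl d))) : ‖D (E G)‖ = 0 := by
    have hd : DenseRange (SchwartzMap.toLpCLM ℂ ℂ p (volume : Measure (Eucl d))) :=
      SchwartzMap.denseRange_toLpCLM (E := Eucl d) (F := ℂ) (μ := volume) hp
    refine hd.induction_on (p := fun G => ‖D (E G)‖ = 0) G ?_ fun f => ?_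
    · exact isClosed_eq (D.comp E).continuous.norm continuous_const
    · have h1 : (E (f.toLp p volume)).distr = ((star (Φ.low M) f : 𝓢(Eucl d, ℂ)) : 𝓢'(Eucl d, ℂ)) := by
        rw [hE, coe_star_eq_convLp hp]
      change ‖D (E (f.toLp p volume))‖ = 0
      have h2 : T' (E (f.toLp p volume)) = T (E (f.toLp p volume)) :=
        ExtSeminorm.distr_ext ((hT' _ _ h1).trans (hT _ _ h1).symm)
      rw [hDv, h2, sub_self, norm_zero]
  have hzero (u : N.Space) : ‖D u‖ = 0 := by
    have hu := u.toFun_distr_lt_top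
    choose E hE using h.exists_ofLp hp
    -- The cutoff of level L + 2 reproduces the truncation of level L + 1, which therefore lies in
    -- the range of E.
    let v (L : ℕ) : N.Space := E (L + 2) ((h.memLp_low hu (L + 1)).toLp _)
    have hv (L : ℕ) : (v L).distr = Lp.toTemperedDistribution ((h.memLp_low hu (L + 1)).toLp _) := by
      rw [hE]
      refine distr_ext_conv fun K x => ?_
      rw [conv_convLp, conv_toTemperedDistribution_of_ae _ (h.memLp_low hu (L + 1)).coeFn_toLp,
        conv_toTemperedDistribution_of_ae _ (h.memLp_low hu (L + 1)).coeFn_toLp,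
        integral_conv_eq_conv_star, integral_conv_eq_conv_star, star_assoc,
        Φ.star_low_low (by omega)]
    have hlim : Tendsto v atTop (𝓝 u) := by
      rw [tendsto_iff_norm_sub_tendsto_zero]
      have h1 := (ENNReal.tendsto_toReal ENNReal.zero_ne_top).comp (h.tendsto_truncation hp hu)
      rw [ENNReal.toReal_zero] at h1
      refine h1.congr fun L => ?_
      rw [norm_sub_rev, ExtSeminorm.norm_eq, ExtSeminorm.distr_sub, hv]
      rfl
    have h2 := (D.continuous.norm.tendsto u).comp hlim
    refine tendsto_nhds_unique h2 (tendsto_const_nhds.congr fun L => ?_)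
    exact (hband _ _ (hE _) _).symm
  ext u
  have h3 := h.norm_eq_zero (hzero u)
  rw [hDv, ExtSeminorm.distr_sub] at h3
  exact ExtSeminorm.distr_ext (sub_eq_zero.1 h3)

theorem zero_mem_spectrum (hd : 1 ≤ d) (hp : p ≠ ∞) (h : Admissible Φ p N w) (hδ : 0 < δ)
    {T : N.Space →L[ℂ] N.Space} (hT : IsMeanOn δ hδ N T) : (0 : ℂ) ∈ spectrum ℂ T := by
  by_contra hcon
  obtain ⟨S, hS⟩ := (spectrum.notMem_iff.1 hcon).exists_left_inv
  -- Every piece lives where |ξ| ≥ 1 and m vanishes, so the index 2 is arbitrary. `low 4` reproduces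
  -- it, which places it in the space.
  obtain ⟨E, hE⟩ := h.exists_ofLp hp 4
  set u := E ((Φ.piece 2).toLp p volume)
  have hu : u.distr = ((Φ.piece 2 : 𝓢(Eucl d, ℂ)) : 𝓢'(Eucl d, ℂ)) := by
    rw [hE, ← coe_star_eq_convLp, star_comm, Φ.star_piece_low_of_le (by norm_num)]
  have h0 : T u = 0 := by
    refine ExtSeminorm.distr_ext ((hT _ _ hu).trans ?_)
    refine distr_ext_conv fun K x => ?_
    rw [conv_mean]
    simp only [Φ.brSymbol_mul_fourier_piece hδ, mul_zero, ift_eq, smul_zero, integral_zero]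
    rfl
  have h1 : u = 0 := by
    have h2 := DFunLike.congr_fun hS u
    rw [map_zero, zero_sub] at h2
    change S (-(T u)) = u at h2
    rw [h0, neg_zero, map_zero] at h2
    exact h2.symm
  refine Φ.piece_ne_zero hd 2 (coe_schwartz_eq_zero Φ ?_)
  rw [← hu, h1]
  rfl

theorem main (hd : 1 ≤ d) (hp : p ≠ ∞) (h : Admissible Φ p N w) (hδ : 0 < δ)
    (hb : IsBoundedOn δ hδ N) :
    ∃ T : N.Space →L[ℂ] N.Space, IsMeanOn δ hδ N T ∧
      (∀ T', IsMeanOn δ hδ N T' → T' = T) ∧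
      spectrum ℂ T = (fun t : ℝ => (t : ℂ)) '' Set.Icc 0 1 := by
  obtain ⟨A, hA⟩ := h.exists_isMult_brSymbol hp hδ hb
  obtain ⟨E, hE⟩ := h.exists_ofLp hp 0
  obtain ⟨J, hJ⟩ := h.exists_toLp
  rw [Φ.low_zero] at hE
  have hJS (f : 𝓢(Eucl d, ℂ)) (u : N.Space) (hu : u.distr = (f : 𝓢'(Eucl d, ℂ))) :
      J u = (star Φ.φ₀ f).toLp p volume := by
    refine Lp.ext ((hJ u).trans ?_)
    refine EventuallyEq.trans (ae_of_all _ fun x => ?_) ((star Φ.φ₀ f).coeFn_toLp p volume).symm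
    rw [hu, conv_coe]
  have hAφ (f : 𝓢(Eucl d, ℂ)) :
      A ((star Φ.φ₀ f).toLp p volume) =ᵐ[volume] ift fun η => brSymbol d δ η * 𝓕 f η := by
    have h1 := hA (star Φ.φ₀ f)
    have h2 (η : Eucl d) : brSymbol d δ η * 𝓕 (star Φ.φ₀ f) η = brSymbol d δ η * 𝓕 f η := by
      rw [fourier_star, ← mul_assoc, mul_comm (brSymbol d δ η), fourier_φ₀_mul_brSymbol Φ hδ]
    simp only [h2] at h1
    exact h1
  set T := E.comp (A.comp J) with hTdef
  have hT : IsMeanOn δ hδ N T := fun f u hu => by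
    change (E (A (J u))).distr = _
    rw [hE, hJS f u hu]
    exact (mean_eq_convLp Φ hp hδ f (hAφ f)).symm
  -- J E convolves twice with `φ₀`, which A does not see, since the transform of `φ₀` is 1 where m ≠
  -- 0.
  have hAJE : (A.comp J).comp E = A := by
    refine Lp_clm_ext hp fun f => ?_
    change A (J (E (f.toLp p volume))) = A (f.toLp p volume)
    rw [hJS (star Φ.φ₀ f) _ (by rw [hE, coe_star_eq_convLp hp])]
    refine Lp.ext ((hAφ _).trans (EventuallyEq.trans ?_ (hA f).symm))
    refine ae_of_all _ fun x => ?_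
    congr 1
    ext η
    rw [fourier_star, ← mul_assoc, mul_comm (brSymbol d δ η), fourier_φ₀_mul_brSymbol Φ hδ]
  refine ⟨T, hT, fun T' hT' => h.eq_of_isMeanOn hp hδ hT hT', Set.Subset.antisymm ?_ ?_⟩
  · intro z hz
    by_contra hcon
    have hz0 : z ≠ 0 := fun h0 => hcon ⟨0, by simp, by simp [h0]⟩
    refine notMem_spectrum_comp_swap hz0 E (A.comp J) ?_ hz
    rw [hAJE]
    exact notMem_spectrum_of_isMult hp hδ hA hcon
  · rintro z ⟨t, ht, rfl⟩
    by_cases ht0 : t = 0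
    · simp only [ht0, Complex.ofReal_zero]
      exact h.zero_mem_spectrum hd hp hδ hT
    · have htc : (t : ℂ) ≠ 0 := Complex.ofReal_ne_zero.2 ht0
      obtain ⟨η, hη⟩ := exists_brSymbol_eq (d := d) hd hδ ht
      have h1 := brSymbol_mem_spectrum hp hδ hA Φ.φ₀_ne_zero (ξ₀ := η) (by rwa [hη])
      by_contra hcon
      have h2 := notMem_spectrum_comp_swap htc (A.comp J) E hcon
      rw [hAJE, ← hη] at h2
      exact h2 h1

end Admissible

end

/-! ### Triebel-Lizorkin and Besov norms are of Littlewood-Paley type -/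

section

variable {q : ℝ}

theorem le_seqNorm (hq : 1 ≤ q) (a : ℕ → ℝ≥0∞) (l : ℕ) : a l ≤ seqNorm q a := by
  have hq0 : 0 < q := by linarith
  have h1 : (a l ^ q) ^ (1 / q) ≤ seqNorm q a :=
    ENNReal.rpow_le_rpow (ENNReal.le_tsum l) (by positivity)
  rwa [← ENNReal.rpow_mul, mul_one_div_cancel hq0.ne', ENNReal.rpow_one] at h1

theorem seqNorm_zero (hq : 1 ≤ q) : seqNorm q (fun _ => 0) = 0 := by
  have := seqNorm_const_mul hq 0 fun _ => 0
  simpa only [zero_mul] using this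

theorem seqNorm_single (hq : 1 ≤ q) (i : ℕ) (c : ℝ≥0∞) :
    seqNorm q (fun l => if l = i then c else 0) = c := by
  have hq0 : 0 < q := by linarith
  rw [seqNorm, tsum_eq_single i fun l hl => by rw [if_neg hl, ENNReal.zero_rpow_of_pos hq0],
    if_pos rfl, ← ENNReal.rpow_mul, mul_one_div_cancel hq0.ne', ENNReal.rpow_one]

/-- The terms in s are peeled off one at a time by the triangle inequality, each having norm equal
to its own size. -/
theorem seqNorm_le_sum_add (hq : 1 ≤ q) (b : ℕ → ℝ≥0∞) (s : Finset ℕ) :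
    seqNorm q b ≤ ∑ i ∈ s, b i + seqNorm q fun l => if l ∈ s then 0 else b l := by
  induction s using Finset.induction_on with
  | empty => simp
  | insert i s hi ih =>
    refine ih.trans ?_
    rw [Finset.sum_insert hi, add_comm (b i), add_assoc]
    refine add_le_add le_rfl ?_
    have h := seqNorm_add_le hq (fun l => if l = i then b i else 0)
      (fun l => if l ∈ insert i s then 0 else b l)
    rw [seqNorm_single hq] at h
    refine le_trans (seqNorm_mono hq fun l => ?_) h
    by_cases h1 : l = i
    · subst h1
      simp [hi]
    · simp [h1]

/-- The sequence `a` with the terms before `L` replaced by zero. -/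
def tailSeq (L : ℕ) (a : ℕ → ℝ≥0∞) (l : ℕ) : ℝ≥0∞ := if L ≤ l then a l else 0

theorem le_seqNorm_tailSeq (hq : 1 ≤ q) (a : ℕ → ℝ≥0∞) {L l : ℕ} (h : L ≤ l) :
    a l ≤ seqNorm q (tailSeq L a) := by
  have := le_seqNorm hq (tailSeq L a) l
  rwa [tailSeq, if_pos h] at this

theorem tailSeq_le (L : ℕ) (a : ℕ → ℝ≥0∞) (l : ℕ) : tailSeq L a l ≤ a l := by
  rw [tailSeq]
  split_ifs
  exacts [le_rfl, zero_le]

theorem seqNorm_le_sum (hq : 1 ≤ q) {b : ℕ → ℝ≥0∞} {M : ℕ} (hb : ∀ l, M ≤ l → b l = 0) :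
    seqNorm q b ≤ ∑ l ∈ Finset.range M, b l := by
  refine (seqNorm_le_sum_add hq b (Finset.range M)).trans_eq ?_
  have h : (fun l => if l ∈ Finset.range M then 0 else b l) = fun _ => 0 := by
    ext l
    split_ifs with hl
    · rfl
    · exact hb l (by simpa using hl)
  rw [h, seqNorm_zero hq, add_zero]

theorem seqNorm_le_tailSeq_add (hq : 1 ≤ q) {a b : ℕ → ℝ≥0∞} {L : ℕ} (hb : ∀ l, l < L → b l = 0)
    (hab : ∀ l, L + 3 ≤ l → b l = a l) :
    seqNorm q b ≤ seqNorm q (tailSeq L a) + ∑ i ∈ Finset.range 3, b (L + i) := by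
  have h := seqNorm_le_sum_add hq b (Finset.Ico L (L + 3))
  rw [Finset.sum_Ico_eq_sum_range, Nat.add_sub_cancel_left, add_comm] at h
  refine h.trans (add_le_add (seqNorm_mono hq fun l => ?_) le_rfl)
  rw [tailSeq]
  simp only [Finset.mem_Ico]
  split_ifs with h1 h2 h2
  · exact zero_le
  · exact zero_le
  · exact (hab l (by omega)).le
  · exact (hb l (by omega)).le

theorem tendsto_seqNorm_tailSeq (hq : 1 ≤ q) {a : ℕ → ℝ≥0∞} (ha : seqNorm q a ≠ ∞) :
    Tendsto (fun L => seqNorm q (tailSeq L a)) atTop (𝓝 0) := by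
  have hq0 : 0 < q := by linarith
  have hsum : ∑' l, a l ^ q ≠ ∞ := fun h => ha (by
    rw [seqNorm, h, ENNReal.top_rpow_of_pos (by positivity)])
  have h1 : Tendsto (fun L => ∑' l, tailSeq L a l ^ q) atTop (𝓝 0) := by
    have h2 := ENNReal.tendsto_sum_nat_add (fun l => a l ^ q) hsum
    refine h2.congr fun L => ?_
    have h3 : (∑' l, tailSeq L a l ^ q) = ∑' l, tailSeq L a (l + L) ^ q := by
      rw [← ENNReal.summable.sum_add_tsum_nat_add' (k := L) (f := fun l => tailSeq L a l ^ q),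
        Finset.sum_eq_zero fun l hl => ?_, zero_add]
      rw [tailSeq, if_neg (by simpa using hl), ENNReal.zero_rpow_of_pos hq0]
    rw [h3]
    refine tsum_congr fun l => ?_
    rw [tailSeq, if_pos (Nat.le_add_left _ _)]
  have h4 := (ENNReal.continuous_rpow_const (y := 1 / q)).tendsto 0 |>.comp h1
  rwa [ENNReal.zero_rpow_of_pos (by positivity)] at h4

end

/-! ### Verification of the admissibility conditions for both norms. -/

section

variable {d : ℕ} {p q : ℝ}

theorem fact_one_le_ofReal (hp : 1 ≤ p) : Fact (1 ≤ ENNReal.ofReal p) :=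
  ⟨by rwa [← ENNReal.ofReal_one, ENNReal.ofReal_le_ofReal_iff (by linarith)]⟩

theorem eLpNorm_conv_eq_lebNorm (hp : 1 ≤ p) (K : 𝓢(Eucl d, ℂ)) (f : 𝓢'(Eucl d, ℂ)) :
    eLpNorm (conv K f) (ENNReal.ofReal p) = lebNorm p (absConv K f) := by
  have := fact_one_le_ofReal hp
  rw [eLpNorm_eq_lintegral_rpow ENNReal.ofReal_ne_top, ENNReal.toReal_ofReal (by linarith)]
  rfl

theorem absConv_eq_zero {K : 𝓢(Eucl d, ℂ)} {f : 𝓢'(Eucl d, ℂ)} (h : conv K f = 0) :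
    absConv K f = fun _ => 0 := by
  ext x
  rw [absConv, h, Pi.zero_apply, enorm_zero]

theorem absConv_congr {K : 𝓢(Eucl d, ℂ)} {f g : 𝓢'(Eucl d, ℂ)} (h : conv K f = conv K g) :
    absConv K f = absConv K g := by
  ext x
  rw [absConv, absConv, h]

theorem lebNorm_zero (hp : 1 ≤ p) : lebNorm p (fun _ : Eucl d => 0) = 0 := by
  have := lebNorm_const_mul (d := d) hp ENNReal.zero_ne_top fun _ => 0
  simpa only [zero_mul] using this

theorem lebNorm_sum_le (hp : 1 ≤ p) (s : Finset ℕ) {g : ℕ → Eucl d → ℝ≥0∞}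
    (hg : ∀ i, Measurable (g i)) :
    lebNorm p (fun x => ∑ i ∈ s, g i x) ≤ ∑ i ∈ s, lebNorm p (g i) := by
  induction s using Finset.induction_on with
  | empty => simp [lebNorm_zero hp]
  | insert i s hi ih =>
    simp only [Finset.sum_insert hi]
    exact (lebNorm_add_le hp (hg i) (Finset.measurable_fun_sum s fun i _ => hg i)).trans
      (add_le_add le_rfl ih)

/-- Dominated convergence for the p-th powers. Pointwise convergence is asked only where g is
finite, which is almost everywhere as its norm is finite. -/
theorem tendsto_lebNorm_zero (hp : 1 ≤ p) {G : ℕ → Eucl d → ℝ≥0∞} {g : Eucl d → ℝ≥0∞}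
    (hG : ∀ n, Measurable (G n)) (hg : Measurable g) (hle : ∀ n x, G n x ≤ g x)
    (hfin : lebNorm p g ≠ ∞) (hlim : ∀ x, g x ≠ ∞ → Tendsto (fun n => G n x) atTop (𝓝 0)) :
    Tendsto (fun n => lebNorm p (G n)) atTop (𝓝 0) := by
  have hp0 : 0 < p := by linarith
  have hint : ∫⁻ x, g x ^ p ≠ ∞ := fun h => hfin (by
    rw [lebNorm, h, ENNReal.top_rpow_of_pos (by positivity)])
  have h1 : Tendsto (fun n => ∫⁻ x, G n x ^ p) atTop (𝓝 (∫⁻ _ : Eucl d, 0)) := by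
    refine tendsto_lintegral_of_dominated_convergence (fun x => g x ^ p)
      (fun n => (hG n).pow_const p)
      (fun n => ae_of_all _ fun x => ENNReal.rpow_le_rpow (hle n x) hp0.le) hint ?_
    filter_upwards [ae_lt_top (hg.pow_const p) hint] with x hx
    have h2 : g x ≠ ∞ := fun h => hx.ne (by rw [h, ENNReal.top_rpow_of_pos hp0])
    have h3 := (ENNReal.continuous_rpow_const (y := p)).tendsto 0 |>.comp (hlim x h2)
    rwa [ENNReal.zero_rpow_of_pos hp0] at h3
  rw [lintegral_zero] at h1
  have h4 := (ENNReal.continuous_rpow_const (y := 1 / p)).tendsto 0 |>.comp h1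
  rwa [ENNReal.zero_rpow_of_pos (by positivity)] at h4

theorem weight_ne_zero (α : ℝ) (l : ℕ) : weight α l ≠ 0 :=
  (ENNReal.rpow_pos (by simp) (by simp)).ne'

theorem weight_ne_top (α : ℝ) (l : ℕ) : weight α l ≠ ∞ :=
  ENNReal.rpow_ne_top_of_ne_zero (by simp) (by simp)

theorem admissible_besov (Φ : LittlewoodPaley d) (α : ℝ) (hp : 1 ≤ p) (hq : 1 ≤ q) :
    Admissible Φ (ENNReal.ofReal p) (besov Φ α p q hp hq) fun l => weight α (l + 1) := by
  have hN (f : 𝓢'(Eucl d, ℂ)) : (besov Φ α p q hp hq).toFun f = lebNorm p (absConv Φ.φ₀ f) +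
    seqNorm q fun l => weight α (l + 1) * lebNorm p (absConv (Φ.piece l) f) := rfl
  constructor
  · exact fun l => weight_ne_zero α (l + 1)
  · exact fun l => weight_ne_top α (l + 1)
  · intro f
    rw [eLpNorm_conv_eq_lebNorm hp, hN]
    exact le_self_add
  · intro f l
    rw [eLpNorm_conv_eq_lebNorm hp, hN]
    exact (le_seqNorm hq (fun l => weight α (l + 1) * lebNorm p (absConv (Φ.piece l) f)) l).trans
      le_add_self
  · intro f M hM
    simp only [eLpNorm_conv_eq_lebNorm hp, hN]
    refine add_le_add le_rfl (seqNorm_le_sum hq fun l hl => ?_)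
    rw [absConv_eq_zero (hM l hl), lebNorm_zero hp, mul_zero]
  · intro f hf
    rw [hN] at hf
    simp only [eLpNorm_conv_eq_lebNorm hp, hN]
    refine ⟨fun L => seqNorm q (tailSeq L fun l => weight α (l + 1) *
      lebNorm p (absConv (Φ.piece l) f)), tendsto_seqNorm_tailSeq hq
        (le_add_self.trans_lt hf).ne, fun L l hl => le_seqNorm_tailSeq hq
          (fun l => weight α (l + 1) * lebNorm p (absConv (Φ.piece l) f)) hl,
      fun L g h0 h1 h2 => ?_⟩
    rw [absConv_eq_zero h0, lebNorm_zero hp, zero_add]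
    refine seqNorm_le_tailSeq_add hq (fun l hl => ?_) fun l hl => ?_
    · rw [absConv_eq_zero (h1 l hl), lebNorm_zero hp, mul_zero]
    · rw [absConv_congr (h2 l hl)]

theorem admissible_triebelLizorkin (Φ : LittlewoodPaley d) (α : ℝ) (hp : 1 ≤ p) (hq : 1 ≤ q) :
    Admissible Φ (ENNReal.ofReal p) (triebelLizorkin Φ α p q hp hq)
      fun l => weight α (l + 1) := by
  have hN (f : 𝓢'(Eucl d, ℂ)) : (triebelLizorkin Φ α p q hp hq).toFun f =
    lebNorm p (absConv Φ.φ₀ f) +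
      lebNorm p (fun x => seqNorm q fun l => weight α (l + 1) * absConv (Φ.piece l) f x) := rfl
  have hmeas (f : 𝓢'(Eucl d, ℂ)) (l : ℕ) :
      Measurable fun x => weight α (l + 1) * absConv (Φ.piece l) f x :=
    (measurable_absConv _ f).const_mul _
  have hw (f : 𝓢'(Eucl d, ℂ)) (l : ℕ) : weight α (l + 1) * lebNorm p (absConv (Φ.piece l) f) =
      lebNorm p fun x => weight α (l + 1) * absConv (Φ.piece l) f x :=
    (lebNorm_const_mul hp (weight_ne_top α _) _).symm
  have hmt (f : 𝓢'(Eucl d, ℂ)) (L : ℕ) : Measurable fun x =>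
      seqNorm q (tailSeq L fun l => weight α (l + 1) * absConv (Φ.piece l) f x) := by
    refine measurable_seqNorm fun l => ?_
    simp only [tailSeq]
    split_ifs
    exacts [hmeas f l, measurable_const]
  constructor
  · exact fun l => weight_ne_zero α (l + 1)
  · exact fun l => weight_ne_top α (l + 1)
  · intro f
    rw [eLpNorm_conv_eq_lebNorm hp, hN]
    exact le_self_add
  · intro f l
    rw [eLpNorm_conv_eq_lebNorm hp, hN, hw]
    exact (lebNorm_mono hp fun x =>
      le_seqNorm hq (fun l => weight α (l + 1) * absConv (Φ.piece l) f x) l).trans le_add_self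
  · intro f M hM
    simp only [eLpNorm_conv_eq_lebNorm hp, hN, hw]
    refine add_le_add le_rfl (le_trans (lebNorm_mono hp fun x => ?_)
      (lebNorm_sum_le hp (Finset.range M) (hmeas f)))
    refine seqNorm_le_sum hq fun l hl => ?_
    rw [absConv_eq_zero (hM l hl), mul_zero]
  · intro f hf
    rw [hN] at hf
    simp only [eLpNorm_conv_eq_lebNorm hp, hN, hw]
    refine ⟨fun L => lebNorm p fun x => seqNorm q (tailSeq L fun l => weight α (l + 1) *
      absConv (Φ.piece l) f x), ?_, fun L l hl => lebNorm_mono hp fun x => le_seqNorm_tailSeq hq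
          (fun l => weight α (l + 1) * absConv (Φ.piece l) f x) hl,
      fun L g h0 h1 h2 => ?_⟩
    -- At a point where the full ℓ^q norm is finite its tails tend to 0, and the full norm dominates
    -- them.
    · exact tendsto_lebNorm_zero hp (hmt f) (measurable_seqNorm (hmeas f))
        (fun L x => seqNorm_mono hq (tailSeq_le L _)) (le_add_self.trans_lt hf).ne
        fun x hx => tendsto_seqNorm_tailSeq hq hx
    · rw [absConv_eq_zero h0, lebNorm_zero hp, zero_add]
      refine le_trans (lebNorm_mono hp fun x => seqNorm_le_tailSeq_add hq (fun l hl => ?_)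
        fun l hl => ?_) ((lebNorm_add_le hp (hmt f L) (Finset.measurable_fun_sum _
          fun i _ => hmeas g (L + i))).trans (add_le_add le_rfl
            (lebNorm_sum_le hp (Finset.range 3) fun i => hmeas g (L + i))))
      · rw [absConv_eq_zero (h1 l hl), mul_zero]
      · rw [absConv_congr (h2 l hl)]

end

end BochnerRiesz

open BochnerRiesz in
theorem mainTheorem8 (d : ℕ) (hd : 1 ≤ d) (Φ : LittlewoodPaley d) (δ α p q : ℝ) (hδ : 0 < δ)
    (hp : 1 ≤ p) (hq : 1 ≤ q) :
    (IsBoundedOn δ hδ (triebelLizorkin Φ α p q hp hq) →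
      ∃ T : (triebelLizorkin Φ α p q hp hq).Space →L[ℂ] (triebelLizorkin Φ α p q hp hq).Space,
        IsMeanOn δ hδ (triebelLizorkin Φ α p q hp hq) T ∧
        (∀ T', IsMeanOn δ hδ (triebelLizorkin Φ α p q hp hq) T' → T' = T) ∧
        spectrum ℂ T = (fun t : ℝ => (t : ℂ)) '' Set.Icc 0 1) ∧
    (IsBoundedOn δ hδ (besov Φ α p q hp hq) →
      ∃ T : (besov Φ α p q hp hq).Space →L[ℂ] (besov Φ α p q hp hq).Space,
        IsMeanOn δ hδ (besov Φ α p q hp hq) T ∧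
        (∀ T', IsMeanOn δ hδ (besov Φ α p q hp hq) T' → T' = T) ∧
        spectrum ℂ T = (fun t : ℝ => (t : ℂ)) '' Set.Icc 0 1) := by
  have := fact_one_le_ofReal hp
  exact ⟨(admissible_triebelLizorkin Φ α hp hq).main hd ENNReal.ofReal_ne_top hδ,
    (admissible_besov Φ α hp hq).main hd ENNReal.ofReal_ne_top hδ⟩
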